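/- Let $d\in\{2,3\}$, let $\Omega\subset\mathbb R^d$ be a bounded open convex polytopal domain, and let $k\ge 3$ if $d=2$, $k\ge 5$ if $d=3$. Let $\mathcal T_h$ be a conforming simplicial triangulation of $\Omega$ that is shape regular with constant $\sigma$ (every $T\in\mathcal T_h$ contains a ball of some radius $r>0$ with $h_T:=\operatorname{diam}T\le\sigma r$). Let $W_h$ be the space of continuous functions $v$ on $\overline\Omega$ with $v|_T\in\mathcal P_k(T)$ for all $T\in\mathcal T_h$ which are $C^1$ at all vertices (if $d=2$), respectively $C^1$ on all edges and $C^2$ at all vertices (if $d=3$). Let $V_h=\{v\in W_h: v=0\text{ on }\partial\Omega\}=W_h\cap H^1_0(\Omega)$, and let $V_0$ be the space of continuous piecewise linear functions on $\mathcal T_h$ that vanish on $\partial\Omega$. For $v\in V_h$ let $I_hv\in V_0$ be the nodal interpolant, $I_hv(z)=v(z)$ at all vertices $z$. Degrees of freedom. The $\mathcal P_k$-Hermite ($d=2$) or $\mathcal P_k$-Argyris ($d=3$) degrees of freedom on $W_h$ have the form $$\mathcal N_\alpha(\varphi)=\frac1{|D_\alpha|}\int_{D_\alpha}\nabla^{k_\alpha}\varphi(t_1,\dots,t_{k_\alpha}),$$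 where $D_\alpha$ is a subsimplex of the triangulation or a point (then the average is the value at the point) and the $t_i$ are unit vectors. They are: the values, the first derivatives along a basis of unit vectors, and (if $d=3$) the second derivatives along the pairs from that basis, at each vertex; function values on the subsimplices of dimension $1,\dots,d$; and, if $d=3$, derivatives on each edge along two linearly independent unit vectors normal to the edge. The domains $D_\alpha$ of the last two kinds are fixed in reference coordinates of the subsimplex, once for each dimension (points of the open subsimplex, or the whole subsimplex). They are admissible in the following sense. With $b_m$ the product of the barycentric coordinates of the reference $m$-simplex, the value functionals on an $m$-dimensional subsimplex ($1\le m\le d$) are unisolvent on the polynomials of degree at most $k$ divisible by $b_m^{d+1-m}$. If $d=3$, the carriers of the edge normal derivatives are unisolvent on the univariate polynomials of degree at most $k-1$ divisible by $b_1^2$. Let $\varphi_\alpha\in W_h$ be the nodal basis functions, $\mathcal N_\beta(\varphi_\alpha)=\delta_{\alpha\beta}$, let $\omega_\alpha$ be the union of the $T\in\mathcal T_h$ whose interior meets $\operatorname{supp}\varphi_\alpha$, and let $\#\omega_\alpha$ be their number. Define $\Pi_0$ on $V_0$ by $\Pi_0p=\sum_\alpha\mathcal N_\alpha(\Pi_0p)\,\varphi_\alpha$,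 where $$\mathcal N_\alpha(\Pi_0p)=\frac1{\#\omega_\alpha}\sum_{T\subset\omega_\alpha}\frac1{|D_\alpha|}\int_{D_\alpha}\partial_n(p|_T)\,(n\cdot t_\alpha)\quad\text{if }D_\alpha\subset\partial\Omega\text{ and }k_\alpha=1,$$ $$\mathcal N_\alpha(\Pi_0p)=\frac1{\#\omega_\alpha}\sum_{T\subset\omega_\alpha}\mathcal N_\alpha(p|_T)\quad\text{otherwise.}$$ Here $n$ is the unit outer normal of $\partial\Omega$ on $D_\alpha$; if $D_\alpha\subset\partial\Omega$, $k_\alpha=1$, and the normal is not unique on $D_\alpha$ (a corner or ridge, where gradients of functions in $V_h$ vanish), then $\mathcal N_\alpha(\Pi_0p)=0$. Then there is a constant $C>0$ depending only on $d$, $k$, $\Omega$, the shape regularity constant $\sigma$, and the choice of the reference domains of the degrees of freedom (and not on $\mathcal T_h$, $\lambda$, or $v$) such that for all such triangulations, all $\lambda>0$ and all $v\in V_h$, $$\sum_{T\in\mathcal T_h}(h_T^{-2}+\lambda)^2\,\|v-\Pi_0I_hv\|_{L^2(T)}^2\le C\sum_{T\in\mathcal T_h}(1+\lambda h_T^2)^2\,\|D^2v\|_{L^2(T)}^2,$$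 where $D^2v$ is the elementwise Hessian, measured in the Frobenius norm. -/

import Mathlib

open Geometry MeasureTheory

noncomputable section

namespace C0FEM

/-- Euclidean space `ℝ^d`. -/
abbrev E (d : ℕ) := EuclideanSpace ℝ (Fin d)

/-! ### Domains and triangulations -/

/-- A bounded open convex polytopal domain: the nonempty interior of the convex hull of finitely
many points. -/
def IsConvexPolytopalDomain {d : ℕ} (Ω : Set (E d)) : Prop :=
  Ω.Nonempty ∧ ∃ P : Finset (E d), Ω = interior (convexHull ℝ (P : Set (E d)))

/-- The closed simplex with vertex set `s`. -/
def body {d : ℕ} (s : Finset (E d)) : Set (E d) := convexHull ℝ (s : Set (E d))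

/-- The elements of a simplicial complex in `ℝ^d`: its `d`-dimensional simplices. -/
def cells {d : ℕ} (K : SimplicialComplex ℝ (E d)) : Set (Finset (E d)) :=
  {T | T ∈ K.faces ∧ T.card = d + 1}

/-- `K` is a conforming simplicial triangulation of `Ω`. -/
structure IsTriangulation {d : ℕ} (K : SimplicialComplex ℝ (E d)) (Ω : Set (E d)) : Prop where
  finite : K.faces.Finite
  pure : ∀ s ∈ K.faces, ∃ T ∈ cells K, s ⊆ T
  space_eq : K.space = closure Ω

/-- The diameter `h_T`. -/
def diam {d : ℕ} (T : Finset (E d)) : ℝ := Metric.diam (body T)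

/-- Shape regularity with constant `σ`: every element contains a ball of radius `r > 0` with
`h_T ≤ σ r`. -/
def IsShapeRegular {d : ℕ} (K : SimplicialComplex ℝ (E d)) (σ : ℝ) : Prop :=
  ∀ T ∈ cells K, ∃ (c : E d) (r : ℝ), 0 < r ∧ diam T ≤ σ * r ∧ Metric.closedBall c r ⊆ body T

/-! ### Finite element spaces -/

/-- `v` restricted to every (closed) element is a polynomial of total degree at most `k`. -/
def IsPiecewisePoly {d : ℕ} (K : SimplicialComplex ℝ (E d)) (k : ℕ) (v : E d → ℝ) : Prop :=
  ∀ T ∈ cells K, ∃ p : MvPolynomial (Fin d) ℝ, p.totalDegree ≤ k ∧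
    ∀ x ∈ body T, v x = MvPolynomial.eval (fun i => x i) p

/-- The derivative of order `j` of `v` is single valued at `x`: the derivatives of the polynomial
pieces `v|_T` agree for all elements `T` that contain the simplex `s` (where `x` lies in `s`). -/
def DerivAgree {d : ℕ} (K : SimplicialComplex ℝ (E d)) (j : ℕ) (v : E d → ℝ)
    (s : Finset (E d)) (x : E d) : Prop :=
  ∀ T ∈ cells K, ∀ T' ∈ cells K, s ⊆ T → s ⊆ T' →
    iteratedFDerivWithin ℝ j v (body T) x = iteratedFDerivWithin ℝ j v (body T') x

/-- The `C⁰` Hermite (`d = 2`) or Argyris (`d = 3`) space without boundary condition: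
continuous piecewise polynomials of degree `k` which are `C¹` at all vertices if `d = 2`, and
`C¹` on all edges and `C²` at all vertices if `d = 3`. -/
structure MemW {d : ℕ} (K : SimplicialComplex ℝ (E d)) (Ω : Set (E d)) (k : ℕ) (v : E d → ℝ) :
    Prop where
  cont : ContinuousOn v (closure Ω)
  poly : IsPiecewisePoly K k v
  vertex_C1 : ∀ z, {z} ∈ K.faces → DerivAgree K 1 v {z} z
  edge_C1 : d = 3 → ∀ e ∈ K.faces, e.card = 2 → ∀ x ∈ body e, DerivAgree K 1 v e x
  vertex_C2 : d = 3 → ∀ z, {z} ∈ K.faces → DerivAgree K 2 v {z} z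

/-- The finite element space `V_h`. (A continuous piecewise polynomial function is in
`H¹₀(Ω)` exactly if it vanishes on `∂Ω`.) -/
structure MemV {d : ℕ} (K : SimplicialComplex ℝ (E d)) (Ω : Set (E d)) (k : ℕ) (v : E d → ℝ) :
    Prop extends MemW K Ω k v where
  zero_bdry : ∀ x ∈ frontier Ω, v x = 0

/-- The space `V_0` of continuous piecewise linear functions vanishing on `∂Ω`. -/
structure MemV0 {d : ℕ} (K : SimplicialComplex ℝ (E d)) (Ω : Set (E d)) (p : E d → ℝ) :
    Prop where
  cont : ContinuousOn p (closure Ω)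
  poly : IsPiecewisePoly K 1 p
  zero_bdry : ∀ x ∈ frontier Ω, p x = 0

/-- The nodal interpolant `I_h v`: the element of `V_0` (unique on the closure of `Ω`) that
equals `v` at all vertices. -/
def nodalInterp {d : ℕ} (K : SimplicialComplex ℝ (E d)) (Ω : Set (E d)) (v : E d → ℝ) :
    E d → ℝ :=
  Classical.epsilon fun p => MemV0 K Ω p ∧ ∀ z, {z} ∈ K.faces → p z = v z

/-! ### Degrees of freedom on the reference simplex -/

/-- The reference simplex in `ℝ^m`. -/
def refSimplex (m : ℕ) : Set (Fin m → ℝ) := {t | (∀ i, 0 ≤ t i) ∧ ∑ i, t i ≤ 1}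

/-- The domain `D_α` of a degree of freedom attached to an `m`-dimensional simplex, in reference
coordinates: a point of the simplex, or the whole simplex. -/
inductive Carrier (m : ℕ) : Type
  | point (t : Fin m → ℝ) : Carrier m
  | whole : Carrier m

/-- The integral average over the carrier (evaluation, if the carrier is a point) of a function
given in reference coordinates. -/
def Carrier.avg {m : ℕ} : Carrier m → ((Fin m → ℝ) → ℝ) → ℝ
  | .point t, g => g t
  | .whole, g => ⨍ t in refSimplex m, g t

/-- A point carrier lies in the open simplex. -/
def Carrier.IsInterior {m : ℕ} : Carrier m → Prop
  | .point t => (∀ i, 0 < t i) ∧ ∑ i, t i < 1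
  | .whole => True

/-- The bubble function of the reference simplex: the product of its barycentric coordinates. -/
def bubble (m : ℕ) : MvPolynomial (Fin m) ℝ :=
  (1 - ∑ i, MvPolynomial.X i) * ∏ i, MvPolynomial.X i

/-- The averages over the carriers in `S` determine, uniquely and with arbitrarily prescribed
values, a polynomial of degree at most `k` on the reference simplex that vanishes to order `r`
on all its facets. -/
def IsUnisolventBubble {m : ℕ} (S : Finset (Carrier m)) (r k : ℕ) : Prop :=
  (∀ c ∈ S, c.IsInterior) ∧
  ∀ y : Carrier m → ℝ, ∃! p : MvPolynomial (Fin m) ℝ,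
    p.totalDegree ≤ k ∧ bubble m ^ r ∣ p ∧
      ∀ c ∈ S, c.avg (fun t => MvPolynomial.eval t p) = y c

/-- The choice of the degrees of freedom that are not located at vertices: `val m` are the carriers
of the function values on the `m`-dimensional subsimplices, `nrm` the carriers of the normal
derivatives on the edges (used for `d = 3` only). -/
structure DofChoice where
  val : (m : ℕ) → Finset (Carrier m)
  nrm : Finset (Carrier 1)

/-- The choice is admissible, that is, together with the function values, gradients (and, for
`d = 3`, Hessians) at the vertices the degrees of freedom are those of a finite element of Hermite
(`d = 2`) or Argyris (`d = 3`) type with polynomials of degree `k`. If the data on the boundary of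
an `m`-dimensional subsimplex vanish, then the restriction of the shape function to the subsimplex
vanishes to order `d + 1 - m` on its facets; for `d = 3`, the normal derivatives along an edge
are then polynomials of degree `k - 1` which vanish to order `2` at the end points. -/
structure DofChoice.IsAdmissible (P : DofChoice) (d k : ℕ) : Prop where
  val : ∀ m, 1 ≤ m → m ≤ d → IsUnisolventBubble (P.val m) (d + 1 - m) k
  nrm : d = 3 → IsUnisolventBubble P.nrm 2 (k - 1)

/-! ### Degrees of freedom on the triangulation -/

/-- The point of the `m`-dimensional simplex `s` with reference coordinates `t` (the vertices of
each simplex are enumerated once and for all). -/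
def facePt {d : ℕ} (m : ℕ) (s : Finset (E d)) (t : Fin m → ℝ) : E d :=
  ∑ i : Fin (m + 1), (Fin.cons (1 - ∑ j, t j) t : Fin (m + 1) → ℝ) i • s.toList.getD i 0

/-- The data of a degree of freedom
`N_α(φ) = ⨍_{D_α} ∇^{k_α} φ (t_1, …, t_{k_α})`: an `m`-dimensional simplex `s`, the domain `D_α`
in reference coordinates of `s`, and the list of the directions `t_1, …, t_{k_α}`. -/
structure Dof (d : ℕ) where
  m : ℕ
  s : Finset (E d)
  c : Carrier m
  dirs : List (E d)

/-- The set `D_α`. -/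
def Dof.carrierSet {d : ℕ} (α : Dof d) : Set (E d) :=
  match α.c with
  | .point t => {facePt α.m α.s t}
  | .whole => body α.s

/-- `N_α(φ|_T)`. -/
def Dof.eval {d : ℕ} (α : Dof d) (T : Finset (E d)) (φ : E d → ℝ) : ℝ :=
  α.c.avg fun t =>
    iteratedFDerivWithin ℝ α.dirs.length φ (body T) (facePt α.m α.s t) α.dirs.get

/-- The directions used in the degrees of freedom: `tv z` is a basis of unit vectors at the vertex
`z`, and, for `d = 3`, `te e` consists of two linearly independent unit normal vectors of the
edge `e`. -/
structure IsFrame {d : ℕ} (K : SimplicialComplex ℝ (E d))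
    (tv : E d → Module.Basis (Fin d) ℝ (E d)) (te : Finset (E d) → Fin 2 → E d) : Prop where
  tv_unit : ∀ z, {z} ∈ K.faces → ∀ i, ‖tv z i‖ = 1
  te_unit : d = 3 → ∀ e ∈ K.faces, e.card = 2 → ∀ i, ‖te e i‖ = 1
  te_indep : d = 3 → ∀ e ∈ K.faces, e.card = 2 → LinearIndependent ℝ (te e)
  te_normal : d = 3 → ∀ e ∈ K.faces, e.card = 2 → ∀ i, ∀ x ∈ e, ∀ y ∈ e,
    inner ℝ (te e i) (x - y) = 0

/-- The degrees of freedom of the Hermite (`d = 2`) or Argyris (`d = 3`) element on `K`. -/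
inductive IsDof {d : ℕ} (K : SimplicialComplex ℝ (E d)) (P : DofChoice)
    (tv : E d → Module.Basis (Fin d) ℝ (E d)) (te : Finset (E d) → Fin 2 → E d) : Dof d → Prop
  | vertex_value (z : E d) (hz : {z} ∈ K.faces) :
      IsDof K P tv te ⟨0, {z}, .point 0, []⟩
  | vertex_grad (z : E d) (hz : {z} ∈ K.faces) (i : Fin d) :
      IsDof K P tv te ⟨0, {z}, .point 0, [tv z i]⟩
  | vertex_hess (hd : d = 3) (z : E d) (hz : {z} ∈ K.faces) (i j : Fin d) (hij : i ≤ j) :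
      IsDof K P tv te ⟨0, {z}, .point 0, [tv z i, tv z j]⟩
  | face_value (m : ℕ) (hm : 1 ≤ m) (s : Finset (E d)) (hs : s ∈ K.faces) (hsm : s.card = m + 1)
      (c : Carrier m) (hc : c ∈ P.val m) :
      IsDof K P tv te ⟨m, s, c, []⟩
  | edge_normal (hd : d = 3) (e : Finset (E d)) (he : e ∈ K.faces) (he2 : e.card = 2)
      (c : Carrier 1) (hc : c ∈ P.nrm) (i : Fin 2) :
      IsDof K P tv te ⟨1, e, c, [te e i]⟩

section Transfer

variable {d : ℕ} (K : SimplicialComplex ℝ (E d)) (Ω : Set (E d)) (k : ℕ) (P : DofChoice)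
  (tv : E d → Module.Basis (Fin d) ℝ (E d)) (te : Finset (E d) → Fin 2 → E d)

open Classical in
/-- `φ` is a nodal basis function for `α`: `N_β(φ) = δ_{αβ}` for all degrees of freedom `β`. -/
def IsNodal (α : Dof d) (φ : E d → ℝ) : Prop :=
  MemW K Ω k φ ∧ ∀ β, IsDof K P tv te β → ∀ T ∈ cells K, β.s ⊆ T →
    β.eval T φ = if β = α then 1 else 0

/-- The nodal basis function `φ_α` (unique on the closure of `Ω`). -/
def nodalBasis (α : Dof d) : E d → ℝ := Classical.epsilon (IsNodal K Ω k P tv te α)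

/-- The elements that make up the patch `ω_α`: those whose interior meets the support
of `φ_α`. -/
def patch (α : Dof d) : Set (Finset (E d)) :=
  {T | T ∈ cells K ∧ (interior (body T) ∩ tsupport (nodalBasis K Ω k P tv te α)).Nonempty}

/-- `n` is a unit outer normal vector of the convex set `Ω` at all points of `D`. -/
def IsOuterNormal (D : Set (E d)) (n : E d) : Prop :=
  ‖n‖ = 1 ∧ ∀ x ∈ D, ∀ y ∈ Ω, inner ℝ n (y - x) ≤ 0

/-- `(1 / #ω_α) ∑_{T ⊂ ω_α} f T`. -/
def patchMean (α : Dof d) (f : Finset (E d) → ℝ) : ℝ :=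
  (1 / ((patch K Ω k P tv te α).ncard : ℝ)) * ∑ᶠ T ∈ patch K Ω k P tv te α, f T

open Classical in
/-- The value `N_α(Π_0 p)`. For a first order degree of freedom with `D_α ⊂ ∂Ω` it is the mean of
`⨍_{D_α} ∂_n(p|_T) (n · t_α)`; if `D_α` has no well-defined normal (it lies on a ridge or at
a corner of `∂Ω`, where the gradients of functions in `V_h` are zero), the value is `0`. In all
other cases it is the mean of `N_α(p|_T)`. -/
def transferValue (p : E d → ℝ) (α : Dof d) : ℝ :=
  match α.dirs with
  | [t] =>
    if α.carrierSet ⊆ frontier Ω then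
      if h : ∃! n, IsOuterNormal Ω α.carrierSet n then
        patchMean K Ω k P tv te α fun T =>
          α.c.avg fun y =>
            fderivWithin ℝ p (body T) (facePt α.m α.s y) h.choose * inner ℝ h.choose t
      else 0
    else patchMean K Ω k P tv te α fun T => α.eval T p
  | _ => patchMean K Ω k P tv te α fun T => α.eval T p

/-- The transfer operator `Π_0 p = ∑_α N_α(Π_0 p) φ_α`. -/
def transfer (p : E d → ℝ) : E d → ℝ := fun x =>
  ∑ᶠ (α : Dof d) (_ : IsDof K P tv te α),
    transferValue K Ω k P tv te p α * nodalBasis K Ω k P tv te α x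

end Transfer

/-! ### Norms -/

/-- `‖v‖²_{L²(T)}`. -/
def l2Sq {d : ℕ} (T : Finset (E d)) (v : E d → ℝ) : ℝ := ∫ x in body T, v x ^ 2

/-- `‖D²v‖²_{L²(T)}`, with the Frobenius norm of the Hessian of `v|_T`. -/
def hessL2Sq {d : ℕ} (T : Finset (E d)) (v : E d → ℝ) : ℝ :=
  ∫ x in body T, ∑ i : Fin d, ∑ j : Fin d,
    (iteratedFDerivWithin ℝ 2 v (body T) x
      ![EuclideanSpace.single i 1, EuclideanSpace.single j 1]) ^ 2

end C0FEM

end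

/-! The estimate is local: on a cell `T` the squared error is at most a constant times the sum of
`h_{T'}^4 ‖D²v‖²_{L²(T')}` over the cells `T'` that share a vertex with `T`
(`exists_local_estimate`). Cells with a common vertex have comparable diameters (`exists_diam_le`),
and a bounded number of cells meets in a vertex (`exists_card_cells_le`). Hence the weights can be
moved from `T` to `T'` (`weight_mul_le`), and the local estimates can be summed.

For the local estimate let `p` be the nodal interpolant of `v`. The derivatives of `v` that occur in
the degrees of freedom are single valued, so a degree of freedom of `v` is the mean over the patch
of the degrees of freedom of its pieces. On the boundary, `v = 0` forces `∇v = (∂_n v) n`, and `∇v =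
0` where the normal is not unique (`deriv_eq_normal`, `deriv_eq_zero_of_two_normals`); this matches
the modified definition of `Π₀` there. Consequently each degree of freedom of `v - Π₀ p` is a mean
of quantities computed from `v - p` on the cells of the patch (`exists_gradient_error`,
`exists_mean_error`). On every cell `v - p` vanishes at the vertices and has the same Hessian as
`v`, so it is bounded by the Hessian, together with its derivatives up to order two
(`exists_jetBound`).

What remains is stability: a polynomial on a cell is bounded by its scaled degrees of freedom
(`exists_stability`). Normal derivatives are not preserved by affine maps, and the frames of
directions may be arbitrarily ill conditioned, so a plain scaling argument is not available.
Instead, derivative data are kept as linear or bilinear forms in arbitrary directions (`DofBound`,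
`DofBound.of_frame`), and the bound climbs from vertices to edges, triangles and tetrahedra. At each
level it is unisolvence on the bubble space of the reference simplex, made quantitative by a duality
argument in finite dimension (`exists_bound_of_separating`).

The nodal basis and the interpolant are defined by choice, so their existence must be proved as
well: `exists_isNodal` interpolates on each cell by elimination and glues, and `exists_nodalInterp`
uses convexity of `Ω` for the boundary values. -/

noncomputable section

namespace C0FEM

open MvPolynomial

/-- Polynomials in `d` variables. -/
abbrev Poly (d : ℕ) := MvPolynomial (Fin d) ℝ

theorem totalDegree_le_iff_degree_le {σ : Type*} {n : ℕ} {p : MvPolynomial σ ℝ} :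
    p.totalDegree ≤ n ↔ ∀ s ∈ p.support, s.degree ≤ n := by
  simp only [totalDegree, Finset.sup_le_iff, Finsupp.degree, Finsupp.sum]
  rfl

/-! ### Directional derivatives of polynomials and orders of vanishing -/

section Derivations

variable {d : ℕ}

/-- The derivative of polynomials in the direction `t`. -/
def dd (t : Fin d → ℝ) : Derivation ℝ (Poly d) (Poly d) :=
  mkDerivation ℝ fun i => C (t i)

@[simp] theorem dd_X (t : Fin d → ℝ) (i : Fin d) : dd t (X i) = C (t i) :=
  mkDerivation_X ℝ _ i

@[simp] theorem dd_C (t : Fin d → ℝ) (a : ℝ) : dd t (C a) = 0 :=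
  derivation_C _ a

theorem dd_eq_sum (t : Fin d → ℝ) (p : Poly d) :
    dd t p = ∑ i, C (t i) * pderiv i p := by
  have : dd t = ∑ i, (C (t i) : Poly d) • pderiv i := by
    apply derivation_ext
    intro i
    classical
    rw [dd_X, ← Derivation.coeFnAddMonoidHom_apply, map_sum, Finset.sum_apply]
    simp [pderiv_X, Pi.single_apply]
  rw [this, ← Derivation.coeFnAddMonoidHom_apply, map_sum, Finset.sum_apply]
  simp

theorem dd_add (t u : Fin d → ℝ) (p : Poly d) : dd (t + u) p = dd t p + dd u p := by
  simp only [dd_eq_sum, Pi.add_apply, map_add, add_mul, Finset.sum_add_distrib]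

theorem dd_smul (a : ℝ) (t : Fin d → ℝ) (p : Poly d) : dd (a • t) p = C a * dd t p := by
  simp only [dd_eq_sum, Pi.smul_apply, smul_eq_mul, map_mul, Finset.mul_sum, mul_assoc]

theorem dd_single (i : Fin d) (p : Poly d) : dd (Pi.single i 1) p = pderiv i p := by
  classical
  rw [dd_eq_sum, Finset.sum_eq_single i]
  · simp
  · intro j _ hj
    simp [hj]
  · simp

theorem dd_comm (t u : Fin d → ℝ) (p : Poly d) : dd t (dd u p) = dd u (dd t p) := by
  have h : ⁅dd t, dd u⁆ = 0 := by
    apply derivation_ext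
    intro i
    rw [Derivation.commutator_apply]
    simp
  have := congrArg (fun D => D p) h
  simp only [Derivation.commutator_apply, Derivation.coe_zero, Pi.zero_apply] at this
  exact sub_eq_zero.1 this

theorem totalDegree_pderiv_le (i : Fin d) (p : Poly d) :
    (pderiv i p).totalDegree ≤ p.totalDegree - 1 := by
  rw [totalDegree_le_iff_degree_le]
  intro m hm
  rw [mem_support_iff, coeff_pderiv] at hm
  have h1 : m + Finsupp.single i 1 ∈ p.support := by
    rw [mem_support_iff]
    exact fun h => hm (by rw [h, zero_mul])
  have h2 := totalDegree_le_iff_degree_le.1 le_rfl _ h1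
  simp at h2
  omega

theorem totalDegree_dd_le (t : Fin d → ℝ) (p : Poly d) :
    (dd t p).totalDegree ≤ p.totalDegree - 1 := by
  rw [dd_eq_sum]
  refine totalDegree_finsetSum_le fun i _ => ?_
  refine (totalDegree_mul _ _).trans ?_
  simpa using totalDegree_pderiv_le i p

/-- Iterated directional derivatives. -/
def dl : List (Fin d → ℝ) → Poly d →ₗ[ℝ] Poly d
  | [] => LinearMap.id
  | t :: l => (dd t).toLinearMap ∘ₗ dl l

@[simp] theorem dl_nil (p : Poly d) : dl [] p = p := rfl

@[simp] theorem dl_cons (t : Fin d → ℝ) (l : List (Fin d → ℝ)) (p : Poly d) :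
    dl (t :: l) p = dd t (dl l p) := rfl

theorem totalDegree_dl_le (l : List (Fin d → ℝ)) (p : Poly d) :
    (dl l p).totalDegree ≤ p.totalDegree := by
  induction l with
  | nil => simp
  | cons t l ih => exact (totalDegree_dd_le _ _).trans (by omega)

/-- The ideal of polynomials that vanish at `x`. -/
def vanish (x : Fin d → ℝ) : Ideal (Poly d) := RingHom.ker (eval x)

theorem mem_vanish {x : Fin d → ℝ} {p : Poly d} : p ∈ vanish x ↔ eval x p = 0 := Iff.rfl

/-- By the Leibniz rule a derivation lowers the order of vanishing by at most one. Orders of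
vanishing are expressed as powers of the maximal ideal at `x`, so that the orders of the factors of
a product add up by ideal multiplication. -/
theorem dd_mem_vanish_pow {x : Fin d → ℝ} {n : ℕ} {p : Poly d} (hp : p ∈ vanish x ^ (n + 1))
    (t : Fin d → ℝ) : dd t p ∈ vanish x ^ n := by
  induction n generalizing p with
  | zero => simp
  | succ n ih =>
    rw [pow_succ] at hp
    refine Submodule.mul_induction_on hp ?_ ?_
    · intro a ha b hb
      rw [Derivation.leibniz]
      refine Ideal.add_mem _ (Ideal.mul_mem_right _ _ ha) ?_
      rw [smul_eq_mul, mul_comm, pow_succ]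
      exact Ideal.mul_mem_mul (ih ha) hb
    · intro a b ha hb
      rw [map_add]
      exact Ideal.add_mem _ ha hb

theorem eval_dl_eq_zero {x : Fin d → ℝ} {n : ℕ} {p : Poly d} (hp : p ∈ vanish x ^ n)
    {l : List (Fin d → ℝ)} (hl : l.length < n) : eval x (dl l p) = 0 := by
  have key : ∀ l : List (Fin d → ℝ), ∀ n, p ∈ vanish x ^ (n + l.length) →
      dl l p ∈ vanish x ^ n := by
    intro l
    induction l with
    | nil => intro n h; simpa using h
    | cons t l ih =>
      intro n h
      exact dd_mem_vanish_pow (ih (n + 1) (by simpa [add_assoc, add_comm 1] using h)) t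
  have h1 := key l (n - l.length) (by rwa [Nat.sub_add_cancel hl.le])
  have h2 : vanish x ^ (n - l.length) ≤ vanish x := Ideal.pow_le_self (by omega)
  exact mem_vanish.1 (h2 h1)

end Derivations

/-! ### Affine substitutions in polynomials -/

section Substitution

variable {m d : ℕ}

theorem totalDegree_bind₁_le {f : Fin d → Poly m} (hf : ∀ i, (f i).totalDegree ≤ 1)
    (p : Poly d) : (bind₁ f p).totalDegree ≤ p.totalDegree := by
  conv_lhs => rw [p.as_sum]
  rw [map_sum]
  refine totalDegree_finsetSum_le fun s hs => ?_
  rw [bind₁_monomial]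
  refine (totalDegree_mul _ _).trans ?_
  rw [totalDegree_C, zero_add]
  refine (totalDegree_finsetProd _ _).trans ?_
  refine le_trans ?_ (le_totalDegree hs)
  rw [Finsupp.sum]
  refine Finset.sum_le_sum fun i _ => ?_
  refine (totalDegree_pow _ _).trans ?_
  calc s i * (f i).totalDegree ≤ s i * 1 := Nat.mul_le_mul_left _ (hf i)
    _ = s i := mul_one _

theorem eval_bind₁ (f : Fin d → Poly m) (p : Poly d) (t : Fin m → ℝ) :
    eval t (bind₁ f p) = eval (fun i => eval t (f i)) p := by
  induction p using MvPolynomial.induction_on with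
  | C a => simp
  | add p q hp hq => simp [hp, hq]
  | mul_X p i hp => simp [hp]

theorem dd_bind₁ (f : Fin d → Poly m) (t : Fin m → ℝ) (u : Fin d → ℝ)
    (h : ∀ i, dd t (f i) = C (u i)) (p : Poly d) : dd t (bind₁ f p) = bind₁ f (dd u p) := by
  induction p using MvPolynomial.induction_on with
  | C a => simp
  | add p q hp hq => simp [hp, hq]
  | mul_X p i hp => simp [hp, h, Derivation.leibniz]

/-- Modulo `l` the substitution fixes the variables, hence every polynomial. This is the algebraic
half of the factor theorem for hyperplanes. -/
theorem dvd_sub_bind₁ {l : Poly d} {f : Fin d → Poly d} (h : ∀ i, l ∣ X i - f i) (p : Poly d) :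
    l ∣ p - bind₁ f p := by
  induction p using MvPolynomial.induction_on with
  | C a => simp
  | add p q hp hq =>
    rw [map_add]
    have := dvd_add hp hq
    convert this using 1
    ring
  | mul_X p i hp =>
    have := dvd_add (hp.mul_right (X i)) ((h i).mul_left (bind₁ f p))
    convert this using 1
    rw [map_mul, bind₁_X_right]
    ring

end Substitution

/-! ### Coefficient bounds and the duality argument behind all constants -/

section Bounds

/-- The exponents of total degree at most `k`. -/
def mons (m k : ℕ) : Finset (Fin m →₀ ℕ) :=
  (Finsupp.finite_of_degree_le (σ := Fin m) k).toFinset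

theorem mem_mons {m k : ℕ} {s : Fin m →₀ ℕ} : s ∈ mons m k ↔ s.degree ≤ k := by
  simp [mons]

theorem support_subset_mons {m k : ℕ} {p : Poly m} (hp : p.totalDegree ≤ k) :
    p.support ⊆ mons m k := fun _ hs =>
  mem_mons.2 ((totalDegree_le_iff_degree_le.1 hp) _ hs)

/-- All coefficients of `p` are bounded by `M`. -/
def CoefBound {m : ℕ} (p : Poly m) (M : ℝ) : Prop := ∀ s, |coeff s p| ≤ M

theorem CoefBound.nonneg {m : ℕ} {p : Poly m} {M : ℝ} (h : CoefBound p M) : 0 ≤ M :=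
  (abs_nonneg _).trans (h 0)

theorem CoefBound.mono {m : ℕ} {p : Poly m} {M N : ℝ} (h : CoefBound p M) (hMN : M ≤ N) :
    CoefBound p N := fun s => (h s).trans hMN

theorem CoefBound.abs_eval_le {m k : ℕ} {p : Poly m} {M : ℝ} (h : CoefBound p M)
    (hp : p.totalDegree ≤ k) {t : Fin m → ℝ} (ht : ∀ i, |t i| ≤ 1) :
    |eval t p| ≤ (mons m k).card * M := by
  rw [eval_eq]
  refine (Finset.abs_sum_le_sum_abs _ _).trans ?_
  calc ∑ s ∈ p.support, |coeff s p * ∏ i ∈ s.support, t i ^ s i|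
      ≤ ∑ s ∈ p.support, M := by
        refine Finset.sum_le_sum fun s _ => ?_
        rw [abs_mul]
        refine (mul_le_of_le_one_right (abs_nonneg _) ?_).trans (h s)
        rw [Finset.abs_prod]
        refine Finset.prod_le_one (fun _ _ => abs_nonneg _) fun i _ => ?_
        rw [abs_pow]
        exact pow_le_one₀ (abs_nonneg _) (ht i)
    _ = p.support.card * M := by simp
    _ ≤ (mons m k).card * M := by
        have := Finset.card_le_card (support_subset_mons hp)
        have h0 := h.nonneg
        gcongr

theorem CoefBound.pderiv {m k : ℕ} {p : Poly m} {M : ℝ} (h : CoefBound p M)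
    (hp : p.totalDegree ≤ k) (i : Fin m) : CoefBound (MvPolynomial.pderiv i p) (k * M) := by
  intro s
  rw [coeff_pderiv]
  have h0 := h.nonneg
  by_cases hs : coeff (s + Finsupp.single i 1) p = 0
  · rw [hs, zero_mul, abs_zero]
    positivity
  · have h1 := (totalDegree_le_iff_degree_le.1 hp) _ (mem_support_iff.2 hs)
    have h2 : s i ≤ s.degree := Finsupp.le_degree i s
    have h3 : ((s i + 1 : ℕ) : ℝ) ≤ k := by
      norm_cast
      simp at h1
      omega
    rw [abs_mul, mul_comm]
    push_cast at h3
    have h4 : |(s i : ℝ) + 1| ≤ k := by rwa [abs_of_nonneg (by positivity)]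
    have := h (s + Finsupp.single i 1)
    gcongr

theorem CoefBound.dd {m k : ℕ} {p : Poly m} {M A : ℝ} (h : CoefBound p M)
    (hp : p.totalDegree ≤ k) {t : Fin m → ℝ} (ht : ∀ i, |t i| ≤ A) (hA : 0 ≤ A) :
    CoefBound (dd t p) (A * (m * (k * M))) := by
  intro s
  rw [dd_eq_sum, coeff_sum]
  refine (Finset.abs_sum_le_sum_abs _ _).trans ?_
  calc ∑ i, |coeff s (C (t i) * MvPolynomial.pderiv i p)| ≤ ∑ _i : Fin m, A * (k * M) := by
        refine Finset.sum_le_sum fun i _ => ?_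
        rw [coeff_C_mul, abs_mul]
        have h1 := ht i
        have h2 := h.pderiv hp i s
        gcongr
    _ = A * (m * (k * M)) := by simp; ring

/-- If finitely or infinitely many functionals have no common zero in a finite-dimensional space,
then every functional is bounded by them. -/
theorem exists_bound_of_separating {V ι : Type*} [AddCommGroup V] [Module ℝ V]
    [FiniteDimensional ℝ V] (ℓ : ι → Module.Dual ℝ V) (w : ι → ℝ) (hw : ∀ i, 0 ≤ w i)
    (h : ∀ v, (∀ i, ℓ i v = 0) → v = 0) (φ : Module.Dual ℝ V) :
    ∃ C : ℝ, 0 ≤ C ∧ ∀ (v : V) (M : ℝ), (∀ i, |ℓ i v| ≤ w i * M) → |φ v| ≤ C * M := by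
  -- In finite dimension a family without common zero spans the dual space. Thus `φ` is a finite
  -- combination of the `ℓ i`, even if the family is infinite, and `C` is read off from this
  -- combination.
  have hW : Submodule.span ℝ (Set.range ℓ) = ⊤ := by
    set W := Submodule.span ℝ (Set.range ℓ)
    have h1 : W.dualCoannihilator = ⊥ := by
      rw [eq_bot_iff]
      intro v hv
      rw [Submodule.mem_dualCoannihilator] at hv
      exact h v fun i => hv _ (Submodule.subset_span ⟨i, rfl⟩)
    rw [← Subspace.dualCoannihilator_dualAnnihilator_eq (W := W), h1,
      Submodule.dualAnnihilator_bot]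
  have hφ : φ ∈ Submodule.span ℝ (Set.range ℓ) := hW ▸ Submodule.mem_top
  obtain ⟨c, hc⟩ := (Finsupp.mem_span_range_iff_exists_finsupp).1 hφ
  refine ⟨∑ i ∈ c.support, |c i| * w i, Finset.sum_nonneg fun i _ =>
    mul_nonneg (abs_nonneg _) (hw i), fun v M hv => ?_⟩
  rw [← hc, Finsupp.sum, LinearMap.sum_apply, Finset.sum_mul]
  refine (Finset.abs_sum_le_sum_abs _ _).trans (Finset.sum_le_sum fun i _ => ?_)
  rw [LinearMap.smul_apply, smul_eq_mul, abs_mul, mul_assoc]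
  exact mul_le_mul_of_nonneg_left (hv i) (abs_nonneg _)

/-- The duality bound is applied to each coefficient functional, and the finitely many constants are
added. A weight `w i = 0` encodes the exact condition `ℓ i p = 0`. -/
theorem exists_coefBound_of_separating {m k : ℕ} {ι : Type*} (ℓ : ι → Poly m →ₗ[ℝ] ℝ)
    (w : ι → ℝ) (hw : ∀ i, 0 ≤ w i)
    (h : ∀ p : Poly m, p.totalDegree ≤ k → (∀ i, ℓ i p = 0) → p = 0) :
    ∃ C : ℝ, 0 ≤ C ∧ ∀ p : Poly m, p.totalDegree ≤ k → ∀ M : ℝ, 0 ≤ M →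
      (∀ i, |ℓ i p| ≤ w i * M) → CoefBound p (C * M) := by
  let V := restrictTotalDegree (Fin m) ℝ k
  have key := fun s : Fin m →₀ ℕ => exists_bound_of_separating (V := V)
    (fun i => ℓ i ∘ₗ V.subtype) w hw
    (fun v hv => Subtype.ext (h v.1 ((mem_restrictTotalDegree _ _ _).1 v.2) hv))
    (lcoeff ℝ s ∘ₗ V.subtype)
  choose c hc0 hc using key
  refine ⟨∑ s ∈ mons m k, c s, Finset.sum_nonneg fun s _ => hc0 s, fun p hp M hM hpM s => ?_⟩
  by_cases hs : s ∈ mons m k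
  · refine (hc s ⟨p, (mem_restrictTotalDegree _ _ _).2 hp⟩ M hpM).trans ?_
    exact mul_le_mul_of_nonneg_right (Finset.single_le_sum (fun s _ => hc0 s) hs) hM
  · have : coeff s p = 0 := by
      by_contra h0
      exact hs (support_subset_mons hp (mem_support_iff.2 h0))
    rw [this, abs_zero]
    exact mul_nonneg (Finset.sum_nonneg fun s _ => hc0 s) hM

end Bounds

/-! ### Averages, divisibility by bubbles and unisolvence on the reference simplex -/

section ReferenceSimplex

variable {m : ℕ}

theorem isCompact_refSimplex (m : ℕ) : IsCompact (refSimplex m) := by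
  have h1 : IsClosed (refSimplex m) := by
    have : refSimplex m = {t | ∀ i, 0 ≤ t i} ∩ {t | ∑ i, t i ≤ 1} := rfl
    rw [this]
    refine IsClosed.inter ?_ (isClosed_le (by fun_prop) (by fun_prop))
    simp only [Set.ofPred_forall]
    exact isClosed_iInter fun i => isClosed_le (by fun_prop) (by fun_prop)
  refine IsCompact.of_isClosed_subset (isCompact_univ_pi (s := fun _ : Fin m => Set.Icc (0 : ℝ) 1)
    fun _ => isCompact_Icc) h1 ?_
  intro t ht i _
  exact ⟨ht.1 i, (Finset.single_le_sum (fun j _ => ht.1 j) (Finset.mem_univ i)).trans ht.2⟩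

theorem abs_le_one_of_mem_refSimplex {t : Fin m → ℝ} (ht : t ∈ refSimplex m) (i : Fin m) :
    |t i| ≤ 1 := by
  rw [abs_of_nonneg (ht.1 i)]
  exact (Finset.single_le_sum (fun j _ => ht.1 j) (Finset.mem_univ i)).trans ht.2

theorem continuous_eval_poly (p : Poly m) : Continuous fun t : Fin m → ℝ => eval t p :=
  MvPolynomial.continuous_eval p

theorem integrableOn_refSimplex {f : (Fin m → ℝ) → ℝ} (hf : Continuous f) :
    IntegrableOn f (refSimplex m) :=
  hf.continuousOn.integrableOn_compact (isCompact_refSimplex m)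

theorem integrableOn_eval (p : Poly m) : IntegrableOn (fun t => eval t p) (refSimplex m) :=
  integrableOn_refSimplex (continuous_eval_poly p)

/-- The average over a carrier as a linear functional on polynomials. -/
def Carrier.avgL (c : Carrier m) : Poly m →ₗ[ℝ] ℝ where
  toFun p := c.avg fun t => eval t p
  map_add' p q := by
    cases c with
    | point t => simp [Carrier.avg]
    | whole =>
      simp only [Carrier.avg, setAverage_eq, map_add]
      rw [integral_add (integrableOn_eval p) (integrableOn_eval q), smul_add]
  map_smul' a p := by
    cases c with
    | point t => simp [Carrier.avg]
    | whole =>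
      simp only [Carrier.avg, setAverage_eq, MvPolynomial.smul_eval, integral_const_mul,
        RingHom.id_apply, smul_eq_mul]
      ring

theorem Carrier.avgL_apply (c : Carrier m) (p : Poly m) :
    c.avgL p = c.avg fun t => eval t p := rfl

theorem Carrier.abs_avg_le {c : Carrier m} (hc : c.IsInterior) {g : (Fin m → ℝ) → ℝ} {B : ℝ}
    (hB : 0 ≤ B) (hg : ∀ t ∈ refSimplex m, |g t| ≤ B) : |c.avg g| ≤ B := by
  cases c with
  | point t => exact hg t ⟨fun i => (hc.1 i).le, hc.2.le⟩
  | whole =>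
    have hfin : volume (refSimplex m) < ⊤ := (isCompact_refSimplex m).measure_lt_top
    have h1 : ‖∫ t in refSimplex m, g t‖ ≤ B * volume.real (refSimplex m) :=
      norm_setIntegral_le_of_norm_le_const hfin hg
    simp only [Carrier.avg, setAverage_eq, smul_eq_mul, abs_mul, abs_inv]
    rw [Real.norm_eq_abs] at h1
    have h0 : 0 ≤ volume.real (refSimplex m) := measureReal_nonneg
    rw [abs_of_nonneg h0]
    rcases h0.eq_or_lt with h | h
    · rw [← h]; simpa using hB
    · rw [inv_mul_le_iff₀ h]
      linarith

theorem Carrier.avg_congr {c : Carrier m} (hc : c.IsInterior) {f g : (Fin m → ℝ) → ℝ}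
    (h : ∀ t ∈ refSimplex m, f t = g t) : c.avg f = c.avg g := by
  cases c with
  | point t => exact h t ⟨fun i => (hc.1 i).le, hc.2.le⟩
  | whole =>
    simp only [Carrier.avg, setAverage_eq]
    rw [setIntegral_congr_fun (isCompact_refSimplex m).isClosed.measurableSet h]

/-- The boundary of the reference simplex. -/
def refBdry (m : ℕ) : Set (Fin m → ℝ) :=
  {t | t ∈ refSimplex m ∧ ((∃ i, t i = 0) ∨ ∑ i, t i = 1)}

theorem Icc_infinite' (m : ℕ) : (Set.Icc (0 : ℝ) (1 / (m + 1))).Infinite :=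
  Set.Icc_infinite (by positivity)

/-- The box `[0, 1/(m+1)]^m` lies in the reference simplex. As a product of infinite sets it
suffices to test whether a polynomial is zero. -/
theorem sum_le_one_of_box {t : Fin m → ℝ} (ht : ∀ i, t i ≤ 1 / (m + 1)) : ∑ i, t i ≤ 1 := by
  calc ∑ i, t i ≤ ∑ _i : Fin m, (1 / (m + 1) : ℝ) := Finset.sum_le_sum fun i _ => ht i
    _ = m / (m + 1) := by simp; ring
    _ ≤ 1 := by rw [div_le_one (by positivity)]; linarith

/-- Factor theorem: `f` maps the box to the hyperplane `l = 0`, where `q` is known to vanish, so `q`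
composed with `f` is the zero polynomial, while it is congruent to `q` modulo `l`. -/
theorem dvd_of_eval_bind₁_eq_zero {l q : Poly m} {f : Fin m → Poly m}
    (hf : ∀ i, l ∣ X i - f i)
    (h : ∀ t : Fin m → ℝ, (∀ i, 0 ≤ t i) → (∀ i, t i ≤ 1 / (m + 1)) →
      eval (fun i => eval t (f i)) q = 0) : l ∣ q := by
  have h0 : bind₁ f q = 0 := by
    refine funext_set (fun _ : Fin m => Set.Icc (0 : ℝ) (1 / (m + 1)))
      (fun _ => Icc_infinite' m) fun t ht => ?_
    rw [eval_bind₁, map_zero]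
    exact h t (fun i => (ht i trivial).1) fun i => (ht i trivial).2
  have := dvd_sub_bind₁ hf q
  rwa [h0, sub_zero] at this

theorem X_dvd_of_eval_eq_zero {q : Poly m} {i : Fin m}
    (h : ∀ t ∈ refBdry m, eval t q = 0) : (X i : Poly m) ∣ q := by
  classical
  refine dvd_of_eval_bind₁_eq_zero (f := fun j => if j = i then 0 else X j) ?_ ?_
  · intro j
    by_cases hj : j = i
    · simp [hj]
    · simp [hj]
  · intro t h0 h1
    refine h _ ⟨⟨fun j => ?_, sum_le_one_of_box fun j => ?_⟩, Or.inl ⟨i, by simp⟩⟩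
    · by_cases hj : j = i <;> simp [hj, h0]
    · by_cases hj : j = i
      · simp only [hj, if_true, map_zero]; positivity
      · simpa [hj] using h1 j

theorem one_sub_sum_dvd_of_eval_eq_zero {q : Poly m} (hm : 1 ≤ m)
    (h : ∀ t ∈ refBdry m, eval t q = 0) : (1 - ∑ i, X i : Poly m) ∣ q := by
  classical
  let i : Fin m := ⟨0, hm⟩
  -- Projection along one axis onto the oblique facet: the coordinate `i` becomes one minus the sum
  -- of the other coordinates.
  refine dvd_of_eval_bind₁_eq_zero
    (f := fun j => if j = i then X i + (1 - ∑ i, X i) else X j) ?_ ?_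
  · intro j
    by_cases hj : j = i
    · simp only [hj, if_true]
      exact ⟨-1, by ring⟩
    · simp [hj]
  · intro t h0 h1
    have hsum : ∑ j, eval t (if j = i then X i + (1 - ∑ i, X i) else X j : Poly m) = 1 := by
      rw [← Finset.add_sum_erase _ _ (Finset.mem_univ i)]
      have : ∑ j ∈ Finset.univ.erase i, eval t (if j = i then X i + (1 - ∑ i, X i) else X j : Poly m)
          = ∑ j ∈ Finset.univ.erase i, t j := by
        refine Finset.sum_congr rfl fun j hj => ?_
        simp [Finset.ne_of_mem_erase hj]
      rw [this]
      have h2 := Finset.add_sum_erase Finset.univ t (Finset.mem_univ i)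
      simp only [if_true, map_add, map_sub, map_one, map_sum, eval_X]
      linarith
    refine h _ ⟨⟨fun j => ?_, hsum.le⟩, Or.inr hsum⟩
    by_cases hj : j = i
    · have h2 := sum_le_one_of_box h1
      simp only [hj, if_true, map_add, map_sub, map_one, map_sum, eval_X]
      linarith [h0 i]
    · simpa [hj] using h0 j

/-- If `p = l ^ r * u` and `t` is transversal to `l = 0`, then modulo `l ^ r` the derivative of `p`
along `t` is `r a l ^ (r - 1) u`. If it is divisible by `l ^ r`, then `l` divides `u`, because `r a`
is invertible in characteristic zero. -/
theorem pow_dvd_of_dvd_dl {l : Poly m} {t : Fin m → ℝ} {a : ℝ} (ha : a ≠ 0)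
    (hl : dd t l = C a) : ∀ (r : ℕ) (p : Poly m),
      (∀ j < r, l ∣ dl (List.replicate j t) p) → l ^ r ∣ p := by
  have hl0 : l ≠ 0 := by
    rintro rfl
    rw [map_zero] at hl
    exact ha (by simpa using hl.symm)
  have hrep : ∀ j (p : Poly m), dl (List.replicate j t) (dd t p)
      = dl (List.replicate (j + 1) t) p := by
    intro j
    induction j with
    | zero => intro p; rfl
    | succ j ih => intro p; rw [List.replicate_succ, dl_cons, ih]; rfl
  intro r
  induction r with
  | zero => intro p _; simp
  | succ r ih =>
    intro p hp
    have h1 : l ^ r ∣ p := ih p fun j hj => hp j (by omega)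
    have h2 : l ^ r ∣ dd t p := ih _ fun j hj => by rw [hrep]; exact hp _ (by omega)
    rcases Nat.eq_zero_or_pos r with rfl | hr
    · simpa using hp 0 (by omega)
    · obtain ⟨u, rfl⟩ := h1
      obtain ⟨n, rfl⟩ : ∃ n, r = n + 1 := ⟨r - 1, by omega⟩
      rw [Derivation.leibniz, Derivation.leibniz_pow, hl, Nat.add_sub_cancel] at h2
      have h3 : l ^ (n + 1) ∣ u • ((n + 1) • l ^ n • (C a : Poly m)) :=
        (dvd_add_right (by rw [smul_eq_mul]; exact dvd_mul_right _ _)).1 h2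
      have h4 : l ^ n * l ∣ l ^ n * (C (a * (n + 1)) * u) := by
        rw [← pow_succ]
        convert h3 using 1
        simp only [smul_eq_mul, nsmul_eq_mul, map_mul, map_add, map_natCast, map_one]
        push_cast
        ring
      have h5 := (mul_dvd_mul_iff_left (pow_ne_zero n hl0)).1 h4
      have hu : IsUnit (C (a * (n + 1)) : Poly m) :=
        (isUnit_iff_ne_zero.2 (mul_ne_zero ha (by positivity))).map C
      rw [hu.dvd_mul_left] at h5
      rw [pow_succ]
      exact mul_dvd_mul_left _ h5

/-- A polynomial whose derivatives of order less than `r` vanish on the boundary of the reference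
simplex is divisible by the `r`-th power of the bubble. -/
theorem bubble_pow_dvd {p : Poly m} (hm : 1 ≤ m) {r : ℕ}
    (h : ∀ l : List (Fin m), l.length < r → ∀ t ∈ refBdry m,
      eval t (dl (l.map fun i => Pi.single i 1) p) = 0) : bubble m ^ r ∣ p := by
  classical
  have hX : ∀ i : Fin m, (X i : Poly m) ^ r ∣ p := by
    intro i
    refine pow_dvd_of_dvd_dl (t := Pi.single i 1) (a := 1) one_ne_zero (by simp) r p ?_
    intro j hj
    refine X_dvd_of_eval_eq_zero fun t ht => ?_
    simpa using h (List.replicate j i) (by simpa using hj) t ht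
  have hL : (1 - ∑ i, X i : Poly m) ^ r ∣ p := by
    refine pow_dvd_of_dvd_dl (t := Pi.single ⟨0, hm⟩ 1) (a := -1) (by norm_num) ?_ r p ?_
    · rw [map_sub, map_sum]
      simp only [dd_X, Derivation.map_one_eq_zero, zero_sub, map_neg, map_one]
      rw [Finset.sum_eq_single ⟨0, hm⟩]
      · simp
      · intro j _ hj; simp [hj]
      · simp
    · intro j hj
      refine one_sub_sum_dvd_of_eval_eq_zero hm fun t ht => ?_
      simpa using h (List.replicate j ⟨0, hm⟩) (by simpa using hj) t ht
  have hirr : ∀ i : Fin m, Irreducible (X i : Poly m) := fun i => X_prime.irreducible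
  have hrel1 : ∀ i, IsRelPrime (1 - ∑ i, X i : Poly m) (X i) := by
    intro i
    refine ((hirr i).isRelPrime_iff_not_dvd.2 ?_).symm
    rintro ⟨g, hg⟩
    have := congrArg (eval (0 : Fin m → ℝ)) hg
    simp at this
  have hprod : (∏ i, (X i : Poly m) ^ r) ∣ p := by
    refine Fintype.prod_dvd_of_isRelPrime ?_ hX
    intro i j hij
    refine IsRelPrime.pow ((hirr i).isRelPrime_iff_not_dvd.2 ?_)
    rw [X_dvd_X]
    exact hij
  rw [bubble, mul_pow, ← Finset.prod_pow]
  refine IsRelPrime.mul_dvd ?_ hL hprod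
  exact IsRelPrime.prod_right fun i _ => (hrel1 i).pow

/-- The derivatives of order less than `r` on the boundary and the averages over the carriers
bound all coefficients. -/
theorem IsUnisolventBubble.exists_coefBound {S : Finset (Carrier m)} {r k : ℕ} (hm : 1 ≤ m)
    (hS : IsUnisolventBubble S r k) :
    ∃ C : ℝ, 0 ≤ C ∧ ∀ p : Poly m, p.totalDegree ≤ k → ∀ M : ℝ, 0 ≤ M →
      (∀ l : List (Fin m), l.length < r → ∀ t ∈ refBdry m,
        |eval t (dl (l.map fun i => Pi.single i 1) p)| ≤ M) →
      (∀ c ∈ S, |c.avg fun t => eval t p| ≤ M) → CoefBound p (C * M) := by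
  -- The family contains the derivatives at all points of the boundary. It is infinite, which the
  -- duality bound permits.
  let ι := S ⊕ ({l : List (Fin m) // l.length < r} × refBdry m)
  let ℓ : ι → Poly m →ₗ[ℝ] ℝ := Sum.elim (fun c => c.1.avgL) fun q =>
    (MvPolynomial.aeval q.2.1).toLinearMap ∘ₗ dl (q.1.1.map fun i => Pi.single i 1)
  have hℓ : ∀ q p, ℓ (Sum.inr q) p = eval q.2.1 (dl (q.1.1.map fun i => Pi.single i 1) p) := by
    intro q p
    simp [ℓ, MvPolynomial.aeval_eq_eval]
  obtain ⟨C, hC, h⟩ := exists_coefBound_of_separating (k := k) ℓ (fun _ => 1)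
    (fun _ => zero_le_one) (by
      -- A polynomial on which all functionals vanish belongs to the bubble space by
      -- `bubble_pow_dvd`, and there uniqueness identifies it with `0`.
      intro p hp h0
      obtain ⟨q, -, hq⟩ := hS.2 fun _ => 0
      have h1 : p = q := hq p ⟨hp, bubble_pow_dvd hm fun l hl t ht => by
        rw [← hℓ (⟨l, hl⟩, ⟨t, ht⟩)]; exact h0 _, fun c hc => h0 (Sum.inl ⟨c, hc⟩)⟩
      have h2 : (0 : Poly m) = q := hq 0 ⟨by simp, dvd_zero _, fun c hc => by
        rw [← Carrier.avgL_apply, map_zero]⟩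
      rw [h1, h2])
  refine ⟨C, hC, fun p hp M hM hl hc => h p hp M hM ?_⟩
  rintro (c | q)
  · rw [one_mul]; exact hc c.1 c.2
  · rw [hℓ, one_mul]; exact hl q.1.1 q.1.2 q.2.1 q.2.2

end ReferenceSimplex

/-! ### Control of a polynomial by its second derivatives -/

section HessianBound

variable {m : ℕ}

/-- Cauchy–Schwarz, from the discriminant of the nonnegative quadratic function `y ↦ ∫ (y f + g)²`.
-/
theorem sq_integral_mul_le {α : Type*} [MeasurableSpace α] {μ : Measure α} {f g : α → ℝ}
    (hf : Integrable (fun x => f x ^ 2) μ) (hg : Integrable (fun x => g x ^ 2) μ)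
    (hfg : Integrable (fun x => f x * g x) μ) :
    (∫ x, f x * g x ∂μ) ^ 2 ≤ (∫ x, f x ^ 2 ∂μ) * ∫ x, g x ^ 2 ∂μ := by
  have h : ∀ y : ℝ, 0 ≤ (∫ x, f x ^ 2 ∂μ) * (y * y) + (2 * ∫ x, f x * g x ∂μ) * y
      + ∫ x, g x ^ 2 ∂μ := by
    intro y
    have h1 : ∫ x, (y * f x + g x) ^ 2 ∂μ = (∫ x, f x ^ 2 ∂μ) * (y * y)
        + (2 * ∫ x, f x * g x ∂μ) * y + ∫ x, g x ^ 2 ∂μ := by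
      have h2 : ∀ x, (y * f x + g x) ^ 2 = (f x ^ 2 * (y * y) + (f x * g x) * (2 * y))
          + g x ^ 2 := fun x => by ring
      simp_rw [h2]
      have h3 : Integrable (fun x => f x ^ 2 * (y * y) + (f x * g x) * (2 * y)) μ :=
        (hf.mul_const _).add (hfg.mul_const _)
      rw [integral_add h3 hg, integral_add (hf.mul_const _) (hfg.mul_const _), integral_mul_const, integral_mul_const]
      ring
    rw [← h1]
    exact integral_nonneg fun x => sq_nonneg _
  have := discrim_le_zero h
  rw [discrim] at this
  nlinarith

theorem eq_zero_of_integral_sq_eq_zero {p : Poly m}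
    (h : ∫ t in refSimplex m, eval t p ^ 2 = 0) : p = 0 := by
  have hc := continuous_eval_poly p
  have h1 : (fun t => eval t p ^ 2) =ᵐ[volume.restrict (refSimplex m)] 0 :=
    (setIntegral_eq_zero_iff_of_nonneg_ae (Filter.Eventually.of_forall fun t => sq_nonneg _)
      (integrableOn_refSimplex (hc.pow 2))).1 h
  let U : Set (Fin m → ℝ) := Set.pi Set.univ fun _ => Set.Ioo 0 (1 / (m + 1))
  have hU : IsOpen U := isOpen_set_pi Set.finite_univ fun _ _ => isOpen_Ioo
  have hUs : U ⊆ refSimplex m := fun t ht =>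
    ⟨fun i => (ht i trivial).1.le, sum_le_one_of_box fun i => (ht i trivial).2.le⟩
  have h2 : (fun t => eval t p ^ 2) =ᵐ[volume.restrict U] 0 :=
    Filter.EventuallyEq.filter_mono h1 (ae_mono (Measure.restrict_mono hUs le_rfl))
  have h3 := Measure.eqOn_open_of_ae_eq h2 hU (hc.pow 2).continuousOn continuousOn_const
  refine funext_set (fun _ : Fin m => Set.Ioo (0 : ℝ) (1 / (m + 1)))
    (fun _ => Set.Ioo_infinite (by positivity)) fun t ht => ?_
  simpa using h3 ht

/-- The squared `L²` norm of the second derivatives on the reference simplex. -/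
def refHess (p : Poly m) : ℝ :=
  ∑ a, ∑ b, ∫ t in refSimplex m, eval t (pderiv a (pderiv b p)) ^ 2

/-- Without second derivatives `p` is affine, and an affine function is determined by its values at
the vertices of the reference simplex. -/
theorem eq_zero_of_pderiv_pderiv_eq_zero {p : Poly m}
    (h : ∀ a b, pderiv a (pderiv b p) = 0) (h0 : eval 0 p = 0)
    (h1 : ∀ i, eval (Pi.single i 1) p = 0) : p = 0 := by
  classical
  -- A monomial of degree at least two contains a product of two variables, and the corresponding
  -- second derivative multiplies its coefficient by a nonzero integer.
  have hdeg : p.totalDegree ≤ 1 := by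
    rw [totalDegree_le_iff_degree_le]
    intro s hs
    by_contra! h2
    obtain ⟨b, hb⟩ : ∃ b, s b ≠ 0 := by
      by_contra! h3
      have : s = 0 := Finsupp.ext h3
      rw [this] at h2
      simp at h2
    obtain ⟨s', rfl⟩ : ∃ s', s = s' + Finsupp.single b 1 :=
      ⟨s - Finsupp.single b 1, (tsub_add_cancel_of_le (by
        rw [Finsupp.single_le_iff]; omega)).symm⟩
    obtain ⟨a, ha⟩ : ∃ a, s' a ≠ 0 := by
      by_contra! h3
      have : s' = 0 := Finsupp.ext h3
      rw [this] at h2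
      simp at h2
    obtain ⟨u, rfl⟩ : ∃ u, s' = u + Finsupp.single a 1 :=
      ⟨s' - Finsupp.single a 1, (tsub_add_cancel_of_le (by
        rw [Finsupp.single_le_iff]; omega)).symm⟩
    have h4 := congrArg (coeff u) (h a b)
    rw [coeff_pderiv, coeff_pderiv, coeff_zero] at h4
    rcases mul_eq_zero.1 h4 with h4 | h4
    · rcases mul_eq_zero.1 h4 with h4 | h4
      · exact (mem_support_iff.1 hs) h4
      · norm_cast at h4
    · norm_cast at h4
  have hform : p = C (coeff 0 p) + ∑ i, C (coeff (Finsupp.single i 1) p) * X i := by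
    ext s
    by_cases hs : s.degree ≤ 1
    · rcases Nat.le_one_iff_eq_zero_or_eq_one.1 hs with h2 | h2
      · rw [Finsupp.degree_eq_zero_iff] at h2
        subst h2
        simp [coeff_sum]
      · obtain ⟨i, rfl⟩ : ∃ i, s = Finsupp.single i 1 := by
          obtain ⟨b, hb⟩ : ∃ b, s b ≠ 0 := by
            by_contra! h3
            have : s = 0 := Finsupp.ext h3
            rw [this] at h2
            simp at h2
          obtain ⟨s', rfl⟩ : ∃ s', s = s' + Finsupp.single b 1 :=
            ⟨s - Finsupp.single b 1, (tsub_add_cancel_of_le (by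
              rw [Finsupp.single_le_iff]; omega)).symm⟩
          have : s' = 0 := by
            rw [← Finsupp.degree_eq_zero_iff]
            simpa using h2
          exact ⟨b, by simp [this]⟩
        rw [coeff_add, coeff_sum, coeff_C, if_neg (by
          intro h; simpa using (congrArg Finsupp.degree h).symm), zero_add,
          Finset.sum_eq_single i]
        · simp
        · intro j _ hj
          rw [coeff_C_mul, coeff_X, if_neg, mul_zero]
          intro h
          exact hj ((Finsupp.single_left_inj one_ne_zero).1 h)
        · simp
    · have h3 : ∀ q : Poly m, q.totalDegree ≤ 1 → coeff s q = 0 := by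
        intro q hq
        by_contra h4
        exact hs ((totalDegree_le_iff_degree_le.1 hq) s (mem_support_iff.2 h4))
      rw [h3 p hdeg, h3]
      refine (totalDegree_add _ _).trans (max_le (by simp) ?_)
      refine totalDegree_finsetSum_le fun i _ => (totalDegree_mul _ _).trans ?_
      simp
  have hc0 : coeff 0 p = 0 := by
    rw [hform] at h0
    simpa using h0
  have hci : ∀ i, coeff (Finsupp.single i 1) p = 0 := by
    intro i
    have := h1 i
    rw [hform, hc0] at this
    simpa [Pi.single_apply] using this
  rw [hform, hc0]
  simp [hci]

/-- A polynomial that vanishes at the vertices of the reference simplex is bounded by its second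
derivatives. -/
theorem exists_coefBound_refHess (m k : ℕ) :
    ∃ C : ℝ, 0 ≤ C ∧ ∀ p : Poly m, p.totalDegree ≤ k → eval 0 p = 0 →
      (∀ i, eval (Pi.single i 1) p = 0) → CoefBound p (C * √(refHess p)) := by
  -- The `L²` norm is not linear, so it is replaced by the pairings of the second derivatives with
  -- all polynomials `q`, weighted by the norm of `q`. The vertex values receive weight `0`.
  let ι := Option (Fin m) ⊕ (Fin m × Fin m × Poly m)
  let ev : Option (Fin m) → Fin m → ℝ := fun o => o.elim 0 fun i => Pi.single i 1
  let intL : Poly m → Poly m →ₗ[ℝ] ℝ := fun q =>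
    { toFun := fun p => ∫ t in refSimplex m, eval t p * eval t q
      map_add' := fun p p' => by
        simp only [map_add, add_mul]
        exact integral_add (integrableOn_refSimplex
          ((continuous_eval_poly p).mul (continuous_eval_poly q))) (integrableOn_refSimplex
          ((continuous_eval_poly p').mul (continuous_eval_poly q)))
      map_smul' := fun a p => by
        simp only [MvPolynomial.smul_eval, mul_assoc, integral_const_mul, RingHom.id_apply,
          smul_eq_mul] }
  let ℓ : ι → Poly m →ₗ[ℝ] ℝ := Sum.elim (fun o => (MvPolynomial.aeval (ev o)).toLinearMap)
    fun q => intL q.2.2 ∘ₗ (pderiv q.1).toLinearMap ∘ₗ (pderiv q.2.1).toLinearMap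
  have hℓ : ∀ o p, ℓ (Sum.inl o) p = eval (ev o) p := fun o p => by
    simp [ℓ, MvPolynomial.aeval_eq_eval]
  have hℓ' : ∀ a b q p, ℓ (Sum.inr (a, b, q)) p
      = ∫ t in refSimplex m, eval t (pderiv a (pderiv b p)) * eval t q := fun a b q p => rfl
  let w : ι → ℝ := Sum.elim (fun _ => 0) fun q => √(∫ t in refSimplex m, eval t q.2.2 ^ 2)
  have hw : ∀ i, 0 ≤ w i := by
    rintro (o | q)
    · exact le_rfl
    · exact Real.sqrt_nonneg _
  obtain ⟨C, hC, h⟩ := exists_coefBound_of_separating (k := k) ℓ w hw (by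
    intro p hp h0
    refine eq_zero_of_pderiv_pderiv_eq_zero ?_ ?_ ?_
    · intro a b
      refine eq_zero_of_integral_sq_eq_zero ?_
      simp only [pow_two]
      -- The second derivative is tested with itself.
      exact h0 (Sum.inr (a, b, pderiv a (pderiv b p)))
    · exact (hℓ none p).symm.trans (h0 _)
    · intro i
      exact (hℓ (some i) p).symm.trans (h0 _))
  refine ⟨C, hC, fun p hp h0 h1 => h p hp _ (Real.sqrt_nonneg _) ?_⟩
  rintro (o | ⟨a, b, q⟩)
  · rw [hℓ]
    cases o with
    | none => rw [show eval (ev none) p = 0 from h0]; simp [w]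
    | some i => rw [show eval (ev (some i)) p = 0 from h1 i]; simp [w]
  · rw [hℓ']
    simp only [w, Sum.elim_inr]
    rw [← Real.sqrt_mul (integral_nonneg fun _ => sq_nonneg _)]
    refine Real.le_sqrt_of_sq_le ?_
    rw [sq_abs]
    have hcp := continuous_eval_poly (pderiv a (pderiv b p))
    have hcq := continuous_eval_poly q
    refine (sq_integral_mul_le (integrableOn_refSimplex (hcp.pow 2))
      (integrableOn_refSimplex (hcq.pow 2)) (integrableOn_refSimplex (hcp.mul hcq))).trans ?_
    rw [mul_comm]
    refine mul_le_mul_of_nonneg_left ?_ (integral_nonneg fun _ => sq_nonneg _)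
    refine le_trans ?_ (Finset.single_le_sum (f := fun a => ∑ b, ∫ t in refSimplex m,
      eval t (pderiv a (pderiv b p)) ^ 2) (fun _ _ => Finset.sum_nonneg fun _ _ =>
        integral_nonneg fun _ => sq_nonneg _) (Finset.mem_univ a))
    exact Finset.single_le_sum (f := fun b => ∫ t in refSimplex m,
      eval t (pderiv a (pderiv b p)) ^ 2) (fun _ _ => integral_nonneg fun _ => sq_nonneg _)
      (Finset.mem_univ b)

end HessianBound

/-! ### Analytic derivatives of polynomial functions -/

section Calculus

variable {d : ℕ}

/-- The directional derivatives of a polynomial as a continuous linear map. -/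
def polyDeriv (p : Poly d) (x : E d) : E d →L[ℝ] ℝ :=
  ∑ i, eval x.ofLp (pderiv i p) • EuclideanSpace.proj i

theorem polyDeriv_apply (p : Poly d) (x t : E d) :
    polyDeriv p x t = eval x.ofLp (dd t.ofLp p) := by
  simp [polyDeriv, dd_eq_sum, mul_comm]

theorem contDiff_eval (p : Poly d) {n : WithTop ℕ∞} :
    ContDiff ℝ n fun x : E d => eval x.ofLp p := by
  induction p using MvPolynomial.induction_on with
  | C a => simpa using contDiff_const
  | add p q hp hq => simpa using hp.add hq
  | mul_X p i hp =>
    simp only [map_mul, eval_X]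
    exact hp.mul (by fun_prop)

theorem hasFDerivAt_eval (p : Poly d) (x : E d) :
    HasFDerivAt (fun x : E d => eval x.ofLp p) (polyDeriv p x) x := by
  induction p using MvPolynomial.induction_on with
  | C a =>
    have : polyDeriv (C a) x = 0 := by ext t; simp [polyDeriv_apply]
    rw [this]
    simpa using hasFDerivAt_const a x
  | add p q hp hq =>
    have : polyDeriv (p + q) x = polyDeriv p x + polyDeriv q x := by
      ext t; simp [polyDeriv_apply]
    rw [this]
    simpa using! hp.add hq
  | mul_X p i hp =>
    have h1 : HasFDerivAt (fun x : E d => x.ofLp i) (EuclideanSpace.proj i : E d →L[ℝ] ℝ) x :=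
      (EuclideanSpace.proj i : E d →L[ℝ] ℝ).hasFDerivAt
    have : polyDeriv (p * X i) x = eval x.ofLp p • (EuclideanSpace.proj i : E d →L[ℝ] ℝ)
        + x.ofLp i • polyDeriv p x := by
      ext t; simp [polyDeriv_apply, Derivation.leibniz]
    rw [this]
    simpa using! hp.mul h1

theorem iteratedFDeriv_eval (p : Poly d) (l : List (E d)) (x : E d) :
    iteratedFDeriv ℝ l.length (fun x : E d => eval x.ofLp p) x l.get
      = eval x.ofLp (dl (l.map WithLp.ofLp) p) := by
  induction l generalizing x with
  | nil => simp
  | cons t l ih =>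
    have hd : DifferentiableAt ℝ (iteratedFDeriv ℝ l.length fun x : E d => eval x.ofLp p) x :=
      (contDiff_eval p (n := ⊤)).differentiable_iteratedFDeriv
        (WithTop.coe_lt_top _) |>.differentiableAt
    have h1 := hd.iteratedFDeriv_succ_apply_left' (m := (t :: l).get)
    refine h1.trans ?_
    have h2 : (fun y => iteratedFDeriv ℝ l.length (fun x : E d => eval x.ofLp p) y
        (Fin.tail (t :: l).get)) = fun y => eval y.ofLp (dl (l.map WithLp.ofLp) p) :=
      funext fun y => ih y
    rw [h2, (hasFDerivAt_eval _ x).fderiv, polyDeriv_apply]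
    rfl

/-- The bridge from analysis to algebra: on a set with unique derivatives the derivative within the
set depends only on the polynomial piece, also at boundary points. Cells are such sets, being convex
with nonempty interior. -/
theorem iteratedFDerivWithin_eq_dl {p : Poly d} {v : E d → ℝ} {s : Set (E d)}
    (hs : UniqueDiffOn ℝ s) (hv : ∀ y ∈ s, v y = eval y.ofLp p) (l : List (E d)) {x : E d}
    (hx : x ∈ s) :
    iteratedFDerivWithin ℝ l.length v s x l.get = eval x.ofLp (dl (l.map WithLp.ofLp) p) := by
  rw [iteratedFDerivWithin_congr hv hx,
    iteratedFDerivWithin_eq_iteratedFDeriv hs (contDiff_eval p).contDiffAt hx,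
    iteratedFDeriv_eval]

theorem fderivWithin_eq_dd {p : Poly d} {v : E d → ℝ} {s : Set (E d)}
    (hs : UniqueDiffOn ℝ s) (hv : ∀ y ∈ s, v y = eval y.ofLp p) (t : E d) {x : E d}
    (hx : x ∈ s) :
    fderivWithin ℝ v s x t = eval x.ofLp (dd t.ofLp p) := by
  rw [fderivWithin_congr hv (hv x hx),
    ((hasFDerivAt_eval p x).hasFDerivWithinAt).fderivWithin (hs x hx), polyDeriv_apply]

end Calculus

/-! ### Simplices, barycentric coordinates and pullback to reference coordinates -/

section Simplices

variable {d : ℕ}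

/-- The enumeration of the vertices of a simplex. -/
def vert (s : Finset (E d)) (i : ℕ) : E d := s.toList.getD i 0

theorem vert_eq_get {m : ℕ} {s : Finset (E d)} (hs : s.card = m + 1) (i : Fin (m + 1)) :
    vert s i = s.toList.get ⟨i, by rw [Finset.length_toList, hs]; exact i.2⟩ := by
  rw [vert, List.getD_eq_getElem]
  rfl

theorem vert_mem {m : ℕ} {s : Finset (E d)} (hs : s.card = m + 1) (i : Fin (m + 1)) :
    vert s i ∈ s := by
  rw [vert_eq_get hs]
  exact Finset.mem_toList.1 (List.get_mem _ _)

theorem vert_injective {m : ℕ} {s : Finset (E d)} (hs : s.card = m + 1) :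
    Function.Injective fun i : Fin (m + 1) => vert s i := by
  intro i j hij
  simp only [vert_eq_get hs] at hij
  have := (List.nodup_iff_injective_get.1 s.nodup_toList) hij
  simpa [Fin.ext_iff] using this

theorem exists_vert_eq {m : ℕ} {s : Finset (E d)} (hs : s.card = m + 1) {z : E d} (hz : z ∈ s) :
    ∃ i : Fin (m + 1), vert s i = z := by
  obtain ⟨i, hi⟩ := List.get_of_mem (Finset.mem_toList.2 hz)
  have : (i : ℕ) < m + 1 := by
    exact i.2.trans_eq (by rw [Finset.length_toList, hs])
  exact ⟨⟨i, this⟩, by rw [vert_eq_get hs]; exact hi⟩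

theorem sum_vert {m : ℕ} {s : Finset (E d)} (hs : s.card = m + 1) {M : Type*} [AddCommMonoid M]
    (f : E d → M) : ∑ i : Fin (m + 1), f (vert s i) = ∑ z ∈ s, f z :=
  Finset.sum_nbij (fun i => vert s i) (fun i _ => vert_mem hs i)
    (fun _ _ _ _ h => vert_injective hs h)
    (fun z hz => by
      obtain ⟨i, hi⟩ := exists_vert_eq hs hz
      exact ⟨i, by simp, hi⟩) fun _ _ => rfl

/-- The barycentric coordinates of the point with reference coordinates `t`. -/
def refBary {m : ℕ} (t : Fin m → ℝ) : Fin (m + 1) → ℝ := Fin.cons (1 - ∑ j, t j) t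

theorem sum_refBary {m : ℕ} (t : Fin m → ℝ) : ∑ i, refBary t i = 1 := by
  rw [Fin.sum_univ_succ]
  simp [refBary]

theorem refBary_nonneg {m : ℕ} {t : Fin m → ℝ} (ht : t ∈ refSimplex m) (i : Fin (m + 1)) :
    0 ≤ refBary t i := by
  refine Fin.cases ?_ (fun j => ?_) i
  · simpa [refBary] using ht.2
  · simpa [refBary] using ht.1 j

theorem facePt_eq {m : ℕ} (s : Finset (E d)) (t : Fin m → ℝ) :
    facePt m s t = ∑ i : Fin (m + 1), refBary t i • vert s i := rfl

theorem body_eq_image {m : ℕ} {s : Finset (E d)} (hs : s.card = m + 1) :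
    body s = facePt m s '' refSimplex m := by
  ext x
  constructor
  · intro hx
    obtain ⟨w, hw0, hw1, hwx⟩ := Finset.mem_convexHull'.1 hx
    rw [← sum_vert hs] at hw1 hwx
    refine ⟨fun j => w (vert s (j.succ : Fin (m + 1))), ⟨fun j => hw0 _ (vert_mem hs _), ?_⟩, ?_⟩
    · rw [Fin.sum_univ_succ] at hw1
      linarith [hw0 _ (vert_mem hs 0)]
    · rw [facePt_eq, ← hwx]
      refine Finset.sum_congr rfl fun i _ => ?_
      congr 1
      refine Fin.cases ?_ (fun j => ?_) i
      · rw [Fin.sum_univ_succ] at hw1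
        simp only [refBary, Fin.cons_zero]
        linarith
      · simp [refBary]
  · rintro ⟨t, ht, rfl⟩
    rw [facePt_eq]
    exact (convex_convexHull ℝ _).sum_mem (fun i _ => refBary_nonneg ht i) (sum_refBary t)
      fun i _ => subset_convexHull ℝ _ (vert_mem hs i)

theorem facePt_mem_body {m : ℕ} {s : Finset (E d)} (hs : s.card = m + 1) {t : Fin m → ℝ}
    (ht : t ∈ refSimplex m) : facePt m s t ∈ body s := by
  rw [body_eq_image hs]
  exact ⟨t, ht, rfl⟩

theorem body_mono {s t : Finset (E d)} (h : s ⊆ t) : body s ⊆ body t :=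
  convexHull_mono (Finset.coe_subset.2 h)

theorem mem_body_of_mem {s : Finset (E d)} {z : E d} (hz : z ∈ s) : z ∈ body s :=
  subset_convexHull ℝ _ hz

theorem convex_body (s : Finset (E d)) : Convex ℝ (body s) := convex_convexHull ℝ _

theorem isCompact_body (s : Finset (E d)) : IsCompact (body s) :=
  s.finite_toSet.isCompact_convexHull ℝ

theorem isClosed_body (s : Finset (E d)) : IsClosed (body s) := (isCompact_body s).isClosed

theorem body_singleton (z : E d) : body {z} = {z} := by simp [body]

theorem affine_nonneg_on_body {s : Finset (E d)} {f : E d →ᵃ[ℝ] ℝ} (h : ∀ z ∈ s, 0 ≤ f z)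
    {x : E d} (hx : x ∈ body s) : 0 ≤ f x := by
  have : Convex ℝ (f ⁻¹' Set.Ici 0) := (convex_Ici (0 : ℝ)).affine_preimage f
  exact convexHull_min (fun z hz => h z hz) this hx

theorem affine_le_on_body {s : Finset (E d)} {f : E d →ᵃ[ℝ] ℝ} {a : ℝ} (h : ∀ z ∈ s, f z ≤ a)
    {x : E d} (hx : x ∈ body s) : f x ≤ a := by
  have : Convex ℝ (f ⁻¹' Set.Iic a) := (convex_Iic a).affine_preimage f
  exact convexHull_min (fun z hz => h z hz) this hx

theorem affine_eq_zero_on_body {s : Finset (E d)} {f : E d →ᵃ[ℝ] ℝ} (h : ∀ z ∈ s, f z = 0)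
    {x : E d} (hx : x ∈ body s) : f x = 0 :=
  le_antisymm (affine_le_on_body (fun z hz => (h z hz).le) hx)
    (affine_nonneg_on_body (fun z hz => (h z hz).ge) hx)

/-- Vertex sets of nondegenerate `d`-dimensional simplices in `ℝ^d`. -/
structure IsCell (T : Finset (E d)) : Prop where
  indep : AffineIndependent ℝ ((↑) : T → E d)
  card : T.card = d + 1

theorem isCell_of_mem_cells {K : SimplicialComplex ℝ (E d)} {T : Finset (E d)}
    (hT : T ∈ cells K) : IsCell T := ⟨K.indep hT.1, hT.2⟩

/-- A nondegenerate `d`-simplex is an affine basis of `ℝ^d`. The coordinates are indexed by points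
of the space instead of the subtype of vertices, so that sums over subsimplices need no coercions.
-/
theorem IsCell.exists_bary {T : Finset (E d)} (hT : IsCell T) :
    ∃ b : E d → (E d →ᵃ[ℝ] ℝ), (∀ u ∈ T, b u u = 1) ∧ (∀ u ∈ T, ∀ v ∈ T, u ≠ v → b u v = 0) ∧
      (∀ x, ∑ u ∈ T, b u x = 1) ∧ ∀ x, ∑ u ∈ T, b u x • u = x := by
  classical
  have htop : affineSpan ℝ (Set.range ((↑) : T → E d)) = ⊤ := by
    rw [hT.indep.affineSpan_eq_top_iff_card_eq_finrank_add_one]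
    simp [hT.card]
  let B : AffineBasis T ℝ (E d) := ⟨(↑), hT.indep, htop⟩
  refine ⟨fun u => if h : u ∈ T then B.coord ⟨u, h⟩ else 0, ?_, ?_, ?_, ?_⟩
  · intro u hu
    simp only [hu, dif_pos]
    exact B.coord_apply_eq ⟨u, hu⟩
  · intro u hu v hv huv
    simp only [hu, dif_pos]
    exact B.coord_apply_ne (i := ⟨u, hu⟩) (j := ⟨v, hv⟩) (by simpa using huv)
  · intro x
    rw [← Finset.sum_coe_sort, ← B.sum_coord_apply_eq_one x]
    exact Finset.sum_congr rfl fun u _ => by simp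
  · intro x
    rw [← Finset.sum_coe_sort]
    conv_rhs => rw [← B.linear_combination_coord_eq_self x]
    exact Finset.sum_congr rfl fun u _ => by simp only [u.2, dif_pos]; rfl

open Classical in
/-- The barycentric coordinate of the cell `T` that belongs to the vertex `u`. -/
def bary (T : Finset (E d)) (u : E d) : E d →ᵃ[ℝ] ℝ :=
  if h : IsCell T then h.exists_bary.choose u else 0

section Bary

variable {T : Finset (E d)} (hT : IsCell T)
include hT

theorem IsCell.bary_self {u : E d} (hu : u ∈ T) : bary T u u = 1 := by
  rw [bary, dif_pos hT]
  exact hT.exists_bary.choose_spec.1 u hu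

theorem IsCell.bary_of_ne {u v : E d} (hu : u ∈ T) (hv : v ∈ T) (h : u ≠ v) : bary T u v = 0 := by
  rw [bary, dif_pos hT]
  exact hT.exists_bary.choose_spec.2.1 u hu v hv h

theorem IsCell.sum_bary (x : E d) : ∑ u ∈ T, bary T u x = 1 := by
  simp only [bary, dif_pos hT]
  exact hT.exists_bary.choose_spec.2.2.1 x

theorem IsCell.sum_bary_smul (x : E d) : ∑ u ∈ T, bary T u x • u = x := by
  simp only [bary, dif_pos hT]
  exact hT.exists_bary.choose_spec.2.2.2 x

theorem IsCell.bary_eq_zero {s : Finset (E d)} (hs : s ⊆ T) {u : E d} (hu : u ∈ T) (hus : u ∉ s)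
    {x : E d} (hx : x ∈ body s) : bary T u x = 0 :=
  affine_eq_zero_on_body (fun _ hz => hT.bary_of_ne hu (hs hz) fun h => hus (h ▸ hz)) hx

theorem IsCell.bary_nonneg {u : E d} (hu : u ∈ T) {x : E d} (hx : x ∈ body T) :
    0 ≤ bary T u x := by
  classical
  refine affine_nonneg_on_body (fun z hz => ?_) hx
  by_cases h : u = z
  · subst h; rw [hT.bary_self hu]; exact zero_le_one
  · rw [hT.bary_of_ne hu hz h]

theorem IsCell.bary_le_one {u : E d} (hu : u ∈ T) {x : E d} (hx : x ∈ body T) :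
    bary T u x ≤ 1 := by
  rw [← hT.sum_bary x]
  exact Finset.single_le_sum (fun v hv => hT.bary_nonneg hv hx) hu

theorem IsCell.mem_body_of_bary {s : Finset (E d)} (hs : s ⊆ T) {x : E d}
    (h0 : ∀ u ∈ s, 0 ≤ bary T u x) (h1 : ∀ u ∈ T, u ∉ s → bary T u x = 0) : x ∈ body s := by
  rw [body, Finset.mem_convexHull']
  refine ⟨fun u => bary T u x, h0, ?_, ?_⟩
  · rw [← hT.sum_bary x]
    exact Finset.sum_subset hs h1
  · conv_rhs => rw [← hT.sum_bary_smul x]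
    exact Finset.sum_subset hs fun u hu hus => by simp only [h1 u hu hus, zero_smul]

theorem IsCell.bary_facePt {m : ℕ} {s : Finset (E d)} (hs : s ⊆ T) (hsm : s.card = m + 1)
    (i : Fin (m + 1)) (t : Fin m → ℝ) : bary T (vert s i) (facePt m s t) = refBary t i := by
  classical
  have h1 : facePt m s t = Finset.univ.affineCombination ℝ (fun i : Fin (m + 1) => vert s i)
      (refBary t) := by
    rw [Finset.affineCombination_eq_linear_combination _ _ _ (sum_refBary t)]
    rfl
  rw [h1, Finset.map_affineCombination _ _ _ (sum_refBary t),
    Finset.affineCombination_eq_linear_combination _ _ _ (sum_refBary t), Finset.sum_eq_single i]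
  · simp [hT.bary_self (hs (vert_mem hsm i))]
  · intro j _ hj
    have : vert s i ≠ vert s j := fun h => hj (vert_injective hsm h).symm
    simp [hT.bary_of_ne (hs (vert_mem hsm i)) (hs (vert_mem hsm j)) this]
  · simp

theorem IsCell.interior_nonempty : (interior (body T)).Nonempty := by
  rw [body, interior_convexHull_nonempty_iff_affineSpan_eq_top]
  have := hT.indep.affineSpan_eq_top_iff_card_eq_finrank_add_one (k := ℝ)
  simp only [Subtype.range_coe_subtype, Finset.setOfPred_mem] at this
  rw [this]
  simp [hT.card]

theorem IsCell.uniqueDiffOn : UniqueDiffOn ℝ (body T) :=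
  uniqueDiffOn_convex (convex_body T) hT.interior_nonempty

theorem IsCell.facePt_injective : Function.Injective (facePt d T) := by
  intro t t' h
  funext j
  have h1 := hT.bary_facePt subset_rfl hT.card j.succ t
  have h2 := hT.bary_facePt subset_rfl hT.card j.succ t'
  rw [h, h2] at h1
  simpa [refBary] using h1.symm

end Bary

section PullBack

/-- The coordinates of the parametrization of a simplex, as polynomials. -/
def facePoly (m : ℕ) (s : Finset (E d)) (i : Fin d) : Poly m :=
  C (vert s 0 i) + ∑ j : Fin m, C (vert s (j + 1) i - vert s 0 i) * X j

/-- The direction in `ℝ^d` that belongs to a direction in reference coordinates. -/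
def faceDir (m : ℕ) (s : Finset (E d)) (t : Fin m → ℝ) : Fin d → ℝ :=
  fun i => ∑ j : Fin m, (vert s (j + 1) i - vert s 0 i) * t j

theorem faceDir_single (m : ℕ) (s : Finset (E d)) (j : Fin m) :
    faceDir m s (Pi.single j 1) = (vert s (j + 1) - vert s 0).ofLp := by
  funext i
  simp [faceDir, Pi.single_apply]

theorem facePt_apply (m : ℕ) (s : Finset (E d)) (t : Fin m → ℝ) (i : Fin d) :
    facePt m s t i = vert s 0 i + ∑ j : Fin m, (vert s (j + 1) i - vert s 0 i) * t j := by
  rw [facePt_eq, Fin.sum_univ_succ]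
  simp only [refBary, Fin.cons_zero, Fin.cons_succ, Fin.val_zero, Fin.val_succ, PiLp.add_apply,
    PiLp.smul_apply, WithLp.ofLp_sum, Finset.sum_apply, smul_eq_mul, sub_mul,
    Finset.sum_sub_distrib, WithLp.ofLp_smul, Pi.smul_apply]
  simp only [mul_comm (_ : ℝ) (t _), ← Finset.sum_mul]
  ring

theorem eval_facePoly (m : ℕ) (s : Finset (E d)) (t : Fin m → ℝ) (i : Fin d) :
    eval t (facePoly m s i) = facePt m s t i := by
  rw [facePt_apply]
  simp [facePoly]

theorem dd_facePoly (m : ℕ) (s : Finset (E d)) (t : Fin m → ℝ) (i : Fin d) :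
    dd t (facePoly m s i) = C (faceDir m s t i) := by
  simp [facePoly, faceDir, Derivation.leibniz, mul_comm]

theorem totalDegree_facePoly (m : ℕ) (s : Finset (E d)) (i : Fin d) :
    (facePoly m s i).totalDegree ≤ 1 := by
  refine (totalDegree_add _ _).trans (max_le (by simp) ?_)
  refine totalDegree_finsetSum_le fun j _ => (totalDegree_mul _ _).trans ?_
  rw [totalDegree_C, totalDegree_X]

/-- A polynomial in the reference coordinates of a simplex. -/
def pb (m : ℕ) (s : Finset (E d)) : Poly d →ₐ[ℝ] Poly m := bind₁ (facePoly m s)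

theorem eval_pb (m : ℕ) (s : Finset (E d)) (p : Poly d) (t : Fin m → ℝ) :
    eval t (pb m s p) = eval (facePt m s t).ofLp p := by
  rw [pb, eval_bind₁]
  simp only [eval_facePoly]

theorem totalDegree_pb_le (m : ℕ) (s : Finset (E d)) (p : Poly d) :
    (pb m s p).totalDegree ≤ p.totalDegree :=
  totalDegree_bind₁_le (totalDegree_facePoly m s) p

theorem dd_pb (m : ℕ) (s : Finset (E d)) (t : Fin m → ℝ) (p : Poly d) :
    dd t (pb m s p) = pb m s (dd (faceDir m s t) p) :=
  dd_bind₁ _ _ _ (dd_facePoly m s t) p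

theorem dl_pb (m : ℕ) (s : Finset (E d)) (l : List (Fin m → ℝ)) (p : Poly d) :
    dl l (pb m s p) = pb m s (dl (l.map (faceDir m s)) p) := by
  induction l with
  | nil => rfl
  | cons t l ih => rw [dl_cons, ih, dd_pb]; rfl

end PullBack

end Simplices

/-! ### Change of variables and scaling on a cell -/

section CellEstimates

variable {d : ℕ}

theorem dist_le_diam {T : Finset (E d)} {x y : E d} (hx : x ∈ body T) (hy : y ∈ body T) :
    dist x y ≤ diam T :=
  Metric.dist_le_diam_of_mem (isCompact_body T).isBounded hx hy

theorem diam_nonneg (T : Finset (E d)) : 0 ≤ diam T := Metric.diam_nonneg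

theorem measurableSet_refSimplex (m : ℕ) : MeasurableSet (refSimplex m) :=
  (isCompact_refSimplex m).isClosed.measurableSet

theorem hasFDerivAt_facePt (T : Finset (E d)) (x : E d) :
    HasFDerivAt (fun x : E d => facePt d T x.ofLp)
      (∑ j : Fin d, (EuclideanSpace.proj j : E d →L[ℝ] ℝ).smulRight (vert T (j + 1) - vert T 0))
      x := by
  have h : (fun x : E d => facePt d T x.ofLp) = fun x => vert T 0 +
      (∑ j : Fin d, (EuclideanSpace.proj j : E d →L[ℝ] ℝ).smulRight
        (vert T (j + 1) - vert T 0)) x := by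
    funext x
    ext i
    rw [facePt_apply]
    simp [mul_comm]
  rw [h]
  exact (ContinuousLinearMap.hasFDerivAt _).const_add _

/-- Change of variables for the affine parametrization. The value of `J` is never needed; it is
compared between cells through their volumes (`jacobian_le`). -/
theorem IsCell.exists_jacobian {T : Finset (E d)} (hT : IsCell T) :
    ∃ J : ℝ, 0 < J ∧ ∀ f : E d → ℝ,
      ∫ x in body T, f x = J * ∫ t in refSimplex d, f (facePt d T t) := by
  set A : E d →L[ℝ] E d := ∑ j : Fin d,
    (EuclideanSpace.proj j : E d →L[ℝ] ℝ).smulRight (vert T (j + 1) - vert T 0)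
  let S : Set (E d) := WithLp.ofLp ⁻¹' refSimplex d
  have hS : MeasurableSet S :=
    (PiLp.volume_preserving_ofLp (Fin d)).measurable (measurableSet_refSimplex d)
  have himg : (fun x : E d => facePt d T x.ofLp) '' S = body T := by
    rw [body_eq_image hT.card]
    ext x
    constructor
    · rintro ⟨y, hy, rfl⟩; exact ⟨y.ofLp, hy, rfl⟩
    · rintro ⟨t, ht, rfl⟩; exact ⟨WithLp.toLp 2 t, ht, rfl⟩
  have hinj : Set.InjOn (fun x : E d => facePt d T x.ofLp) S := fun x _ y _ h =>
    WithLp.ofLp_injective 2 (hT.facePt_injective h)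
  have key : ∀ f : E d → ℝ, ∫ x in body T, f x
      = |A.det| * ∫ t in refSimplex d, f (facePt d T t) := by
    intro f
    rw [← himg, integral_image_eq_integral_abs_det_fderiv_smul volume hS
      (fun x _ => (hasFDerivAt_facePt T x).hasFDerivWithinAt) hinj]
    simp only [smul_eq_mul]
    rw [integral_const_mul]
    congr 1
    exact (PiLp.volume_preserving_ofLp (Fin d)).setIntegral_preimage_emb
      (MeasurableEquiv.toLp 2 (Fin d → ℝ)).symm.measurableEmbedding
      (fun t => f (facePt d T t)) (refSimplex d)
  -- A vanishing determinant would give the cell volume zero, although its interior is nonempty.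
  refine ⟨|A.det|, lt_of_le_of_ne (abs_nonneg _) fun h => ?_, key⟩
  have h1 := key fun _ => 1
  rw [← h, zero_mul, setIntegral_const, smul_eq_mul, mul_one] at h1
  have h2 : 0 < volume (body T) :=
    (isOpen_interior.measure_pos volume hT.interior_nonempty).trans_le
      (measure_mono interior_subset)
  have h3 : volume (body T) ≠ ⊤ := (isCompact_body T).measure_ne_top
  exact (ENNReal.toReal_pos h2.ne' h3).ne' h1

section InscribedBall

variable {T : Finset (E d)} (hT : IsCell T) {c : E d} {r : ℝ} (hr : 0 < r)
  (hball : Metric.closedBall c r ⊆ body T)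
include hT hr hball

/-- A barycentric coordinate stays in `[0, 1]` along the diameter of the inscribed ball in direction
`t`, so it changes by at most one over the length `2 * r`. -/
theorem IsCell.abs_bary_linear_le {u : E d} (hu : u ∈ T) (t : E d) :
    |(bary T u).linear t| ≤ ‖t‖ / (2 * r) := by
  rcases eq_or_ne t 0 with rfl | ht
  · simp
  have hn : 0 < ‖t‖ := norm_pos_iff.2 ht
  have hmem : ∀ a : ℝ, |a| ≤ r / ‖t‖ → c + a • t ∈ body T := by
    intro a ha
    refine hball ?_
    rw [Metric.mem_closedBall, dist_eq_norm, add_sub_cancel_left, norm_smul, Real.norm_eq_abs]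
    rwa [le_div_iff₀ hn] at ha
  have hf : ∀ a : ℝ, bary T u (c + a • t) = a * (bary T u).linear t + bary T u c := by
    intro a
    have := (bary T u).map_vadd c (a • t)
    simp only [vadd_eq_add, map_smul, smul_eq_mul] at this
    rw [add_comm c, this]
  have hq : 0 < r / ‖t‖ := div_pos hr hn
  have m1 := hmem (r / ‖t‖) (abs_of_pos hq).le
  have m2 := hmem (-(r / ‖t‖)) (by rw [abs_neg, abs_of_pos hq])
  have a1 := hT.bary_nonneg hu m1
  have a2 := hT.bary_nonneg hu m2
  have b1 := hT.bary_le_one hu m1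
  have b2 := hT.bary_le_one hu m2
  rw [hf] at a1 a2 b1 b2
  have h3 : |r / ‖t‖ * (bary T u).linear t| ≤ 1 / 2 := by
    rw [abs_le]; constructor <;> linarith
  rw [abs_mul, abs_of_pos hq, div_mul_eq_mul_div, div_le_iff₀ hn] at h3
  rw [le_div_iff₀ (by positivity)]
  linarith

/-- The coordinate of `u` rises from `0` at `w` to `1` at `u`, while its slope is at most `1 / (2 *
r)`. Shape regularity thus bounds the edge lengths from below. -/
theorem IsCell.two_mul_le_dist {u w : E d} (hu : u ∈ T) (hw : w ∈ T) (huw : u ≠ w) :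
    2 * r ≤ dist u w := by
  have h1 := hT.abs_bary_linear_le hr hball hu (u - w)
  have h2 : (bary T u).linear (u - w) = 1 := by
    have := (bary T u).linearMap_vsub u w
    simp only [vsub_eq_sub] at this
    rw [this, hT.bary_self hu, hT.bary_of_ne hu hw huw, sub_zero]
  rw [h2, abs_one, one_le_div (by positivity), ← dist_eq_norm] at h1
  exact h1

end InscribedBall

/-- The direction in reference coordinates that belongs to the direction `t`. -/
def cellDir (T : Finset (E d)) (t : E d) : Fin d → ℝ :=
  fun j => (bary T (vert T (j + 1))).linear t

/-- The linear parts of the identities `∑ λ_u = 1` and `∑ λ_u u = x` show that the barycentric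
slopes of `t` sum to zero and reproduce `t`. -/
theorem IsCell.faceDir_cellDir {T : Finset (E d)} (hT : IsCell T) (t : E d) :
    faceDir d T (cellDir T t) = t.ofLp := by
  have hlin : ∀ u, (bary T u).linear t = bary T u t - bary T u 0 := fun u => by
    simpa using (bary T u).linearMap_vsub t 0
  have h1 : ∑ i : Fin (d + 1), (bary T (vert T i)).linear t = 0 := by
    rw [sum_vert hT.card fun z => (bary T z).linear t]
    simp only [hlin, Finset.sum_sub_distrib, hT.sum_bary, sub_self]
  have h2 : ∑ i : Fin (d + 1), (bary T (vert T i)).linear t • vert T i = t := by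
    rw [sum_vert hT.card fun z => (bary T z).linear t • z]
    simp only [hlin, sub_smul, Finset.sum_sub_distrib, hT.sum_bary_smul, sub_zero]
  funext i
  conv_rhs => rw [← h2]
  rw [Fin.sum_univ_succ] at h1 ⊢
  simp only [Fin.val_zero, Fin.val_succ] at h1
  simp only [faceDir, cellDir, sub_mul, Finset.sum_sub_distrib, ← Finset.mul_sum,
    Fin.val_zero, Fin.val_succ, PiLp.add_apply, PiLp.smul_apply, WithLp.ofLp_sum,
    Finset.sum_apply, smul_eq_mul, WithLp.ofLp_smul, Pi.smul_apply]
  rw [eq_neg_of_add_eq_zero_left h1]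
  simp only [mul_comm]
  ring

/-- Bounds for the derivatives on a cell from bounds for the coefficients in reference
coordinates. -/
theorem IsCell.abs_eval_dl_le {T : Finset (E d)} (hT : IsCell T) {c : E d} {r : ℝ} (hr : 0 < r)
    (hball : Metric.closedBall c r ⊆ body T) {k : ℕ} {p : Poly d} (hp : p.totalDegree ≤ k)
    {M : ℝ} (hM : CoefBound (pb d T p) M) (l : List (E d)) {x : E d} (hx : x ∈ body T) :
    |eval x.ofLp (dl (l.map WithLp.ofLp) p)| ≤
      (mons d k).card * ((l.map fun t => ‖t‖ / (2 * r) * (d * k)).prod * M) := by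
  obtain ⟨y, hy, rfl⟩ : x ∈ facePt d T '' refSimplex d := body_eq_image hT.card ▸ hx
  have key : ∀ l : List (E d), CoefBound (pb d T (dl (l.map WithLp.ofLp) p))
      ((l.map fun t => ‖t‖ / (2 * r) * (d * k)).prod * M) := by
    intro l
    induction l with
    | nil => simpa using hM
    | cons t l ih =>
      have h1 := ih.dd (k := k) ((totalDegree_pb_le _ _ _).trans ((totalDegree_dl_le _ _).trans hp))
        (t := cellDir T t) (A := ‖t‖ / (2 * r))
        (fun j => hT.abs_bary_linear_le hr hball (vert_mem hT.card j.succ) t) (by positivity)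
      rw [dd_pb, hT.faceDir_cellDir] at h1
      rw [List.map_cons, dl_cons, List.map_cons, List.prod_cons]
      refine h1.mono (le_of_eq ?_)
      ring
  rw [← eval_pb]
  exact (key l).abs_eval_le ((totalDegree_pb_le _ _ _).trans ((totalDegree_dl_le _ _).trans hp))
    fun i => abs_le_one_of_mem_refSimplex hy i

theorem IsCell.hessL2Sq_eq {T : Finset (E d)} (hT : IsCell T) {v : E d → ℝ} {p : Poly d}
    (hv : ∀ x ∈ body T, v x = eval x.ofLp p) :
    hessL2Sq T v = ∫ x in body T, ∑ i, ∑ j, (eval x.ofLp (pderiv i (pderiv j p))) ^ 2 := by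
  refine setIntegral_congr_fun (isClosed_body T).measurableSet fun x hx => ?_
  refine Finset.sum_congr rfl fun i _ => Finset.sum_congr rfl fun j _ => ?_
  have h := iteratedFDerivWithin_eq_dl hT.uniqueDiffOn hv
    [EuclideanSpace.single i 1, EuclideanSpace.single j 1] hx
  have h2 : ([EuclideanSpace.single i 1, EuclideanSpace.single j 1] : List (E d)).get
      = ![EuclideanSpace.single i 1, EuclideanSpace.single j 1] := by
    funext a
    fin_cases a <;> rfl
  rw [h2] at h
  refine congrArg (· ^ 2) (h.trans ?_)
  simp only [List.map_cons, List.map_nil, dl_cons, dl_nil, PiLp.ofLp_single, dd_single]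

theorem dd_dd_sq_le (p : Poly d) (t u x : Fin d → ℝ) :
    (eval x (dd t (dd u p))) ^ 2 ≤ ((∑ i, t i ^ 2) * ∑ i, u i ^ 2) *
      ∑ i, ∑ j, (eval x (pderiv i (pderiv j p))) ^ 2 := by
  have h1 : eval x (dd t (dd u p)) = ∑ q : Fin d × Fin d, (t q.1 * u q.2) *
      eval x (pderiv q.1 (pderiv q.2 p)) := by
    rw [Fintype.sum_prod_type]
    rw [dd_eq_sum t, map_sum]
    refine Finset.sum_congr rfl fun i _ => ?_
    rw [dd_eq_sum u, map_mul, eval_C, map_sum, map_sum, Finset.mul_sum]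
    refine Finset.sum_congr rfl fun j _ => ?_
    rw [pderiv_C_mul, map_mul, eval_C, mul_assoc]
  rw [h1]
  refine (Finset.sum_mul_sq_le_sq_mul_sq _ _ _).trans (le_of_eq ?_)
  congr 1
  · rw [Fintype.sum_prod_type]
    simp only [mul_pow, ← Finset.mul_sum, ← Finset.sum_mul]
  · rw [Fintype.sum_prod_type]

/-- The reference directions correspond to edge vectors of length at most `diam T`, so a squared
second derivative picks up `diam T ^ 4`. The factor `d ^ 2` counts the pairs of directions, and
`J⁻¹` comes from the change of variables. -/
theorem IsCell.refHess_pb_le {T : Finset (E d)} (hT : IsCell T) {v : E d → ℝ} {p : Poly d}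
    (hv : ∀ x ∈ body T, v x = eval x.ofLp p) {J : ℝ} (hJ : 0 < J)
    (hint : ∀ f : E d → ℝ, ∫ x in body T, f x = J * ∫ t in refSimplex d, f (facePt d T t)) :
    refHess (pb d T p) ≤ d ^ 2 * diam T ^ 4 * (J⁻¹ * hessL2Sq T v) := by
  rw [hT.hessL2Sq_eq hv, hint, inv_mul_cancel_left₀ hJ.ne']
  set I := ∫ t in refSimplex d, ∑ i, ∑ j,
    (eval (facePt d T t).ofLp (pderiv i (pderiv j p))) ^ 2
  have hdir : ∀ a : Fin d, ∑ i, (faceDir d T (Pi.single a 1)) i ^ 2 ≤ diam T ^ 2 := by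
    intro a
    rw [faceDir_single, ← EuclideanSpace.real_norm_sq_eq, ← dist_eq_norm]
    gcongr
    exact dist_le_diam (mem_body_of_mem (vert_mem hT.card a.succ))
      (mem_body_of_mem (vert_mem hT.card 0))
  have hterm : ∀ a b : Fin d, ∫ t in refSimplex d, eval t (pderiv a (pderiv b (pb d T p))) ^ 2
      ≤ diam T ^ 4 * I := by
    intro a b
    rw [← integral_const_mul]
    have hcont : ∀ q : Poly d, Continuous fun t => eval (facePt d T t).ofLp q := fun q => by
      simp only [← eval_pb]; exact continuous_eval_poly _
    refine integral_mono (integrableOn_refSimplex ((continuous_eval_poly _).pow 2))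
      (integrableOn_refSimplex ?_) fun t => ?_
    · exact continuous_const.mul (continuous_finsetSum _ fun i _ =>
        continuous_finsetSum _ fun j _ => (hcont _).pow 2)
    · simp only
      rw [← dd_single a, ← dd_single b, dd_pb, dd_pb, eval_pb]
      refine (dd_dd_sq_le _ _ _ _).trans ?_
      refine mul_le_mul_of_nonneg_right ?_ (Finset.sum_nonneg fun _ _ =>
        Finset.sum_nonneg fun _ _ => sq_nonneg _)
      calc _ ≤ diam T ^ 2 * diam T ^ 2 := mul_le_mul (hdir a) (hdir b)
            (Finset.sum_nonneg fun _ _ => sq_nonneg _) (by positivity)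
        _ = diam T ^ 4 := by ring
  calc refHess (pb d T p) ≤ ∑ _a : Fin d, ∑ _b : Fin d, diam T ^ 4 * I :=
        Finset.sum_le_sum fun a _ => Finset.sum_le_sum fun b _ => hterm a b
    _ = d ^ 2 * diam T ^ 4 * I := by simp; ring

theorem IsCell.hessL2Sq_nonneg (T : Finset (E d)) (v : E d → ℝ) : 0 ≤ hessL2Sq T v :=
  integral_nonneg fun _ => Finset.sum_nonneg fun _ _ => Finset.sum_nonneg fun _ _ => sq_nonneg _

end CellEstimates

/-! ### Affine functions as polynomials -/

section AffinePolynomials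

variable {d : ℕ}

/-- An affine function as a polynomial. -/
def affPoly (f : E d →ᵃ[ℝ] ℝ) : Poly d :=
  C (f 0) + ∑ i, C (f.linear (EuclideanSpace.single i 1)) * X i

theorem affine_linear_apply (f : E d →ₗ[ℝ] ℝ) (t : E d) :
    f t = ∑ i, f (EuclideanSpace.single i 1) * t i := by
  have h : t = ∑ i, t i • (EuclideanSpace.single i (1 : ℝ) : E d) := by
    ext j
    simp [Pi.single_apply]
  conv_lhs => rw [h]
  simp [map_sum, mul_comm]

theorem eval_affPoly (f : E d →ᵃ[ℝ] ℝ) (x : E d) : eval x.ofLp (affPoly f) = f x := by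
  have h1 : f x = f.linear x + f 0 := by simpa using f.map_vadd 0 x
  rw [h1, affine_linear_apply f.linear x]
  simp [affPoly, add_comm]

theorem dd_affPoly (f : E d →ᵃ[ℝ] ℝ) (t : E d) : dd t.ofLp (affPoly f) = C (f.linear t) := by
  rw [affine_linear_apply f.linear t]
  simp [affPoly, Derivation.leibniz, mul_comm]

theorem totalDegree_affPoly (f : E d →ᵃ[ℝ] ℝ) : (affPoly f).totalDegree ≤ 1 := by
  refine (totalDegree_add _ _).trans (max_le (by simp) ?_)
  refine totalDegree_finsetSum_le fun j _ => (totalDegree_mul _ _).trans ?_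
  rw [totalDegree_C, totalDegree_X]

end AffinePolynomials

/-! ### Stability of the degrees of freedom, from vertices up to cells -/

section Stability

variable {d : ℕ}

/-- The average over a carrier on a simplex as a linear functional on polynomials. -/
def faceAvg (m : ℕ) (s : Finset (E d)) (c : Carrier m) : Poly d →ₗ[ℝ] ℝ :=
  c.avgL ∘ₗ (pb m s).toLinearMap

theorem faceAvg_apply (m : ℕ) (s : Finset (E d)) (c : Carrier m) (q : Poly d) :
    faceAvg m s c q = c.avg fun t => eval (facePt m s t).ofLp q := by
  simp only [← eval_pb]
  rfl

theorem faceAvg_eq_avg_pb (m : ℕ) (s : Finset (E d)) (c : Carrier m) (q : Poly d) :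
    faceAvg m s c q = c.avg fun t => eval t (pb m s q) := rfl

/-- The degrees of freedom of a polynomial on the subsimplices of `S` are bounded by `M` after
scaling with `h`. -/
structure DofBound (P : DofChoice) (S : Finset (E d)) (h M : ℝ) (q : Poly d) : Prop where
  vertex : ∀ z ∈ S, ∀ l : List (E d), l.length < d →
    |eval z.ofLp (dl (l.map WithLp.ofLp) q)| * h ^ l.length ≤ M * (l.map norm).prod
  value : ∀ m, 1 ≤ m → ∀ s ⊆ S, s.card = m + 1 → ∀ c ∈ P.val m, |faceAvg m s c q| ≤ M
  normal : d = 3 → ∀ e ⊆ S, e.card = 2 → ∀ c ∈ P.nrm, ∀ t : E d,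
    (∀ x ∈ e, ∀ y ∈ e, inner ℝ t (x - y) = 0) → h * |faceAvg 1 e c (dd t.ofLp q)| ≤ M * ‖t‖

theorem DofBound.mono {P : DofChoice} {S S' : Finset (E d)} {h M : ℝ} {q : Poly d}
    (hq : DofBound P S h M q) (hS : S' ⊆ S) : DofBound P S' h M q where
  vertex z hz := hq.vertex z (hS hz)
  value m hm s hs := hq.value m hm s (hs.trans hS)
  normal hd e he := hq.normal hd e (he.trans hS)

/-- The spanning edge vectors of a simplex. -/
def edgeDirs {m : ℕ} (s : Finset (E d)) (l : List (Fin m)) : List (E d) :=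
  l.map fun j : Fin m => vert s ((j : ℕ) + 1) - vert s 0

theorem length_edgeDirs {m : ℕ} (s : Finset (E d)) (l : List (Fin m)) :
    (edgeDirs s l).length = l.length := by simp [edgeDirs]

theorem dl_single_pb {m : ℕ} (s : Finset (E d)) (l : List (Fin m)) (q : Poly d) :
    dl (l.map fun i => Pi.single i 1) (pb m s q)
      = pb m s (dl ((edgeDirs s l).map WithLp.ofLp) q) := by
  rw [dl_pb, edgeDirs, List.map_map, List.map_map]
  have : (faceDir m s ∘ fun i : Fin m => Pi.single i 1)
      = WithLp.ofLp ∘ fun j : Fin m => vert s ((j : ℕ) + 1) - vert s 0 :=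
    funext fun j => faceDir_single m s j
  rw [this]

theorem prod_norm_le {h : ℝ} (hh : 0 ≤ h) {l : List (E d)} (hl : ∀ t ∈ l, ‖t‖ ≤ h) :
    (l.map norm).prod ≤ h ^ l.length := by
  induction l with
  | nil => simp
  | cons t l ih =>
    rw [List.map_cons, List.prod_cons, List.length_cons, pow_succ, mul_comm]
    have h0 : 0 ≤ (l.map norm).prod := List.prod_nonneg fun a ha => by
      obtain ⟨t, -, rfl⟩ := List.mem_map.1 ha
      exact norm_nonneg t
    exact mul_le_mul (ih fun t ht => hl t (List.mem_cons_of_mem _ ht))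
      (hl t List.mem_cons_self) (norm_nonneg _) (by positivity)

theorem prod_edgeDirs_le {m : ℕ} {s : Finset (E d)} (hs : s.card = m + 1) {h : ℝ}
    (hh : ∀ x ∈ s, ∀ y ∈ s, dist x y ≤ h) (l : List (Fin m)) :
    ((edgeDirs s l).map norm).prod ≤ h ^ l.length := by
  rw [← length_edgeDirs s l]
  have h0 : 0 ≤ h := by
    simpa using hh _ (vert_mem hs 0) _ (vert_mem hs 0)
  refine prod_norm_le h0 fun t ht => ?_
  obtain ⟨j, -, rfl⟩ := List.mem_map.1 ht
  rw [← dist_eq_norm]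
  exact hh _ (vert_mem hs j.succ) _ (vert_mem hs 0)

theorem facePt_mem_body_erase {m : ℕ} {s : Finset (E d)} (hs : s.card = m + 1) {t : Fin m → ℝ}
    (ht : t ∈ refBdry m) : ∃ e ⊆ s, e.card = m ∧ facePt m s t ∈ body e := by
  classical
  obtain ⟨i, hi⟩ : ∃ i : Fin (m + 1), refBary t i = 0 := by
    rcases ht.2 with ⟨i, hi⟩ | h
    · exact ⟨i.succ, by simpa [refBary] using hi⟩
    · exact ⟨0, by simp [refBary, h]⟩
  refine ⟨s.erase (vert s i), Finset.erase_subset _ _, ?_, ?_⟩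
  · rw [Finset.card_erase_of_mem (vert_mem hs i), hs, Nat.add_sub_cancel]
  · rw [facePt_eq, ← Finset.add_sum_erase _ _ (Finset.mem_univ i), hi, zero_smul, zero_add]
    have h1 : ∑ j ∈ Finset.univ.erase i, refBary t j = 1 := by
      rw [← sum_refBary t, ← Finset.add_sum_erase _ _ (Finset.mem_univ i), hi, zero_add]
    refine (convex_convexHull ℝ _).sum_mem (fun j _ => refBary_nonneg ht.1 j) h1 fun j hj => ?_
    refine subset_convexHull ℝ _ (Finset.mem_coe.2 (Finset.mem_erase.2 ⟨fun h => ?_,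
      vert_mem hs j⟩))
    exact Finset.ne_of_mem_erase hj (vert_injective hs h)

theorem exists_vert_of_mem_refBdry_one {s : Finset (E d)} (hs : s.card = 2) {t : Fin 1 → ℝ}
    (ht : t ∈ refBdry 1) : facePt 1 s t ∈ s := by
  obtain ⟨e, he, hc, hx⟩ := facePt_mem_body_erase hs ht
  obtain ⟨z, rfl⟩ := Finset.card_eq_one.1 hc
  rw [body_singleton] at hx
  rw [Set.mem_singleton_iff.1 hx]
  exact he (Finset.mem_singleton_self z)

theorem CoefBound.abs_eval_body_le {m k : ℕ} {s : Finset (E d)} (hs : s.card = m + 1)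
    {q : Poly d} (hq : q.totalDegree ≤ k) {M : ℝ} (h : CoefBound (pb m s q) M) {x : E d}
    (hx : x ∈ body s) : |eval x.ofLp q| ≤ (mons m k).card * M := by
  obtain ⟨y, hy, rfl⟩ : x ∈ facePt m s '' refSimplex m := body_eq_image hs ▸ hx
  rw [← eval_pb]
  exact h.abs_eval_le ((totalDegree_pb_le _ _ _).trans hq)
    fun i => abs_le_one_of_mem_refSimplex hy i

/-- The boundary points of an edge are vertices, where derivatives in all directions are controlled.
The directions in `l` run along the edge; their lengths are at most `h` and cancel against the
powers of `h`, so that only the scaling of `l'` remains. -/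
theorem DofBound.edge_jet {P : DofChoice} {e : Finset (E d)} (he : e.card = 2) {h M : ℝ}
    {q : Poly d} (hq : DofBound P e h M q) (hh : 0 < h) (hM : 0 ≤ M)
    (hdist : ∀ x ∈ e, ∀ y ∈ e, dist x y ≤ h) (l : List (Fin 1)) (l' : List (E d))
    (hl : l.length + l'.length < d) {t : Fin 1 → ℝ} (ht : t ∈ refBdry 1) :
    |eval t (dl (l.map fun i => Pi.single i 1) (pb 1 e (dl (l'.map WithLp.ofLp) q)))|
      * h ^ l'.length ≤ M * (l'.map norm).prod := by
  have happ : ∀ a b : List (Fin d → ℝ), dl a (dl b q) = dl (a ++ b) q := by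
    intro a b
    induction a with
    | nil => rfl
    | cons t a ih => rw [dl_cons, ih]; rfl
  rw [dl_single_pb, eval_pb, happ, ← List.map_append]
  have h1 := hq.vertex _ (exists_vert_of_mem_refBdry_one he ht) (edgeDirs e l ++ l')
    (by simpa [length_edgeDirs] using hl)
  rw [List.length_append, List.map_append (f := norm), List.prod_append, length_edgeDirs,
    pow_add, mul_left_comm, mul_left_comm M] at h1
  have h2 := prod_edgeDirs_le he hdist l
  have h3 : 0 ≤ (l'.map norm).prod := List.prod_nonneg fun a ha => by
    obtain ⟨t, -, rfl⟩ := List.mem_map.1 ha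
    exact norm_nonneg t
  have h4 : 0 < h ^ l.length := by positivity
  refine le_of_mul_le_mul_left (h1.trans ?_) h4
  gcongr

/-- The values on an edge are controlled by the degrees of freedom. -/
theorem exists_edge_bound {k : ℕ} {P : DofChoice}
    (hP : IsUnisolventBubble (P.val 1) d k) :
    ∃ C : ℝ, 0 ≤ C ∧ ∀ e : Finset (E d), e.card = 2 → ∀ h : ℝ, 0 < h →
      (∀ x ∈ e, ∀ y ∈ e, dist x y ≤ h) → ∀ q : Poly d, q.totalDegree ≤ k → ∀ M : ℝ, 0 ≤ M →
      DofBound P e h M q → CoefBound (pb 1 e q) (C * M) := by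
  obtain ⟨C, hC, H⟩ := hP.exists_coefBound le_rfl
  refine ⟨C, hC, fun e he h hh hdist q hq M hM hb => H _ ((totalDegree_pb_le _ _ _).trans hq) M hM
    (fun l hl t ht => ?_) fun c hc => hb.value 1 le_rfl e subset_rfl he c hc⟩
  simpa using hb.edge_jet he hh hM hdist l [] (by simpa using hl) ht

/-- The gradients on an edge are controlled by the degrees of freedom. -/
theorem exists_edge_grad_bound {k : ℕ} {P : DofChoice} (hd : d = 3)
    (hP : IsUnisolventBubble (P.val 1) d k) (hN : IsUnisolventBubble P.nrm 2 (k - 1)) (κ : ℝ) :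
    ∃ C : ℝ, 0 ≤ C ∧ ∀ e : Finset (E d), e.card = 2 → ∀ h : ℝ, 0 < h →
      (∀ x ∈ e, ∀ y ∈ e, dist x y ≤ h) → (∀ x ∈ e, ∀ y ∈ e, x ≠ y → h ≤ κ * dist x y) →
      ∀ q : Poly d, q.totalDegree ≤ k → ∀ M : ℝ, 0 ≤ M → DofBound P e h M q →
      ∀ x ∈ body e, ∀ t : E d, h * |eval x.ofLp (dd t.ofLp q)| ≤ C * M * ‖t‖ := by
  obtain ⟨C₁, hC₁, H₁⟩ := exists_edge_bound hP
  obtain ⟨C₂, hC₂, H₂⟩ := hN.exists_coefBound le_rfl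
  set N₁ : ℝ := ((mons 1 k).card : ℝ)
  set N₂ : ℝ := ((mons 1 (k - 1)).card : ℝ)
  have hκ' : κ ≤ |κ| := le_abs_self κ
  refine ⟨2 * (N₂ * C₂) + |κ| * (N₁ * (k * C₁)), by positivity,
    fun e he h hh hdist hκ q hq M hM hb x hx t => ?_⟩
  -- On the edge a normal derivative is a polynomial of degree at most `k - 1`. Its values and first
  -- derivatives at the end points are vertex data of order at most two, and its averages are
  -- degrees of freedom.
  have hnormal : ∀ t : E d, (∀ x ∈ e, ∀ y ∈ e, inner ℝ t (x - y) = 0) →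
      h * |eval x.ofLp (dd t.ofLp q)| ≤ N₂ * C₂ * M * ‖t‖ := by
    intro t ht
    have hdeg : (dd t.ofLp q).totalDegree ≤ k - 1 :=
      (totalDegree_dd_le _ _).trans (Nat.sub_le_sub_right hq 1)
    have h1 : CoefBound (pb 1 e (dd t.ofLp q)) (C₂ * (M * ‖t‖ / h)) := by
      refine H₂ _ ((totalDegree_pb_le _ _ _).trans hdeg) _ (by positivity) (fun l hl y hy => ?_)
        fun c hc => ?_
      · have := hb.edge_jet he hh hM hdist l [t] (by simp; omega) hy
        rw [le_div_iff₀ hh]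
        simpa using this
      · rw [le_div_iff₀ hh, mul_comm]
        exact hb.normal hd e subset_rfl he c hc t ht
    have h2 := h1.abs_eval_body_le (k := k - 1) he hdeg hx
    calc h * |eval x.ofLp (dd t.ofLp q)| ≤ h * (N₂ * (C₂ * (M * ‖t‖ / h))) := by gcongr
      _ = N₂ * C₂ * M * ‖t‖ := by field_simp
  set D : E d := vert e 1 - vert e 0
  have hv0 := vert_mem he 0
  have hv1 := vert_mem he 1
  have hne : vert e 1 ≠ vert e 0 := by
    intro h
    have := vert_injective he (a₁ := 1) (a₂ := 0) h
    simp at this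
  have hD : 0 < ‖D‖ := norm_pos_iff.2 (sub_ne_zero.2 hne)
  have hhD : h ≤ |κ| * ‖D‖ := by
    have := hκ _ hv1 _ hv0 hne
    rw [dist_eq_norm] at this
    exact this.trans (by gcongr; exact le_rfl)
  -- The derivative along the edge is the derivative of the restriction to the edge, whose
  -- coefficients are already bounded.
  have htang : |eval x.ofLp (dd D.ofLp q)| ≤ N₁ * (k * (C₁ * M)) := by
    have h1 := (H₁ e he h hh hdist q hq M hM hb).pderiv ((totalDegree_pb_le _ _ _).trans hq) 0
    rw [← dd_single, dd_pb, faceDir_single] at h1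
    exact h1.abs_eval_body_le he ((totalDegree_dd_le _ _).trans (by omega)) hx
  -- Orthogonal splitting of `t` into a multiple of the edge vector `D` and a normal direction.
  -- Dividing by `‖D‖` is harmless because `h ≤ |κ| * ‖D‖`.
  set a : ℝ := inner ℝ t D / ‖D‖ ^ 2
  have ha : |a| ≤ ‖t‖ / ‖D‖ := by
    rw [abs_div, abs_of_pos (by positivity : 0 < ‖D‖ ^ 2), div_le_div_iff₀ (by positivity) hD]
    calc |inner ℝ t D| * ‖D‖ ≤ (‖t‖ * ‖D‖) * ‖D‖ := by
          gcongr; exact abs_real_inner_le_norm t D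
      _ = ‖t‖ * ‖D‖ ^ 2 := by ring
  have horth : inner ℝ (t - a • D) D = 0 := by
    rw [inner_sub_left, real_inner_smul_left, real_inner_self_eq_norm_sq]
    simp only [a]
    field_simp
    ring
  have hall : ∀ z ∈ e, ∀ y ∈ e, inner ℝ (t - a • D) (z - y) = 0 := by
    intro z hz y hy
    obtain ⟨i, rfl⟩ := exists_vert_eq he hz
    obtain ⟨j, rfl⟩ := exists_vert_eq he hy
    have h2 : inner ℝ (t - a • D) (vert e 0 - vert e 1) = 0 := by
      have : vert e 0 - vert e 1 = -D := (neg_sub _ _).symm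
      rw [this, inner_neg_right, horth, neg_zero]
    fin_cases i <;> fin_cases j
    · simp
    · exact h2
    · exact horth
    · simp
  have hn := hnormal _ hall
  have hnorm : ‖t - a • D‖ ≤ 2 * ‖t‖ := by
    have h2 : ‖a • D‖ ≤ ‖t‖ := by
      rw [norm_smul, Real.norm_eq_abs]
      calc |a| * ‖D‖ ≤ ‖t‖ / ‖D‖ * ‖D‖ := by gcongr
        _ = ‖t‖ := by field_simp
    linarith [norm_sub_le t (a • D)]
  have hsplit : eval x.ofLp (dd t.ofLp q)
      = eval x.ofLp (dd (t - a • D).ofLp q) + a * eval x.ofLp (dd D.ofLp q) := by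
    have h2 : t.ofLp = (t - a • D).ofLp + a • D.ofLp := by
      funext i
      simp
    conv_lhs => rw [h2, dd_add, dd_smul, map_add, map_mul, eval_C]
  have hha : h * |a| ≤ |κ| * ‖t‖ := by
    calc h * |a| ≤ (|κ| * ‖D‖) * (‖t‖ / ‖D‖) := by gcongr
      _ = |κ| * ‖t‖ := by field_simp
  rw [hsplit]
  calc h * |eval x.ofLp (dd (t - a • D).ofLp q) + a * eval x.ofLp (dd D.ofLp q)|
      ≤ h * (|eval x.ofLp (dd (t - a • D).ofLp q)| + |a| * |eval x.ofLp (dd D.ofLp q)|) := by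
        gcongr
        rw [← abs_mul]
        exact abs_add_le _ _
    _ = h * |eval x.ofLp (dd (t - a • D).ofLp q)| + (h * |a|) * |eval x.ofLp (dd D.ofLp q)| := by
        ring
    _ ≤ N₂ * C₂ * M * (2 * ‖t‖) + (|κ| * ‖t‖) * (N₁ * (k * (C₁ * M))) := by
        refine add_le_add (hn.trans (by gcongr)) ?_
        gcongr
    _ = _ := by ring

/-- Values and derivatives of lower order on the boundary of a simplex together with the averages
over the carriers control the values on the simplex. -/
theorem exists_face_bound {m r k : ℕ} {P : DofChoice} (hm : 1 ≤ m)
    (hP : IsUnisolventBubble (P.val m) r k) :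
    ∃ C : ℝ, 0 ≤ C ∧ ∀ s : Finset (E d), s.card = m + 1 → ∀ h : ℝ,
      ∀ q : Poly d, q.totalDegree ≤ k → ∀ M : ℝ, 0 ≤ M → DofBound P s h M q →
      (∀ e ⊆ s, e.card = m → ∀ x ∈ body e, ∀ l : List (Fin m), l.length < r →
        |eval x.ofLp (dl ((edgeDirs s l).map WithLp.ofLp) q)| ≤ M) →
      ∀ x ∈ body s, |eval x.ofLp q| ≤ C * M := by
  obtain ⟨C, hC, H⟩ := hP.exists_coefBound hm
  refine ⟨(mons m k).card * C, by positivity, fun s hs h q hq M hM hb hbd x hx => ?_⟩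
  rw [mul_assoc]
  refine CoefBound.abs_eval_body_le hs hq (H _ ((totalDegree_pb_le _ _ _).trans hq) M hM
    (fun l hl t ht => ?_) fun c hc => hb.value m hm s subset_rfl hs c hc) hx
  rw [dl_single_pb, eval_pb]
  obtain ⟨e, he, hc, hx⟩ := facePt_mem_body_erase hs ht
  exact hbd e he hc _ hx l hl

theorem DofBound.weaken {P : DofChoice} {S : Finset (E d)} {h M M' : ℝ} {q : Poly d}
    (hq : DofBound P S h M q) (hM : M ≤ M') : DofBound P S h M' q where
  vertex z hz l hl := (hq.vertex z hz l hl).trans (mul_le_mul_of_nonneg_right hM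
    (List.prod_nonneg fun a ha => by
      obtain ⟨t, -, rfl⟩ := List.mem_map.1 ha
      exact norm_nonneg t))
  value m hm s hs hc c hcc := (hq.value m hm s hs hc c hcc).trans hM
  normal hd e he hc c hcc t ht := (hq.normal hd e he hc c hcc t ht).trans
    (mul_le_mul_of_nonneg_right hM (norm_nonneg _))

/-- Stability of the degrees of freedom on all subsimplices of a cell. -/
theorem exists_stability {k : ℕ} (hd : d = 2 ∨ d = 3) {P : DofChoice} (hP : P.IsAdmissible d k)
    (κ : ℝ) :
    ∃ C : ℝ, 0 ≤ C ∧ ∀ s : Finset (E d), s.Nonempty → s.card ≤ d + 1 → ∀ h : ℝ, 0 < h →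
      (∀ x ∈ s, ∀ y ∈ s, dist x y ≤ h) → (∀ x ∈ s, ∀ y ∈ s, x ≠ y → h ≤ κ * dist x y) →
      ∀ q : Poly d, q.totalDegree ≤ k → ∀ M : ℝ, 0 ≤ M → DofBound P s h M q →
      (∀ x ∈ body s, |eval x.ofLp q| ≤ C * M) ∧
      (d = 3 → s.card = 2 → ∀ x ∈ body s, ∀ t : E d,
        h * |eval x.ofLp (dd t.ofLp q)| ≤ C * M * ‖t‖) := by
  obtain ⟨C₁, hC₁, H₁⟩ := exists_edge_bound (d := d) (P := P) (k := k)
    (by simpa using hP.val 1 le_rfl (by omega))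
  obtain ⟨G, hG, HG⟩ : ∃ G : ℝ, 0 ≤ G ∧ (d = 3 → ∀ e : Finset (E d), e.card = 2 → ∀ h : ℝ, 0 < h →
      (∀ x ∈ e, ∀ y ∈ e, dist x y ≤ h) → (∀ x ∈ e, ∀ y ∈ e, x ≠ y → h ≤ κ * dist x y) →
      ∀ q : Poly d, q.totalDegree ≤ k → ∀ M : ℝ, 0 ≤ M → DofBound P e h M q →
      ∀ x ∈ body e, ∀ t : E d, h * |eval x.ofLp (dd t.ofLp q)| ≤ G * M * ‖t‖) := by
    by_cases h3 : d = 3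
    · obtain ⟨G, hG, H⟩ := exists_edge_grad_bound (P := P) (k := k) h3
        (by simpa using hP.val 1 le_rfl (by omega)) (hP.nrm h3) κ
      exact ⟨G, hG, fun _ => H⟩
    · exact ⟨0, le_rfl, fun h => absurd h h3⟩
  obtain ⟨C₂, hC₂, H₂⟩ := exists_face_bound (d := d) (P := P) (by norm_num)
    (hP.val 2 (by norm_num) (by omega))
  obtain ⟨C₃, hC₃, H₃⟩ : ∃ C₃ : ℝ, 0 ≤ C₃ ∧ (d = 3 → ∀ s : Finset (E d), s.card = 3 + 1 → ∀ h : ℝ,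
      ∀ q : Poly d, q.totalDegree ≤ k → ∀ M : ℝ, 0 ≤ M → DofBound P s h M q →
      (∀ e ⊆ s, e.card = 3 → ∀ x ∈ body e, ∀ l : List (Fin 3), l.length < d + 1 - 3 →
        |eval x.ofLp (dl ((edgeDirs s l).map WithLp.ofLp) q)| ≤ M) →
      ∀ x ∈ body s, |eval x.ofLp q| ≤ C₃ * M) := by
    by_cases h3 : d = 3
    · obtain ⟨C, hC, H⟩ := exists_face_bound (d := d) (P := P) (by norm_num)
        (hP.val 3 (by norm_num) (by omega))
      exact ⟨C, hC, fun _ => H⟩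
    · exact ⟨0, le_rfl, fun h => absurd h h3⟩
  obtain ⟨B₁, hB₁, E1⟩ : ∃ B : ℝ, 0 ≤ B ∧ ∀ s : Finset (E d), s.card = 2 → ∀ h : ℝ, 0 < h →
      (∀ x ∈ s, ∀ y ∈ s, dist x y ≤ h) →
      ∀ q : Poly d, q.totalDegree ≤ k → ∀ M : ℝ, 0 ≤ M → DofBound P s h M q →
      ∀ x ∈ body s, |eval x.ofLp q| ≤ B * M := by
    refine ⟨(mons 1 k).card * C₁, by positivity, fun s hs h hh hdist q hq M hM hb x hx => ?_⟩
    rw [mul_assoc]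
    exact CoefBound.abs_eval_body_le hs hq (H₁ s hs h hh hdist q hq M hM hb) hx
  obtain ⟨B₂, hB₂, E2⟩ : ∃ B : ℝ, 0 ≤ B ∧ ∀ s : Finset (E d), s.card = 3 → ∀ h : ℝ, 0 < h →
      (∀ x ∈ s, ∀ y ∈ s, dist x y ≤ h) → (∀ x ∈ s, ∀ y ∈ s, x ≠ y → h ≤ κ * dist x y) →
      ∀ q : Poly d, q.totalDegree ≤ k → ∀ M : ℝ, 0 ≤ M → DofBound P s h M q →
      ∀ x ∈ body s, |eval x.ofLp q| ≤ B * M := by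
    -- The sum `1 + B₁ + G` covers all data of a triangle: its own degrees of freedom, the values on
    -- its edges, and the gradients on its edges.
    refine ⟨C₂ * (1 + B₁ + G), by positivity,
      fun s hs h hh hdist hκ q hq M hM hb x hx => ?_⟩
    have hMA : M ≤ (1 + B₁ + G) * M := le_mul_of_one_le_left hM (by linarith)
    rw [mul_assoc]
    refine H₂ s hs h q hq _ (hM.trans hMA) (hb.weaken hMA) (fun e he hec y hy l hl => ?_) x hx
    have hbe := hb.mono he
    have hdiste : ∀ x ∈ e, ∀ y ∈ e, dist x y ≤ h := fun x hx y hy => hdist x (he hx) y (he hy)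
    have hκe : ∀ x ∈ e, ∀ y ∈ e, x ≠ y → h ≤ κ * dist x y :=
      fun x hx y hy => hκ x (he hx) y (he hy)
    -- The bubble exponent on a triangle is `d - 1`: edge values suffice for `d = 2`, and first
    -- derivatives are needed in addition for `d = 3`.
    match l with
    | [] =>
      refine (E1 e hec h hh hdiste q hq M hM hbe y hy).trans ?_
      exact mul_le_mul_of_nonneg_right (by linarith) hM
    | [j] =>
      have h3 : d = 3 := by rw [List.length_singleton] at hl; omega
      have h4 := HG h3 e hec h hh hdiste hκe q hq M hM hbe y hy (vert s (j + 1) - vert s 0)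
      have h5 : ‖vert s (j + 1) - vert s 0‖ ≤ h := by
        rw [← dist_eq_norm]
        exact hdist _ (vert_mem hs j.succ) _ (vert_mem hs 0)
      have h6 : |eval y.ofLp (dl ((edgeDirs s [j]).map WithLp.ofLp) q)| ≤ G * M := by
        refine le_of_mul_le_mul_left (h4.trans ?_) hh
        rw [mul_comm h]
        exact mul_le_mul_of_nonneg_left h5 (mul_nonneg hG hM)
      exact h6.trans (mul_le_mul_of_nonneg_right (by linarith) hM)
    | _ :: _ :: _ => rw [List.length_cons, List.length_cons] at hl; omega
  obtain ⟨B₃, hB₃, E3⟩ : ∃ B : ℝ, 0 ≤ B ∧ (d = 3 → ∀ s : Finset (E d), s.card = 4 → ∀ h : ℝ,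
      0 < h →
      (∀ x ∈ s, ∀ y ∈ s, dist x y ≤ h) → (∀ x ∈ s, ∀ y ∈ s, x ≠ y → h ≤ κ * dist x y) →
      ∀ q : Poly d, q.totalDegree ≤ k → ∀ M : ℝ, 0 ≤ M → DofBound P s h M q →
      ∀ x ∈ body s, |eval x.ofLp q| ≤ B * M) := by
    refine ⟨C₃ * (1 + B₂), by positivity,
      fun h3 s hs h hh hdist hκ q hq M hM hb x hx => ?_⟩
    have hMA : M ≤ (1 + B₂) * M := le_mul_of_one_le_left hM (by linarith)
    rw [mul_assoc]
    refine H₃ h3 s hs h q hq _ (hM.trans hMA) (hb.weaken hMA) (fun e he hec y hy l hl => ?_) x hx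
    -- On a tetrahedron the bubble exponent is `1`, so only values on the facets enter.
    have hl0 : l = [] := List.length_eq_zero_iff.1 (by omega)
    subst hl0
    refine (E2 e hec h hh (fun x hx y hy => hdist x (he hx) y (he hy))
      (fun x hx y hy => hκ x (he hx) y (he hy)) q hq M hM (hb.mono he) y hy).trans ?_
    exact mul_le_mul_of_nonneg_right (by linarith) hM
  refine ⟨1 + B₁ + B₂ + B₃ + G, by positivity,
    fun s hs hcard h hh hdist hκ q hq M hM hb => ⟨fun x hx => ?_, fun h3 hc x hx t => ?_⟩⟩
  · have hpos := hs.card_pos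
    have hc : s.card = 1 ∨ s.card = 2 ∨ s.card = 3 ∨ (d = 3 ∧ s.card = 4) := by omega
    rcases hc with hc | hc | hc | ⟨h3, hc⟩
    · obtain ⟨z, rfl⟩ := Finset.card_eq_one.1 hc
      rw [body_singleton, Set.mem_singleton_iff] at hx
      subst hx
      have h1 := hb.vertex x (Finset.mem_singleton_self x) [] (by simp; omega)
      simp only [List.map_nil, dl_nil, List.length_nil, pow_zero, mul_one, List.prod_nil] at h1
      exact h1.trans (le_mul_of_one_le_left hM (by linarith))
    · refine (E1 s hc h hh hdist q hq M hM hb x hx).trans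
        (mul_le_mul_of_nonneg_right (by linarith) hM)
    · refine (E2 s hc h hh hdist hκ q hq M hM hb x hx).trans
        (mul_le_mul_of_nonneg_right (by linarith) hM)
    · refine (E3 h3 s hc h hh hdist hκ q hq M hM hb x hx).trans
        (mul_le_mul_of_nonneg_right (by linarith) hM)
  · refine (HG h3 s hc h hh hdist hκ q hq M hM hb x hx t).trans (mul_le_mul_of_nonneg_right
      (mul_le_mul_of_nonneg_right (by linarith) hM) (norm_nonneg t))

end Stability

/-! ### Vanishing degrees of freedom -/

section Unisolvence

variable {d : ℕ}

theorem exists_le_mul_dist {X : Type*} [MetricSpace X] (s : Finset X) {h : ℝ} (hh : 0 < h) :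
    ∃ κ : ℝ, ∀ x ∈ s, ∀ y ∈ s, x ≠ y → h ≤ κ * dist x y := by
  refine ⟨∑ p ∈ s ×ˢ s, h / dist p.1 p.2, fun x hx y hy hxy => ?_⟩
  rw [← div_le_iff₀ (dist_pos.2 hxy)]
  have h1 : ∀ p ∈ s ×ˢ s, 0 ≤ h / dist p.1 p.2 := fun p _ => by positivity
  exact Finset.single_le_sum h1 (Finset.mk_mem_product hx hy)

/-- Vanishing degrees of freedom: the qualitative version of `exists_stability`. -/
theorem DofBound.eval_eq_zero {k : ℕ} (hd : d = 2 ∨ d = 3) {P : DofChoice}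
    (hP : P.IsAdmissible d k) {s : Finset (E d)} (hs : s.Nonempty) (hcard : s.card ≤ d + 1)
    {q : Poly d} (hq : q.totalDegree ≤ k) (hb : ∀ h : ℝ, 0 < h → DofBound P s h 0 q) :
    (∀ x ∈ body s, eval x.ofLp q = 0) ∧
      (d = 3 → s.card = 2 → ∀ x ∈ body s, ∀ t : E d, eval x.ofLp (dd t.ofLp q) = 0) := by
  classical
  -- Since the bound is `M = 0`, the scale `h` and the ratio `κ` may depend on the simplex, and no
  -- shape regularity is needed.
  obtain ⟨h, hh, hdist⟩ : ∃ h : ℝ, 0 < h ∧ ∀ x ∈ s, ∀ y ∈ s, dist x y ≤ h :=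
    ⟨diam s + 1, by linarith [diam_nonneg s], fun x hx y hy =>
      (dist_le_diam (mem_body_of_mem hx) (mem_body_of_mem hy)).trans (by linarith)⟩
  obtain ⟨κ, hκ⟩ := exists_le_mul_dist s hh
  obtain ⟨C, -, H⟩ := exists_stability hd hP κ
  obtain ⟨h1, h2⟩ := H s hs hcard h hh hdist hκ q hq 0 le_rfl (hb h hh)
  refine ⟨fun x hx => by simpa using h1 x hx, fun h3 hc x hx t => ?_⟩
  have h4 := h2 h3 hc x hx t
  rw [mul_zero, zero_mul] at h4
  by_contra h5
  exact absurd h4 (not_le.2 (mul_pos hh (abs_pos.2 h5)))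

end Unisolvence

/-! ### Degrees of freedom as functionals on polynomials -/

section DofFunctionals

variable {d : ℕ}

/-- A degree of freedom as a linear functional on polynomials. -/
def polyDof (α : Dof d) : Poly d →ₗ[ℝ] ℝ :=
  faceAvg α.m α.s α.c ∘ₗ dl (α.dirs.map WithLp.ofLp)

theorem polyDof_apply (α : Dof d) (q : Poly d) :
    polyDof α q = faceAvg α.m α.s α.c (dl (α.dirs.map WithLp.ofLp) q) := rfl

theorem faceAvg_congr {m : ℕ} {s : Finset (E d)} (hs : s.card = m + 1) {c : Carrier m}
    (hc : c.IsInterior) {p q : Poly d} (h : ∀ x ∈ body s, eval x.ofLp p = eval x.ofLp q) :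
    faceAvg m s c p = faceAvg m s c q := by
  rw [faceAvg_apply, faceAvg_apply]
  exact Carrier.avg_congr hc fun t ht => h _ (facePt_mem_body hs ht)

theorem Dof.eval_eq_polyDof {α : Dof d} (hs : α.s.card = α.m + 1) (hc : α.c.IsInterior)
    {T : Finset (E d)} (hT : IsCell T) (hsT : α.s ⊆ T) {v : E d → ℝ} {p : Poly d}
    (hv : ∀ x ∈ body T, v x = MvPolynomial.eval x.ofLp p) : α.eval T v = polyDof α p := by
  rw [polyDof_apply, faceAvg_apply, Dof.eval]
  refine Carrier.avg_congr hc fun t ht => ?_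
  exact iteratedFDerivWithin_eq_dl hT.uniqueDiffOn hv α.dirs
    (body_mono hsT (facePt_mem_body hs ht))

theorem polyDof_eq_zero {γ : Dof d} (hs : γ.s.card = γ.m + 1) (hc : γ.c.IsInterior) {n : ℕ}
    {q : Poly d} (hq : ∀ y ∈ body γ.s, q ∈ vanish y.ofLp ^ n) (hn : γ.dirs.length < n) :
    polyDof γ q = 0 := by
  rw [polyDof_apply, faceAvg_congr (q := 0) hs hc, map_zero]
  intro x hx
  rw [map_zero]
  exact eval_dl_eq_zero (hq x hx) (by simpa using hn)

end DofFunctionals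

/-! ### The finite set of degrees of freedom -/

section DofSet

variable {d k : ℕ} {K : SimplicialComplex ℝ (E d)} {P : DofChoice}
  {tv : E d → Module.Basis (Fin d) ℝ (E d)} {te : Finset (E d) → Fin 2 → E d}

theorem IsDof.mem_faces {α : Dof d} (hα : IsDof K P tv te α) : α.s ∈ K.faces := by
  cases hα <;> assumption

theorem IsDof.card_eq {α : Dof d} (hα : IsDof K P tv te α) : α.s.card = α.m + 1 := by
  cases hα <;> first | assumption | simp

/-- Each simplex of `K` is a face of a cell. -/
def IsPure (K : SimplicialComplex ℝ (E d)) : Prop := ∀ s ∈ K.faces, ∃ T ∈ cells K, s ⊆ T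

theorem card_le_of_mem_faces (hK : IsPure K) {s : Finset (E d)} (hs : s ∈ K.faces) :
    s.card ≤ d + 1 := by
  obtain ⟨T, hT, hsT⟩ := hK s hs
  exact (Finset.card_le_card hsT).trans hT.2.le

theorem IsDof.isInterior (hK : IsPure K) (hP : P.IsAdmissible d k) {α : Dof d}
    (hα : IsDof K P tv te α) : α.c.IsInterior := by
  cases hα with
  | vertex_value z hz => simp [Carrier.IsInterior]
  | vertex_grad z hz i => simp [Carrier.IsInterior]
  | vertex_hess hd z hz i j hij => simp [Carrier.IsInterior]
  | face_value m hm s hs hsm c hc =>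
    refine (hP.val m hm ?_).1 c hc
    have := card_le_of_mem_faces hK hs
    omega
  | edge_normal hd e he he2 c hc i => exact (hP.nrm hd).1 c hc

theorem finite_isDof (hfin : K.faces.Finite) (hK : IsPure K) :
    {α : Dof d | IsDof K P tv te α}.Finite := by
  have hZ : {z : E d | {z} ∈ K.faces}.Finite :=
    hfin.preimage (Finset.singleton_injective.injOn)
  have h1 : (⋃ z ∈ {z : E d | {z} ∈ K.faces}, ({⟨0, {z}, .point 0, []⟩} : Set (Dof d)) ∪
      (Set.range fun i => ⟨0, {z}, .point 0, [tv z i]⟩) ∪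
      Set.range fun p : Fin d × Fin d => ⟨0, {z}, .point 0, [tv z p.1, tv z p.2]⟩).Finite :=
    hZ.biUnion fun z _ => ((Set.finite_singleton _).union (Set.finite_range _)).union
      (Set.finite_range _)
  have h2 : (⋃ m ∈ Set.Iic d, ⋃ s ∈ K.faces,
      (fun c : Carrier m => (⟨m, s, c, []⟩ : Dof d)) '' (P.val m : Set (Carrier m))).Finite :=
    (Set.finite_Iic d).biUnion fun m _ => hfin.biUnion fun s _ =>
      (Finset.finite_toSet _).image _
  have h3 : (⋃ e ∈ K.faces, (fun p : Carrier 1 × Fin 2 => (⟨1, e, p.1, [te e p.2]⟩ : Dof d)) ''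
      ((P.nrm : Set (Carrier 1)) ×ˢ Set.univ)).Finite :=
    hfin.biUnion fun e _ => ((Finset.finite_toSet _).prod Set.finite_univ).image _
  refine ((h1.union h2).union h3).subset fun α hα => ?_
  cases hα with
  | vertex_value z hz =>
    exact Or.inl (Or.inl (Set.mem_biUnion hz (Or.inl (Or.inl rfl))))
  | vertex_grad z hz i =>
    exact Or.inl (Or.inl (Set.mem_biUnion hz (Or.inl (Or.inr ⟨i, rfl⟩))))
  | vertex_hess hd z hz i j hij =>
    exact Or.inl (Or.inl (Set.mem_biUnion hz (Or.inr ⟨(i, j), rfl⟩)))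
  | face_value m hm s hs hsm c hc =>
    refine Or.inl (Or.inr (Set.mem_biUnion (x := m) ?_ (Set.mem_biUnion hs ⟨c, hc, rfl⟩)))
    have := card_le_of_mem_faces hK hs
    exact Set.mem_Iic.2 (by omega)
  | edge_normal hd e he he2 c hc i =>
    exact Or.inr (Set.mem_biUnion he ⟨(c, i), ⟨hc, trivial⟩, rfl⟩)

end DofSet

/-! ### Bubbles on subsimplices and extension to a cell -/

section ShapeFunctions

variable {d : ℕ}

theorem prod_vert {m : ℕ} {s : Finset (E d)} (hs : s.card = m + 1) {M : Type*} [CommMonoid M]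
    (f : E d → M) : ∏ i : Fin (m + 1), f (vert s i) = ∏ z ∈ s, f z :=
  Finset.prod_nbij (fun i => vert s i) (fun i _ => vert_mem hs i)
    (fun _ _ _ _ h => vert_injective hs h)
    (fun z hz => by
      obtain ⟨i, hi⟩ := exists_vert_eq hs hz
      exact ⟨i, by simp, hi⟩) fun _ _ => rfl

/-- The barycentric coordinates as polynomials. -/
def baryPoly (T : Finset (E d)) (u : E d) : Poly d := affPoly (bary T u)

/-- The product of powers of the barycentric coordinates that belong to the vertices in `s`. -/
def faceBubble (T s : Finset (E d)) (r : ℕ) : Poly d := ∏ u ∈ s, baryPoly T u ^ r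

/-- The extension of a polynomial on the simplex `s` to the cell `T`. -/
def extendPoly (m : ℕ) (T s : Finset (E d)) : Poly m →ₐ[ℝ] Poly d :=
  bind₁ fun j : Fin m => baryPoly T (vert s (j + 1))

variable {T : Finset (E d)} (hT : IsCell T)

theorem totalDegree_faceBubble (T s : Finset (E d)) (r : ℕ) :
    (faceBubble T s r).totalDegree ≤ s.card * r := by
  refine (totalDegree_finsetProd _ _).trans ?_
  rw [← smul_eq_mul, ← Finset.sum_const]
  refine Finset.sum_le_sum fun u _ => (totalDegree_pow _ _).trans ?_
  exact (Nat.mul_le_mul_left r (totalDegree_affPoly _)).trans (mul_one r).le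

theorem totalDegree_extendPoly (m : ℕ) (T s : Finset (E d)) (q : Poly m) :
    (extendPoly m T s q).totalDegree ≤ q.totalDegree :=
  totalDegree_bind₁_le (fun _ => totalDegree_affPoly _) q

include hT

theorem IsCell.pb_baryPoly {m : ℕ} {s : Finset (E d)} (hs : s ⊆ T) (hsm : s.card = m + 1)
    (i : Fin (m + 1)) : pb m s (baryPoly T (vert s i))
      = (Fin.cons (1 - ∑ j, X j) X : Fin (m + 1) → Poly m) i := by
  refine MvPolynomial.funext fun t => ?_
  rw [eval_pb, baryPoly, eval_affPoly, hT.bary_facePt hs hsm]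
  refine Fin.cases ?_ (fun j => ?_) i
  · simp [refBary]
  · simp [refBary]

theorem IsCell.pb_faceBubble {m : ℕ} {s : Finset (E d)} (hs : s ⊆ T) (hsm : s.card = m + 1)
    (r : ℕ) : pb m s (faceBubble T s r) = bubble m ^ r := by
  rw [faceBubble, ← prod_vert hsm fun u => baryPoly T u ^ r, map_prod]
  simp only [map_pow, hT.pb_baryPoly hs hsm]
  rw [Finset.prod_pow, Fin.prod_univ_succ, bubble]
  simp

theorem IsCell.pb_extendPoly {m : ℕ} {s : Finset (E d)} (hs : s ⊆ T) (hsm : s.card = m + 1)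
    (q : Poly m) : pb m s (extendPoly m T s q) = q := by
  rw [extendPoly, pb, bind₁_bind₁]
  have : (fun j : Fin m => bind₁ (facePoly m s) (baryPoly T (vert s (j + 1)))) = X := by
    funext j
    have := hT.pb_baryPoly hs hsm j.succ
    simpa [pb] using this
  rw [this]
  simp

/-- Each vertex of `s` outside `s'` contributes `r` factors that vanish on `s'`. The sets `t` in the
hypothesis contain these vertices; quantifying over them replaces the set difference in the count.
-/
theorem IsCell.faceBubble_mem {s s' : Finset (E d)} (hs : s ⊆ T) (hs' : s' ⊆ T) (r : ℕ)
    {y : E d} (hy : y ∈ body s') (n : ℕ) (hn : ∀ t ⊆ s, (∀ u ∈ s, u ∉ s' → u ∈ t) → n ≤ r * t.card) :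
    faceBubble T s r ∈ vanish y.ofLp ^ n := by
  classical
  rw [faceBubble, ← Finset.prod_filter_mul_prod_filter_not s (· ∉ s')]
  refine Ideal.mul_mem_right _ _ ?_
  have h1 : ∏ u ∈ s.filter (· ∉ s'), baryPoly T u ^ r
      ∈ ∏ _u ∈ s.filter (· ∉ s'), vanish y.ofLp ^ r := by
    refine Ideal.prod_mem_prod fun u hu => Ideal.pow_mem_pow ?_ r
    rw [Finset.mem_filter] at hu
    rw [mem_vanish, baryPoly, eval_affPoly]
    exact hT.bary_eq_zero hs' (hs hu.1) hu.2 hy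
  rw [Finset.prod_const, ← pow_mul] at h1
  exact Ideal.pow_le_pow_right (hn _ (Finset.filter_subset _ _)
    fun u hu hus => Finset.mem_filter.2 ⟨hu, hus⟩) h1

end ShapeFunctions

/-! ### Degrees of bubble multiples and the nodal basis of the bubble space -/

section BubbleDegree

theorem le_totalDegree_bubble {m : ℕ} (hm : 1 ≤ m) : m + 1 ≤ (bubble m).totalDegree := by
  classical
  have h1 : (1 - ∑ i, X i : Poly m) ≠ 0 := by
    intro h
    have := congrArg (eval (0 : Fin m → ℝ)) h
    simp at this
  have h2 : (∏ i, X i : Poly m) ≠ 0 := Finset.prod_ne_zero_iff.2 fun i _ => X_ne_zero i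
  rw [bubble, totalDegree_mul_of_isDomain h1 h2]
  have h3 : 1 ≤ (1 - ∑ i, X i : Poly m).totalDegree := by
    by_contra! h
    have h4 := totalDegree_eq_zero_iff_eq_C.1 (Nat.lt_one_iff.1 h)
    have h5 := congrArg (eval (0 : Fin m → ℝ)) h4
    have h6 := congrArg (eval (Pi.single ⟨0, hm⟩ 1 : Fin m → ℝ)) h4
    simp only [map_sub, map_one, map_sum, eval_X, eval_C] at h5 h6
    rw [← h5] at h6
    simp [Pi.single_apply] at h6
  have h4 : m ≤ (∏ i, X i : Poly m).totalDegree := by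
    have h5 : (∏ i, X i : Poly m) = monomial (∑ i, Finsupp.single i 1) 1 := by
      rw [monomial_sum_one]
      rfl
    rw [h5, totalDegree_monomial _ one_ne_zero]
    have : (∑ i : Fin m, Finsupp.single i 1).degree = m := by
      simp [map_sum]
    exact this.ge
  omega

/-- Dividing by the bubble power lowers the degree by the full amount `(m + 1) * r`. Therefore
multiplying the extended quotient by the bubble on the cell does not exceed degree `k`. -/
theorem totalDegree_bubble_pow_mul {m : ℕ} (hm : 1 ≤ m) {r : ℕ} {q : Poly m} (hq : q ≠ 0) :
    (m + 1) * r + q.totalDegree ≤ (bubble m ^ r * q).totalDegree := by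
  have h0 : bubble m ≠ 0 := by
    intro h
    have := le_totalDegree_bubble hm
    rw [h, totalDegree_zero] at this
    omega
  induction r with
  | zero => simp
  | succ r ih =>
    rw [pow_succ', mul_assoc, totalDegree_mul_of_isDomain h0 (mul_ne_zero (pow_ne_zero _ h0) hq)]
    have := le_totalDegree_bubble hm
    linarith

/-- The nodal basis of the bubble space. -/
theorem IsUnisolventBubble.exists_nodal {m r k : ℕ} {S : Finset (Carrier m)} (hm : 1 ≤ m)
    (hS : IsUnisolventBubble S r k) {c : Carrier m} (hc : c ∈ S) :
    ∃ q : Poly m, (m + 1) * r + q.totalDegree ≤ k ∧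
      (c.avg fun t => eval t (bubble m ^ r * q)) = 1 ∧
      ∀ c' ∈ S, c' ≠ c → (c'.avg fun t => eval t (bubble m ^ r * q)) = 0 := by
  classical
  obtain ⟨p, ⟨hp, ⟨q, rfl⟩, hpS⟩, -⟩ := hS.2 fun c' => if c' = c then 1 else 0
  have h1 := hpS c hc
  rw [if_pos rfl] at h1
  refine ⟨q, (totalDegree_bubble_pow_mul hm ?_).trans hp, h1, fun c' hc' hne => ?_⟩
  · rintro rfl
    have : (c.avg fun t => eval t (bubble m ^ r * 0)) = c.avgL (bubble m ^ r * 0) := rfl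
    rw [this, mul_zero, map_zero] at h1
    exact zero_ne_one h1
  · rw [hpS c' hc', if_neg hne]

end BubbleDegree

/-- The order in which the degrees of freedom are interpolated: vertices (by order of
differentiation), then edges, faces and cells. -/
def Dof.rank {d : ℕ} (α : Dof d) : ℕ :=
  if α.m = 0 then α.dirs.length else 2 * α.m + 1 + α.dirs.length

/-! ### Coordinate functions at a vertex -/

section VertexFunctions

variable {d : ℕ}

theorem facePt_zero (z : E d) (t : Fin 0 → ℝ) : facePt 0 {z} t = z := by
  simp [facePt_eq, refBary, vert]

theorem polyDof_vertex (z : E d) (l : List (E d)) (q : Poly d) :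
    polyDof ⟨0, {z}, .point 0, l⟩ q = eval z.ofLp (dl (l.map WithLp.ofLp) q) := by
  rw [polyDof_apply, faceAvg_apply]
  simp only [Carrier.avg, facePt_zero]

/-- The coordinate functions at a vertex `z` with respect to a basis. -/
def coordPoly (b : Module.Basis (Fin d) ℝ (E d)) (z : E d) (i : Fin d) : Poly d :=
  affPoly ((b.coord i).toAffineMap - AffineMap.const ℝ (E d) (b.coord i z))

theorem eval_coordPoly (b : Module.Basis (Fin d) ℝ (E d)) (z : E d) (i : Fin d) :
    eval z.ofLp (coordPoly b z i) = 0 := by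
  rw [coordPoly, eval_affPoly]
  simp

theorem dd_coordPoly (b : Module.Basis (Fin d) ℝ (E d)) (z : E d) (i j : Fin d) :
    dd (b j).ofLp (coordPoly b z i) = C (if j = i then 1 else 0) := by
  classical
  rw [coordPoly, dd_affPoly]
  simp [Finsupp.single_apply]

theorem eval_dd_mul {z t : Fin d → ℝ} {A L : Poly d} (hL : eval z L = 0) :
    eval z (dd t (A * L)) = eval z A * eval z (dd t L) := by
  simp [Derivation.leibniz, hL]

theorem eval_dd_dd_mul {z t u : Fin d → ℝ} {A L L' : Poly d} (hL : eval z L = 0)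
    (hL' : eval z L' = 0) :
    eval z (dd t (dd u (A * (L * L')))) = eval z A *
      (eval z (dd t L) * eval z (dd u L') + eval z (dd u L) * eval z (dd t L')) := by
  simp only [Derivation.leibniz, map_add, smul_eq_mul, map_mul, hL, hL']
  ring

variable {T : Finset (E d)} (hT : IsCell T) {z : E d} (hz : z ∈ T)
include hT hz

theorem IsCell.eval_baryPoly_self : eval z.ofLp (baryPoly T z) = 1 := by
  rw [baryPoly, eval_affPoly, hT.bary_self hz]

/-- The exponent `d` removes all derivatives of order less than `d` at the other vertices, that is,
all vertex degrees of freedom there. -/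
theorem IsCell.baryPoly_pow_mul_mem {z' : E d} (hz' : z' ∈ T) (h : z' ≠ z) (g : Poly d) :
    baryPoly T z ^ d * g ∈ vanish z'.ofLp ^ d := by
  refine Ideal.mul_mem_right _ _ (Ideal.pow_mem_pow ?_ d)
  rw [mem_vanish, baryPoly, eval_affPoly, hT.bary_of_ne hz hz' h.symm]

end VertexFunctions

/-! ### Interpolation on a single cell by elimination -/

section LocalBasis

variable {d k : ℕ} {K : SimplicialComplex ℝ (E d)} {P : DofChoice}
  {tv : E d → Module.Basis (Fin d) ℝ (E d)} {te : Finset (E d) → Fin 2 → E d}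

/-- `q` is a polynomial of degree at most `k` with `N_α(q) = 1`, and the other degrees of freedom
of `q` on the cell `T` with rank at most that of `α` vanish. -/
structure IsTriangular (K : SimplicialComplex ℝ (E d)) (P : DofChoice)
    (tv : E d → Module.Basis (Fin d) ℝ (E d)) (te : Finset (E d) → Fin 2 → E d) (k : ℕ)
    (T : Finset (E d)) (α : Dof d) (q : Poly d) : Prop where
  deg : q.totalDegree ≤ k
  self : polyDof α q = 1
  other : ∀ γ, IsDof K P tv te γ → γ.s ⊆ T → γ ≠ α → γ.rank ≤ α.rank → polyDof γ q = 0

theorem polyDof_vertex_eq_zero {T : Finset (E d)} (hT : IsCell T) {z z' : E d} (hz : z ∈ T)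
    (hz' : z' ∈ T) (h : z' ≠ z) (g : Poly d) (l : List (E d)) (hl : l.length < d) :
    polyDof ⟨0, {z'}, .point 0, l⟩ (baryPoly T z ^ d * g) = 0 := by
  rw [polyDof_vertex]
  exact eval_dl_eq_zero (hT.baryPoly_pow_mul_mem hz hz' h g) (by simpa using hl)

theorem totalDegree_baryPoly_pow (T : Finset (E d)) (z : E d) (n : ℕ) :
    (baryPoly T z ^ n).totalDegree ≤ n :=
  (totalDegree_pow _ _).trans ((Nat.mul_le_mul_left n (totalDegree_affPoly _)).trans
    (mul_one n).le)

theorem exists_triangular_vertex_value (hd : 2 ≤ d) (hk : d ≤ k) {T : Finset (E d)}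
    (hT : IsCell T) {z : E d} (hz : z ∈ T) :
    ∃ q, IsTriangular K P tv te k T ⟨0, {z}, .point 0, []⟩ q := by
  refine ⟨baryPoly T z ^ d * 1, ?_, ?_, ?_⟩
  · rw [mul_one]
    exact (totalDegree_baryPoly_pow T z d).trans hk
  · rw [polyDof_vertex]
    simp [hT.eval_baryPoly_self hz]
  · intro γ hγ hγT hne hr
    cases hγ with
    | vertex_value z' hz' =>
      exact polyDof_vertex_eq_zero hT hz (Finset.singleton_subset_iff.1 hγT)
        (fun h => hne (by rw [h])) 1 [] (by simp; omega)
    | vertex_grad z' hz' i => simp [Dof.rank] at hr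
    | vertex_hess h3 z' hz' i j hij => simp [Dof.rank] at hr
    | face_value m hm s hs hsm c hc =>
      simp only [Dof.rank, if_neg (by omega : m ≠ 0), if_true, List.length_nil] at hr; omega
    | edge_normal h3 e he he2 c hc i => simp [Dof.rank] at hr

/-- The factor `coordPoly` is the coordinate dual to `tv z i`: it gives the correct gradient at `z`
and the value `0`. The degree `d + 1` is the least admitted `k` for `d = 2`. -/
theorem exists_triangular_vertex_grad (hd : 2 ≤ d) (hk : d + 1 ≤ k) {T : Finset (E d)}
    (hT : IsCell T) {z : E d} (hz : z ∈ T) (i : Fin d) :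
    ∃ q, IsTriangular K P tv te k T ⟨0, {z}, .point 0, [tv z i]⟩ q := by
  have hL := eval_coordPoly (tv z) z i
  refine ⟨baryPoly T z ^ d * coordPoly (tv z) z i, ?_, ?_, ?_⟩
  · exact ((totalDegree_mul _ _).trans (Nat.add_le_add (totalDegree_baryPoly_pow T z d)
      (totalDegree_affPoly _))).trans hk
  · rw [polyDof_vertex]
    simp only [List.map_cons, List.map_nil, dl_cons, dl_nil]
    rw [eval_dd_mul hL, dd_coordPoly]
    simp [hT.eval_baryPoly_self hz]
  · intro γ hγ hγT hne hr
    cases hγ with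
    | vertex_value z' hz' =>
      by_cases h : z' = z
      · subst h
        rw [polyDof_vertex]
        simp [hL]
      · exact polyDof_vertex_eq_zero hT hz (Finset.singleton_subset_iff.1 hγT) h _ []
          (by simp; omega)
    | vertex_grad z' hz' j =>
      by_cases h : z' = z
      · subst h
        rw [polyDof_vertex]
        simp only [List.map_cons, List.map_nil, dl_cons, dl_nil]
        rw [eval_dd_mul hL, dd_coordPoly, if_neg (fun h => hne (by rw [h]))]
        simp
      · exact polyDof_vertex_eq_zero hT hz (Finset.singleton_subset_iff.1 hγT) h _ _
          (by simp; omega)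
    | vertex_hess h3 z' hz' i j hij => simp [Dof.rank] at hr
    | face_value m hm s hs hsm c hc =>
      simp only [Dof.rank, if_neg (by omega : m ≠ 0), if_true, List.length_nil,
        List.length_singleton] at hr
      omega
    | edge_normal h3 e he he2 c hc i => simp [Dof.rank] at hr

/-- A product of two dual coordinates at `z` has vanishing value and gradient, and its Hessian is
the one required up to normalization. The degree `d + 2 = 5` is the least admitted `k` for `d = 3`.
-/
theorem exists_triangular_vertex_hess (hd : d = 3) (hk : d + 2 ≤ k) {T : Finset (E d)}
    (hT : IsCell T) {z : E d} (hz : z ∈ T) (i j : Fin d) (hij : i ≤ j) :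
    ∃ q, IsTriangular K P tv te k T ⟨0, {z}, .point 0, [tv z i, tv z j]⟩ q := by
  have hL := eval_coordPoly (tv z) z i
  have hL' := eval_coordPoly (tv z) z j
  have key : ∀ a b : Fin d, eval z.ofLp (dd (tv z a).ofLp (dd (tv z b).ofLp (baryPoly T z ^ d *
      (coordPoly (tv z) z i * (coordPoly (tv z) z j * C (if i = j then 1 / 2 else 1))))))
      = ((if a = i then 1 else 0) * (if b = j then 1 else 0) +
        (if b = i then 1 else 0) * (if a = j then 1 else 0)) * (if i = j then 1 / 2 else 1) := by
    intro a b
    have hC : ∀ c : Fin d, eval z.ofLp (dd (tv z c).ofLp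
        (coordPoly (tv z) z j * C (if i = j then 1 / 2 else 1)))
        = (if c = j then 1 else 0) * (if i = j then 1 / 2 else 1) := by
      intro c
      rw [mul_comm, Derivation.leibniz, dd_C, smul_zero, add_zero, dd_coordPoly, smul_eq_mul,
        map_mul, eval_C, eval_C, mul_comm]
    rw [eval_dd_dd_mul hL (by rw [map_mul, hL', zero_mul]), hC, hC, dd_coordPoly, dd_coordPoly,
      eval_C, eval_C, map_pow, hT.eval_baryPoly_self hz]
    ring
  -- The factor `1 / 2` on the diagonal compensates for the second derivative of a square.
  refine ⟨baryPoly T z ^ d *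
      (coordPoly (tv z) z i * (coordPoly (tv z) z j * C (if i = j then 1 / 2 else 1))),
      ?_, ?_, ?_⟩
  · refine (totalDegree_mul _ _).trans (le_trans ?_ hk)
    refine Nat.add_le_add (totalDegree_baryPoly_pow T z d) ((totalDegree_mul _ _).trans ?_)
    have h1 : (coordPoly (tv z) z i).totalDegree ≤ 1 := totalDegree_affPoly _
    have h2 : (coordPoly (tv z) z j).totalDegree ≤ 1 := totalDegree_affPoly _
    have h3 := totalDegree_mul (coordPoly (tv z) z j) (C (if i = j then 1 / 2 else 1))
    rw [totalDegree_C] at h3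
    omega
  · rw [polyDof_vertex]
    simp only [List.map_cons, List.map_nil, dl_cons, dl_nil]
    rw [key]
    by_cases h : i = j
    · subst h; norm_num
    · simp [h, Ne.symm h]
  · intro γ hγ hγT hne hr
    cases hγ with
    | vertex_value z' hz' =>
      by_cases h : z' = z
      · subst h
        rw [polyDof_vertex]
        simp [hL]
      · exact polyDof_vertex_eq_zero hT hz (Finset.singleton_subset_iff.1 hγT) h _ []
          (by simp; omega)
    | vertex_grad z' hz' a =>
      by_cases h : z' = z
      · subst h
        rw [polyDof_vertex]
        simp only [List.map_cons, List.map_nil, dl_cons, dl_nil]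
        rw [eval_dd_mul (by rw [map_mul, hL, zero_mul]),
          eval_dd_mul (by rw [map_mul, hL', zero_mul]), hL, zero_mul, mul_zero]
      · exact polyDof_vertex_eq_zero hT hz (Finset.singleton_subset_iff.1 hγT) h _ _
          (by simp; omega)
    | vertex_hess h3 z' hz' a b hab =>
      by_cases h : z' = z
      · subst h
        rw [polyDof_vertex]
        simp only [List.map_cons, List.map_nil, dl_cons, dl_nil]
        rw [key]
        have h4 : ¬ (a = i ∧ b = j) := by
          rintro ⟨rfl, rfl⟩
          exact hne rfl
        -- Both pairs are ordered, so an exchanged pair of indices is possible only if the indices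
        -- are equal.
        have h5 : ¬ (b = i ∧ a = j) := by
          rintro ⟨rfl, rfl⟩
          have : a = b := le_antisymm hab hij
          subst this
          exact hne rfl
        have h6 : ((if a = i then 1 else 0) * (if b = j then 1 else 0) : ℝ) = 0 := by
          by_cases ha : a = i
          · rw [if_neg fun hb => h4 ⟨ha, hb⟩, mul_zero]
          · rw [if_neg ha, zero_mul]
        have h7 : ((if b = i then 1 else 0) * (if a = j then 1 else 0) : ℝ) = 0 := by
          by_cases hb : b = i
          · rw [if_neg fun ha => h5 ⟨hb, ha⟩, mul_zero]
          · rw [if_neg hb, zero_mul]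
        rw [h6, h7]
        simp
      · exact polyDof_vertex_eq_zero hT hz (Finset.singleton_subset_iff.1 hγT) h _ _
          (by simp; omega)
    | face_value m hm s hs hsm c hc =>
      simp only [Dof.rank, if_neg (by omega : m ≠ 0), if_true, List.length_nil,
        List.length_cons] at hr
      omega
    | edge_normal h3 e he he2 c hc i => simp [Dof.rank] at hr

theorem le_mul_card_of_sdiff_subset {s s' t : Finset (E d)} {m m' r n : ℕ}
    (hs : s.card = m + 1) (hs' : s'.card = m' + 1) (hss : ¬ s ⊆ s')
    (ht : ∀ u ∈ s, u ∉ s' → u ∈ t) (h1 : n ≤ r * max 1 (m - m')) : n ≤ r * t.card := by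
  classical
  have h2 : s \ s' ⊆ t := fun u hu => ht u (Finset.mem_sdiff.1 hu).1 (Finset.mem_sdiff.1 hu).2
  have h3 := Finset.card_le_card h2
  have h4 := Finset.le_card_sdiff s' s
  have h5 : 1 ≤ (s \ s').card := Finset.card_pos.2 (Finset.sdiff_nonempty.2 hss)
  exact h1.trans (Nat.mul_le_mul_left r (max_le (by omega) (by omega)))

theorem faceAvg_faceBubble_mul {m : ℕ} {T s : Finset (E d)} (hT : IsCell T) (hs : s ⊆ T)
    (hsm : s.card = m + 1) (r : ℕ) (q : Poly m) (c : Carrier m) :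
    faceAvg m s c (faceBubble T s r * extendPoly m T s q)
      = c.avg fun t => eval t (bubble m ^ r * q) := by
  rw [faceAvg_eq_avg_pb, map_mul, hT.pb_faceBubble hs hsm, hT.pb_extendPoly hs hsm]

/-- A nodal function of the bubble space on `s`, extended with the bubble of the cell. The exponent
`d + 1 - m` makes all degrees of freedom of at most the same rank on other subsimplices vanish. -/
theorem exists_triangular_face_value (hd : d = 2 ∨ d = 3) (hP : P.IsAdmissible d k)
    (hK : IsPure K) {T : Finset (E d)} (hT : IsCell T) {m : ℕ} (hm : 1 ≤ m) {s : Finset (E d)}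
    (hs : s ∈ K.faces) (hsT : s ⊆ T) (hsm : s.card = m + 1) {c : Carrier m} (hc : c ∈ P.val m) :
    ∃ q, IsTriangular K P tv te k T ⟨m, s, c, []⟩ q := by
  have hmd : m ≤ d := by
    have := card_le_of_mem_faces hK hs
    omega
  obtain ⟨q, hdeg, hq1, hq0⟩ := (hP.val m hm hmd).exists_nodal hm hc
  refine ⟨faceBubble T s (d + 1 - m) * extendPoly m T s q, ?_, ?_, ?_⟩
  · refine (totalDegree_mul _ _).trans (le_trans ?_ hdeg)
    refine Nat.add_le_add ?_ (totalDegree_extendPoly m T s q)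
    rw [← hsm]
    exact totalDegree_faceBubble T s _
  · rw [polyDof_apply]
    simp only [List.map_nil, dl_nil]
    rw [faceAvg_faceBubble_mul hT hsT hsm, hq1]
  · intro γ hγ hγT hne hr
    have hint := hγ.isInterior hK hP
    have hcard := hγ.card_eq
    have hvan : ∀ n, ¬ s ⊆ γ.s → n ≤ (d + 1 - m) * max 1 (m - γ.m) → γ.dirs.length < n →
        polyDof γ (faceBubble T s (d + 1 - m) * extendPoly m T s q) = 0 := by
      intro n hss hn hl
      refine polyDof_eq_zero hcard hint (fun y hy => Ideal.mul_mem_right _ _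
        (hT.faceBubble_mem hsT hγT _ hy n fun t _ ht => ?_)) hl
      exact le_mul_card_of_sdiff_subset hsm hcard hss ht hn
    have hm0 : m ≠ 0 := by omega
    have hvert : ∀ z l, γ = ⟨0, {z}, .point 0, l⟩ → l.length < d → polyDof γ
        (faceBubble T s (d + 1 - m) * extendPoly m T s q) = 0 := by
      rintro z l rfl hl
      refine hvan d (fun h => ?_) ?_ hl
      · have := Finset.card_le_card h
        simp at this
        omega
      -- At a vertex at least `m` factors vanish, and `(d + 1 - m) * m ≥ d` because the difference
      -- is `(m - 1) * (d - m)`.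
      · simp only [Nat.sub_zero]
        rw [max_eq_right hm]
        obtain ⟨n, rfl⟩ : ∃ n, m = n + 1 := ⟨m - 1, by omega⟩
        obtain ⟨a, rfl⟩ : ∃ a, d = n + 1 + a := ⟨d - (n + 1), by omega⟩
        have : n + 1 + a + 1 - (n + 1) = a + 1 := by omega
        rw [this]
        nlinarith
    cases hγ with
    | vertex_value z hz => exact hvert z _ rfl (by simp; omega)
    | vertex_grad z hz i => exact hvert z _ rfl (by simp; omega)
    | vertex_hess h3 z hz i j hij => exact hvert z _ rfl (by simp; omega)
    | face_value m' hm' s' hs' hsm' c' hc' =>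
      simp only [Dof.rank, if_neg (by omega : m' ≠ 0), if_neg hm0, List.length_nil] at hr
      -- The rank excludes subsimplices of larger dimension, so an inclusion forces `s = s'`, where
      -- nodality in the bubble space decides.
      by_cases hss : s ⊆ s'
      · have h1 := Finset.card_le_card hss
        have h2 : m' = m := by omega
        subst h2
        have h3 : s = s' := Finset.eq_of_subset_of_card_le hss (by omega)
        subst h3
        rw [polyDof_apply]
        simp only [List.map_nil, dl_nil]
        rw [faceAvg_faceBubble_mul hT hsT hsm]
        exact hq0 c' hc' fun h => hne (by rw [h])
      · refine hvan 1 hss ?_ (by simp)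
        exact Nat.mul_pos (by omega) (lt_of_lt_of_le one_pos (le_max_left _ _))
    | edge_normal h3 e he he2 c' hc' i =>
      simp only [Dof.rank, if_neg hm0, if_neg one_ne_zero, List.length_nil,
        List.length_singleton] at hr
      refine hvan 2 (fun h => ?_) ?_ (by simp)
      · have := Finset.card_le_card h
        simp only at this
        omega
      -- Order two on the edges: for `m = 2` the exponent is two, for `m = 3` two vertices of the
      -- cell lie off the edge.
      · have : m = 2 ∨ m = 3 := by omega
        rcases this with rfl | rfl <;> simp [h3]

/-- A dual functional of the normals is extended from their span to the whole space, and its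
component along the edge is subtracted. The correction does not change the values on the normals,
since these are orthogonal to the edge. -/
theorem exists_dual_of_normal {e : Finset (E d)} (he : e.card = 2) {t : Fin 2 → E d}
    (hli : LinearIndependent ℝ t)
    (hn : ∀ i, ∀ x ∈ e, ∀ y ∈ e, inner ℝ (t i) (x - y) = 0) (i : Fin 2) :
    ∃ f : E d →ᵃ[ℝ] ℝ, (∀ x ∈ body e, f x = 0) ∧
      ∀ j, f.linear (t j) = if j = i then 1 else 0 := by
  obtain ⟨g, hg⟩ := LinearMap.exists_extend ((Module.Basis.span hli).coord i)
  set D : E d := vert e 1 - vert e 0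
  have hv0 := vert_mem he 0
  have hv1 := vert_mem he 1
  have hne : vert e 1 ≠ vert e 0 := by
    intro h
    have := vert_injective he (a₁ := 1) (a₂ := 0) h
    simp at this
  have hD : ‖D‖ ^ 2 ≠ 0 := pow_ne_zero 2 (norm_ne_zero_iff.2 (sub_ne_zero.2 hne))
  let F : E d →ₗ[ℝ] ℝ := g - (g D / ‖D‖ ^ 2) • (innerₛₗ ℝ D)
  have hFD : F D = 0 := by
    simp only [F, LinearMap.sub_apply, LinearMap.smul_apply, smul_eq_mul, innerₛₗ_apply_apply,
      real_inner_self_eq_norm_sq]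
    rw [div_mul_cancel₀ _ hD, sub_self]
  refine ⟨F.toAffineMap - AffineMap.const ℝ (E d) (F (vert e 0)), fun x hx => ?_, fun j => ?_⟩
  · refine affine_eq_zero_on_body (fun z hz => ?_) hx
    obtain ⟨a, rfl⟩ := exists_vert_eq he hz
    fin_cases a
    · simp
    · have : F (vert e 1) - F (vert e 0) = 0 := by rw [← map_sub]; exact hFD
      simpa using this
  · have h1 : inner ℝ D (t j) = 0 := by
      rw [real_inner_comm]; exact hn j _ hv1 _ hv0
    have h2 : g (t j) = if j = i then 1 else 0 := by
      have h3 : g (Module.Basis.span hli j : E d) = (Module.Basis.span hli).coord i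
          (Module.Basis.span hli j) := congrArg (fun φ => φ (Module.Basis.span hli j)) hg
      rw [Module.Basis.coord_apply, Module.Basis.repr_self, Finsupp.single_apply] at h3
      rw [← h3]
      congr 1
      simp
    simp [F, h1, h2]

/-- The squared edge bubble is multiplied by an affine function that vanishes on the edge and is
dual to the chosen normal. On the edge itself only the derivative of the affine factor survives. -/
theorem exists_triangular_edge_normal (hd : d = 3) (hk : 1 ≤ k) (hP : P.IsAdmissible d k)
    (hK : IsPure K) (hF : IsFrame K tv te) {T : Finset (E d)} (hT : IsCell T) {e : Finset (E d)}
    (he : e ∈ K.faces) (heT : e ⊆ T) (he2 : e.card = 2) {c : Carrier 1} (hc : c ∈ P.nrm)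
    (i : Fin 2) :
    ∃ q, IsTriangular K P tv te k T ⟨1, e, c, [te e i]⟩ q := by
  obtain ⟨q, hdeg, hq1, hq0⟩ := (hP.nrm hd).exists_nodal le_rfl hc
  obtain ⟨f, hf0, hf1⟩ := exists_dual_of_normal he2 (hF.te_indep hd e he he2)
    (hF.te_normal hd e he he2) i
  have hL : ∀ x ∈ body e, eval x.ofLp (affPoly f) = 0 := fun x hx => by
    rw [eval_affPoly, hf0 x hx]
  have havg : ∀ (c' : Carrier 1), c'.IsInterior → ∀ j, faceAvg 1 e c'
      (dd (te e j).ofLp (faceBubble T e 2 * extendPoly 1 T e q * affPoly f))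
      = (c'.avg fun t => eval t (bubble 1 ^ 2 * q)) * if j = i then 1 else 0 := by
    intro c' hc' j
    rw [faceAvg_congr (q := (if j = i then (1 : ℝ) else 0) •
      (faceBubble T e 2 * extendPoly 1 T e q)) he2 hc', map_smul,
      faceAvg_faceBubble_mul hT heT he2, smul_eq_mul, mul_comm]
    intro x hx
    rw [eval_dd_mul (hL x hx), dd_affPoly, hf1, eval_C, smul_eval, mul_comm]
  refine ⟨faceBubble T e 2 * extendPoly 1 T e q * affPoly f, ?_, ?_, ?_⟩
  · have h1 := totalDegree_faceBubble T e 2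
    have h2 := totalDegree_extendPoly 1 T e q
    have h3 := totalDegree_affPoly f
    have h4 := totalDegree_mul (faceBubble T e 2 * extendPoly 1 T e q) (affPoly f)
    have h5 := totalDegree_mul (faceBubble T e 2) (extendPoly 1 T e q)
    rw [he2] at h1
    omega
  · rw [polyDof_apply]
    simp only [List.map_cons, List.map_nil, dl_cons, dl_nil]
    rw [havg c ((hP.nrm hd).1 c hc) i, hq1, if_pos rfl, mul_one]
  · intro γ hγ hγT hne hr
    have hint := hγ.isInterior hK hP
    have hcard := hγ.card_eq
    have hvan : ∀ n, ¬ e ⊆ γ.s → n ≤ 2 * max 1 (1 - γ.m) → γ.dirs.length < n →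
        polyDof γ (faceBubble T e 2 * extendPoly 1 T e q * affPoly f) = 0 := by
      intro n hss hn hl
      refine polyDof_eq_zero hcard hint (fun y hy => Ideal.mul_mem_right _ _
        (Ideal.mul_mem_right _ _ (hT.faceBubble_mem heT hγT _ hy n fun t _ ht => ?_))) hl
      exact le_mul_card_of_sdiff_subset (m := 1) he2 hcard hss ht hn
    have hvert : ∀ z l, γ = ⟨0, {z}, .point 0, l⟩ → l.length < 3 → polyDof γ
        (faceBubble T e 2 * extendPoly 1 T e q * affPoly f) = 0 := by
      rintro z l rfl hl
      refine polyDof_eq_zero (n := 3) hcard hint (fun y hy => ?_) hl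
      have hss : ¬ e ⊆ {z} := fun h => by
        have := Finset.card_le_card h
        simp at this
        omega
      -- At an end point of the edge the bubble contributes order two and the affine factor the
      -- third order. At the other vertices both coordinates of the edge vanish, each to order two.
      by_cases hze : z ∈ e
      · have hyz : y = z := by
          simpa [body_singleton] using hy
        have h1 : faceBubble T e 2 ∈ vanish y.ofLp ^ 2 :=
          hT.faceBubble_mem heT hγT 2 hy 2 fun t _ ht =>
            le_mul_card_of_sdiff_subset (m := 1) he2 hcard hss ht (by simp)
        have h2 : affPoly f ∈ vanish y.ofLp := hL y (hyz ▸ mem_body_of_mem hze)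
        rw [pow_succ]
        exact Ideal.mul_mem_mul (Ideal.mul_mem_right _ _ h1) h2
      · refine Ideal.mul_mem_right _ _ (Ideal.mul_mem_right _ _
          (hT.faceBubble_mem heT hγT 2 hy 3 fun t _ ht => ?_))
        have h3 : e ⊆ t := fun u hu => ht u hu fun h => hze (by
          rw [Finset.mem_singleton] at h
          rwa [← h])
        have := Finset.card_le_card h3
        omega
    cases hγ with
    | vertex_value z hz => exact hvert z _ rfl (by simp)
    | vertex_grad z hz i => exact hvert z _ rfl (by simp)
    | vertex_hess h3 z hz i j hij => exact hvert z _ rfl (by simp)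
    | face_value m' hm' s' hs' hsm' c' hc' =>
      simp only [Dof.rank, if_neg (by omega : m' ≠ 0), if_neg one_ne_zero, List.length_nil,
        List.length_singleton] at hr
      have h2 : m' = 1 := by omega
      subst h2
      by_cases hss : e ⊆ s'
      · have h3 : e = s' := Finset.eq_of_subset_of_card_le hss (by omega)
        subst h3
        rw [polyDof_apply]
        simp only [List.map_nil, dl_nil]
        rw [faceAvg_congr (q := 0) he2 hint, map_zero]
        intro x hx
        rw [map_mul, hL x hx, mul_zero, map_zero]
      · exact hvan 1 hss (by simp) (by simp)
    | edge_normal h3 e' he' he2' c' hc' j =>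
      by_cases hss : e ⊆ e'
      · have h3 : e = e' := Finset.eq_of_subset_of_card_le hss (by omega)
        subst h3
        rw [polyDof_apply]
        simp only [List.map_cons, List.map_nil, dl_cons, dl_nil]
        rw [havg c' hint j]
        by_cases hji : j = i
        · subst hji
          rw [hq0 c' hc' fun h => hne (by rw [h]), zero_mul]
        · rw [if_neg hji, mul_zero]
      · exact hvan 2 hss (by simp) (by simp)

theorem exists_triangular (hdk : (d = 2 ∧ 3 ≤ k) ∨ (d = 3 ∧ 5 ≤ k)) (hP : P.IsAdmissible d k)
    (hK : IsPure K) (hF : IsFrame K tv te) {T : Finset (E d)} (hT : IsCell T) {α : Dof d}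
    (hα : IsDof K P tv te α) (hαT : α.s ⊆ T) : ∃ q, IsTriangular K P tv te k T α q := by
  cases hα with
  | vertex_value z hz =>
    exact exists_triangular_vertex_value (by omega) (by omega) hT (Finset.singleton_subset_iff.1 hαT)
  | vertex_grad z hz i =>
    exact exists_triangular_vertex_grad (by omega) (by omega) hT
      (Finset.singleton_subset_iff.1 hαT) i
  | vertex_hess h3 z hz i j hij =>
    exact exists_triangular_vertex_hess h3 (by omega) hT (Finset.singleton_subset_iff.1 hαT) i j hij
  | face_value m hm s hs hsm c hc =>
    exact exists_triangular_face_value (by omega) hP hK hT hm hs hαT hsm hc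
  | edge_normal h3 e he he2 c hc i =>
    exact exists_triangular_edge_normal h3 (by omega) hP hK hF hT he hαT he2 hc i

/-- The degrees of freedom on a cell can be prescribed. -/
theorem exists_poly_of_dofs (hdk : (d = 2 ∧ 3 ≤ k) ∨ (d = 3 ∧ 5 ≤ k)) (hP : P.IsAdmissible d k)
    (hK : IsPure K) (hfin : K.faces.Finite) (hF : IsFrame K tv te) {T : Finset (E d)}
    (hT : IsCell T) (y : Dof d → ℝ) :
    ∃ q : Poly d, q.totalDegree ≤ k ∧
      ∀ α, IsDof K P tv te α → α.s ⊆ T → polyDof α q = y α := by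
  classical
  have hS : {α : Dof d | IsDof K P tv te α ∧ α.s ⊆ T}.Finite :=
    (finite_isDof hfin hK).subset fun α h => h.1
  set S := hS.toFinset
  have hmem : ∀ α, α ∈ S ↔ IsDof K P tv te α ∧ α.s ⊆ T := fun α => by simp [S]
  have htri : ∀ α : Dof d, ∃ q, α ∈ S → IsTriangular K P tv te k T α q := by
    intro α
    by_cases h : α ∈ S
    · obtain ⟨q, hq⟩ := exists_triangular hdk hP hK hF hT ((hmem α).1 h).1 ((hmem α).1 h).2
      exact ⟨q, fun _ => hq⟩
    · exact ⟨0, fun h' => absurd h' h⟩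
  choose b hb using htri
  -- Elimination by rank: corrections of rank `n` change neither the degrees of freedom of lower
  -- rank nor each other. No dimension count is involved.
  have step : ∀ n, ∃ q : Poly d, q.totalDegree ≤ k ∧
      ∀ α ∈ S, α.rank < n → polyDof α q = y α := by
    intro n
    induction n with
    | zero => exact ⟨0, by simp, fun α _ h => absurd h (Nat.not_lt_zero _)⟩
    | succ n ih =>
      obtain ⟨q, hq, hqy⟩ := ih
      refine ⟨q + ∑ α ∈ S.filter (·.rank = n), (y α - polyDof α q) • b α, ?_, ?_⟩
      · refine (totalDegree_add _ _).trans (max_le hq ?_)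
        refine totalDegree_finsetSum_le fun α hα => (totalDegree_smul_le _ _).trans ?_
        exact (hb α (Finset.mem_filter.1 hα).1).deg
      · intro γ hγ hr
        have hγ' := (hmem γ).1 hγ
        rw [map_add, map_sum]
        simp only [map_smul, smul_eq_mul]
        have hzero : ∀ α ∈ S.filter (·.rank = n), γ ≠ α →
            (y α - polyDof α q) * polyDof γ (b α) = 0 := by
          intro α hα hne
          have hα' := Finset.mem_filter.1 hα
          rw [(hb α hα'.1).other γ hγ'.1 hγ'.2 hne (by omega), mul_zero]
        rcases Nat.lt_succ_iff_lt_or_eq.1 hr with h | h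
        · rw [Finset.sum_eq_zero, add_zero, hqy γ hγ h]
          intro α hα
          refine hzero α hα ?_
          rintro rfl
          have := (Finset.mem_filter.1 hα).2
          omega
        · have hγf : γ ∈ S.filter (·.rank = n) := Finset.mem_filter.2 ⟨hγ, h⟩
          rw [Finset.sum_eq_single γ (fun α hα hne => hzero α hα hne.symm)
            (fun h => absurd hγf h), (hb γ hγ).self]
          ring
  obtain ⟨q, hq, hqy⟩ := step (S.sup Dof.rank + 1)
  exact ⟨q, hq, fun α hα hαT => hqy α ((hmem α).2 ⟨hα, hαT⟩)
    (Nat.lt_succ_of_le (Finset.le_sup (f := Dof.rank) ((hmem α).2 ⟨hα, hαT⟩)))⟩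

end LocalBasis

/-! ### From frames to arbitrary directions -/

section DofBounds

variable {d : ℕ}

/-- In three dimensions two independent normals span the orthogonal complement of the edge. -/
theorem eq_zero_of_normal {e : Finset (E d)} (hd : d = 3) (he : e.card = 2) {t : Fin 2 → E d}
    (hli : LinearIndependent ℝ t)
    (hn : ∀ i, ∀ x ∈ e, ∀ y ∈ e, inner ℝ (t i) (x - y) = 0) {Φ : E d →ₗ[ℝ] ℝ}
    (hΦ : ∀ i, Φ (t i) = 0) {u : E d} (hu : ∀ x ∈ e, ∀ y ∈ e, inner ℝ u (x - y) = 0) :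
    Φ u = 0 := by
  set D : E d := vert e 1 - vert e 0
  have hv0 := vert_mem he 0
  have hv1 := vert_mem he 1
  have hne : vert e 1 ≠ vert e 0 := by
    intro h
    have := vert_injective he (a₁ := 1) (a₂ := 0) h
    simp at this
  have hD : D ≠ 0 := sub_ne_zero.2 hne
  have hmem : ∀ x : E d, inner ℝ x D = 0 → x ∈ (Submodule.span ℝ {D})ᗮ := fun x hx => by
    rw [Submodule.mem_orthogonal_singleton_iff_inner_left]
    exact hx
  have hle : Submodule.span ℝ (Set.range t) ≤ (Submodule.span ℝ {D})ᗮ := by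
    rw [Submodule.span_le]
    rintro _ ⟨i, rfl⟩
    exact hmem _ (hn i _ hv1 _ hv0)
  have : Fact (Module.finrank ℝ (E d) = 2 + 1) := ⟨by simp [hd]⟩
  have heq : Submodule.span ℝ (Set.range t) = (Submodule.span ℝ {D})ᗮ := by
    refine Submodule.eq_of_le_of_finrank_eq hle ?_
    rw [Submodule.finrank_orthogonal_span_singleton (n := 2) hD, finrank_span_eq_card hli]
    simp
  have hu' : u ∈ Submodule.span ℝ (Set.range t) := by
    rw [heq]
    exact hmem _ (hu _ hv1 _ hv0)
  have hker : Submodule.span ℝ (Set.range t) ≤ LinearMap.ker Φ := by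
    rw [Submodule.span_le]
    rintro _ ⟨i, rfl⟩
    exact hΦ i
  exact hker hu'

/-- The average over a carrier of the directional derivatives, as a functional of the direction. -/
def avgDeriv (m : ℕ) (s : Finset (E d)) (c : Carrier m) (q : Poly d) : E d →ₗ[ℝ] ℝ where
  toFun t := faceAvg m s c (dd t.ofLp q)
  map_add' t u := by rw [WithLp.ofLp_add, dd_add, map_add]
  map_smul' a t := by
    rw [WithLp.ofLp_smul, dd_smul, C_mul', map_smul, RingHom.id_apply]

theorem avgDeriv_apply (m : ℕ) (s : Finset (E d)) (c : Carrier m) (q : Poly d) (t : E d) :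
    avgDeriv m s c q t = faceAvg m s c (dd t.ofLp q) := rfl

/-- Bounds for the degrees of freedom in the directions of a frame give bounds in all directions,
if they come from multilinear functionals. -/
theorem DofBound.of_frame (hd : d = 2 ∨ d = 3) {P : DofChoice} {S : Finset (E d)} {h M : ℝ}
    {q : Poly d}
    {tv : E d → Module.Basis (Fin d) ℝ (E d)} {te : Finset (E d) → Fin 2 → E d}
    (hli : d = 3 → ∀ e ⊆ S, e.card = 2 → LinearIndependent ℝ (te e))
    (hn : d = 3 → ∀ e ⊆ S, e.card = 2 → ∀ i, ∀ x ∈ e, ∀ y ∈ e, inner ℝ (te e i) (x - y) = 0)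
    (h0 : ∀ z ∈ S, |eval z.ofLp q| ≤ M)
    (h1 : ∀ z ∈ S, ∃ Ψ : E d →ₗ[ℝ] ℝ, (∀ i, eval z.ofLp (dd (tv z i).ofLp q) = Ψ (tv z i)) ∧
      ∀ t, |Ψ t| * h ≤ M * ‖t‖)
    (h2 : d = 3 → ∀ z ∈ S, ∃ g : Poly d,
      (∀ i j, i ≤ j → eval z.ofLp (dd (tv z i).ofLp (dd (tv z j).ofLp q))
        = eval z.ofLp (dd (tv z i).ofLp (dd (tv z j).ofLp g))) ∧
      ∀ t u : E d, |eval z.ofLp (dd t.ofLp (dd u.ofLp g))| * h ^ 2 ≤ M * (‖t‖ * ‖u‖))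
    (hval : ∀ m, 1 ≤ m → ∀ s ⊆ S, s.card = m + 1 → ∀ c ∈ P.val m, |faceAvg m s c q| ≤ M)
    (hnrm : d = 3 → ∀ e ⊆ S, e.card = 2 → ∀ c ∈ P.nrm, ∃ Ψ : E d →ₗ[ℝ] ℝ,
      (∀ i, faceAvg 1 e c (dd (te e i).ofLp q) = Ψ (te e i)) ∧ ∀ t, h * |Ψ t| ≤ M * ‖t‖) :
    DofBound P S h M q where
  vertex z hz l hl := by
    match l with
    | [] => simpa using h0 z hz
    | [t] =>
      obtain ⟨Ψ, hΨ, hb⟩ := h1 z hz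
      -- Linear forms that agree on a basis are equal. The bound on `Ψ` in all directions is
      -- inherited without a constant that depends on the conditioning of the frame.
      have heq : (polyDeriv q z : E d →ₗ[ℝ] ℝ) = Ψ := (tv z).ext fun i => by
        rw [ContinuousLinearMap.coe_coe, polyDeriv_apply, hΨ]
      have h3 := hb t
      rw [← heq, ContinuousLinearMap.coe_coe, polyDeriv_apply] at h3
      simpa using h3
    | [t, u] =>
      have h3 : d = 3 := by
        rw [List.length_cons, List.length_singleton] at hl
        omega
      obtain ⟨g, hg, hb⟩ := h2 h3 z hz
      -- Second derivatives are prescribed for `i ≤ j` only; symmetry supplies the other pairs.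
      have hsym : ∀ i j, eval z.ofLp (dd (tv z i).ofLp (dd (tv z j).ofLp q))
          = eval z.ofLp (dd (tv z i).ofLp (dd (tv z j).ofLp g)) := by
        intro i j
        rcases le_total i j with hij | hij
        · exact hg i j hij
        · rw [dd_comm _ _ q, dd_comm _ _ g]; exact hg j i hij
      have h4 : ∀ j, (polyDeriv (dd (tv z j).ofLp q) z : E d →ₗ[ℝ] ℝ)
          = polyDeriv (dd (tv z j).ofLp g) z := fun j => (tv z).ext fun i => by
        rw [ContinuousLinearMap.coe_coe, ContinuousLinearMap.coe_coe, polyDeriv_apply,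
          polyDeriv_apply, hsym]
      have h5 : (polyDeriv (dd t.ofLp q) z : E d →ₗ[ℝ] ℝ) = polyDeriv (dd t.ofLp g) z :=
        (tv z).ext fun j => by
          have := congrArg (fun φ => φ t) (h4 j)
          simp only [ContinuousLinearMap.coe_coe, polyDeriv_apply] at this ⊢
          rw [dd_comm _ _ q, dd_comm _ _ g]
          exact this
      have h6 := congrArg (fun φ => φ u) h5
      simp only [ContinuousLinearMap.coe_coe, polyDeriv_apply] at h6
      have h7 := hb u t
      rw [← h6, dd_comm] at h7
      simpa [mul_comm ‖u‖] using h7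
    | _ :: _ :: _ :: _ =>
      simp only [List.length_cons] at hl
      omega
  value := hval
  normal h3 e he hec c hc t ht := by
    obtain ⟨Ψ, hΨ, hb⟩ := hnrm h3 e he hec c hc
    have := eq_zero_of_normal h3 hec (hli h3 e he hec) (hn h3 e he hec)
      (Φ := avgDeriv 1 e c q - Ψ) (fun i => by
        rw [LinearMap.sub_apply, avgDeriv_apply, hΨ, sub_self]) ht
    rw [LinearMap.sub_apply, avgDeriv_apply, sub_eq_zero] at this
    rw [this]
    exact hb t

end DofBounds

/-! ### Gluing polynomial pieces -/

section Gluing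

variable {d k : ℕ} {K : SimplicialComplex ℝ (E d)} {Ω : Set (E d)}

theorem IsTriangulation.closure_eq (hK : IsTriangulation K Ω) :
    closure Ω = ⋃ T : cells K, body T.1 := by
  rw [← hK.space_eq]
  ext x
  rw [SimplicialComplex.mem_space_iff, Set.mem_iUnion]
  constructor
  · rintro ⟨s, hs, hx⟩
    obtain ⟨T, hT, hsT⟩ := hK.pure s hs
    exact ⟨⟨T, hT⟩, body_mono hsT hx⟩
  · rintro ⟨T, hx⟩
    exact ⟨T.1, T.2.1, hx⟩

theorem IsTriangulation.exists_cell (hK : IsTriangulation K Ω) {x : E d} (hx : x ∈ closure Ω) :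
    ∃ T ∈ cells K, x ∈ body T := by
  rw [hK.closure_eq, Set.mem_iUnion] at hx
  obtain ⟨T, hT⟩ := hx
  exact ⟨T.1, T.2, hT⟩

theorem IsTriangulation.body_subset (hK : IsTriangulation K Ω) {T : Finset (E d)}
    (hT : T ∈ cells K) : body T ⊆ closure Ω := by
  rw [hK.closure_eq]
  exact Set.subset_iUnion (fun T : cells K => body T.1) ⟨T, hT⟩

theorem IsTriangulation.finite_cells (hK : IsTriangulation K Ω) : (cells K).Finite :=
  hK.finite.subset fun _ h => h.1

open Classical in
theorem body_inter_subset {T T' : Finset (E d)} (hT : T ∈ K.faces) (hT' : T' ∈ K.faces) {x : E d}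
    (hx : x ∈ body T) (hx' : x ∈ body T') : x ∈ body (T ∩ T') := by
  have := K.inter_subset_convexHull hT hT' ⟨hx, hx'⟩
  rwa [← Finset.coe_inter] at this

/-- Polynomials on the cells that agree on intersections define a continuous function. -/
theorem IsTriangulation.exists_glue (hK : IsTriangulation K Ω) (q : Finset (E d) → Poly d)
    (hq : ∀ T ∈ cells K, ∀ T' ∈ cells K, ∀ x ∈ body T, x ∈ body T' →
      eval x.ofLp (q T) = eval x.ofLp (q T')) :
    ∃ v : E d → ℝ, (∀ T ∈ cells K, ∀ x ∈ body T, v x = eval x.ofLp (q T)) ∧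
      ContinuousOn v (closure Ω) := by
  classical
  have hv : ∃ v : E d → ℝ, ∀ T ∈ cells K, ∀ x ∈ body T, v x = eval x.ofLp (q T) := by
    refine ⟨fun x => if h : ∃ T ∈ cells K, x ∈ body T then eval x.ofLp (q h.choose) else 0,
      fun T hT x hx => ?_⟩
    have h : ∃ T ∈ cells K, x ∈ body T := ⟨T, hT, hx⟩
    simp only [dif_pos h]
    exact hq _ h.choose_spec.1 _ hT x h.choose_spec.2 hx
  obtain ⟨v, hv⟩ := hv
  refine ⟨v, hv, ?_⟩
  rw [hK.closure_eq]
  have : Finite (cells K) := hK.finite_cells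
  refine (locallyFinite_of_finite _).continuousOn_iUnion (fun T => isClosed_body T.1) fun T => ?_
  exact ((contDiff_eval (q T.1) (n := 0)).continuous.continuousOn).congr (hv T.1 T.2)

theorem IsPiecewisePoly.exists_polys {v : E d → ℝ} (hv : IsPiecewisePoly K k v) :
    ∃ q : Finset (E d) → Poly d, ∀ T ∈ cells K, (q T).totalDegree ≤ k ∧
      ∀ x ∈ body T, v x = eval x.ofLp (q T) := by
  classical
  have : ∀ T : Finset (E d), ∃ q : Poly d, T ∈ cells K → q.totalDegree ≤ k ∧
      ∀ x ∈ body T, v x = eval x.ofLp q := by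
    intro T
    by_cases hT : T ∈ cells K
    · obtain ⟨p, hp⟩ := hv T hT
      exact ⟨p, fun _ => hp⟩
    · exact ⟨0, fun h => absurd h hT⟩
  choose q hq using this
  exact ⟨q, hq⟩

theorem DerivAgree.eval_dl_eq {v : E d → ℝ} {q : Finset (E d) → Poly d}
    (hq : ∀ T ∈ cells K, ∀ x ∈ body T, v x = eval x.ofLp (q T)) {l : List (E d)}
    {s : Finset (E d)} {x : E d} (hx : x ∈ body s) (h : DerivAgree K l.length v s x)
    {T T' : Finset (E d)} (hT : T ∈ cells K) (hT' : T' ∈ cells K) (hs : s ⊆ T) (hs' : s ⊆ T') :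
    eval x.ofLp (dl (l.map WithLp.ofLp) (q T)) = eval x.ofLp (dl (l.map WithLp.ofLp) (q T')) := by
  rw [← iteratedFDerivWithin_eq_dl (isCell_of_mem_cells hT).uniqueDiffOn (hq T hT) l
      (body_mono hs hx),
    ← iteratedFDerivWithin_eq_dl (isCell_of_mem_cells hT').uniqueDiffOn (hq T' hT') l
      (body_mono hs' hx), h T hT T' hT' hs hs']

theorem derivAgree_one {v : E d → ℝ} {q : Finset (E d) → Poly d}
    (hq : ∀ T ∈ cells K, ∀ x ∈ body T, v x = eval x.ofLp (q T)) {s : Finset (E d)} {x : E d}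
    (hx : x ∈ body s) (h : ∀ T ∈ cells K, ∀ T' ∈ cells K, s ⊆ T → s ⊆ T' → ∀ t : E d,
      eval x.ofLp (dd t.ofLp (q T)) = eval x.ofLp (dd t.ofLp (q T'))) : DerivAgree K 1 v s x := by
  intro T hT T' hT' hs hs'
  ext m
  have hm : m = [m 0].get := by
    funext i
    fin_cases i
    rfl
  rw [hm]
  have h1 := iteratedFDerivWithin_eq_dl (isCell_of_mem_cells hT).uniqueDiffOn (hq T hT) [m 0]
      (body_mono hs hx)
  have h2 := iteratedFDerivWithin_eq_dl (isCell_of_mem_cells hT').uniqueDiffOn (hq T' hT') [m 0]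
      (body_mono hs' hx)
  exact h1.trans ((h T hT T' hT' hs hs' (m 0)).trans h2.symm)

theorem derivAgree_two {v : E d → ℝ} {q : Finset (E d) → Poly d}
    (hq : ∀ T ∈ cells K, ∀ x ∈ body T, v x = eval x.ofLp (q T)) {s : Finset (E d)} {x : E d}
    (hx : x ∈ body s) (h : ∀ T ∈ cells K, ∀ T' ∈ cells K, s ⊆ T → s ⊆ T' → ∀ t u : E d,
      eval x.ofLp (dd t.ofLp (dd u.ofLp (q T))) = eval x.ofLp (dd t.ofLp (dd u.ofLp (q T')))) :
    DerivAgree K 2 v s x := by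
  intro T hT T' hT' hs hs'
  ext m
  have hm : m = [m 0, m 1].get := by
    funext i
    fin_cases i <;> rfl
  rw [hm]
  have h1 := iteratedFDerivWithin_eq_dl (isCell_of_mem_cells hT).uniqueDiffOn (hq T hT)
    [m 0, m 1] (body_mono hs hx)
  have h2 := iteratedFDerivWithin_eq_dl (isCell_of_mem_cells hT').uniqueDiffOn (hq T' hT')
    [m 0, m 1] (body_mono hs' hx)
  exact h1.trans ((h T hT T' hT' hs hs' (m 0) (m 1)).trans h2.symm)

end Gluing

/-! ### Existence of the nodal basis, patches, and the transfer operator on a cell -/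

section NodalBasis

variable {d k : ℕ} {K : SimplicialComplex ℝ (E d)} {Ω : Set (E d)} {P : DofChoice}
  {tv : E d → Module.Basis (Fin d) ℝ (E d)} {te : Finset (E d) → Fin 2 → E d}

theorem singleton_mem_faces {s : Finset (E d)} (hs : s ∈ K.faces) {z : E d} (hz : z ∈ s) :
    {z} ∈ K.faces :=
  K.down_closed hs (Finset.singleton_subset_iff.2 hz) (Finset.singleton_nonempty z)

/-- If the degrees of freedom on a simplex `S` vanish, then so do the scaled bounds. -/
theorem dofBound_zero (hd : d = 2 ∨ d = 3) (hF : IsFrame K tv te) {S : Finset (E d)}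
    (hS : S ∈ K.faces) {q : Poly d}
    (hq : ∀ α, IsDof K P tv te α → α.s ⊆ S → polyDof α q = 0) (h : ℝ) : DofBound P S h 0 q := by
  have hface : ∀ e ⊆ S, e.card = 2 → e ∈ K.faces := fun e he hec =>
    K.down_closed hS he (Finset.card_pos.1 (by omega))
  refine DofBound.of_frame hd (tv := tv) (te := te)
    (fun h3 e he hec => hF.te_indep h3 e (hface e he hec) hec)
    (fun h3 e he hec => hF.te_normal h3 e (hface e he hec) hec) ?_ ?_ ?_ ?_ ?_
  · intro z hz
    have := hq _ (IsDof.vertex_value z (singleton_mem_faces hS hz))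
      (Finset.singleton_subset_iff.2 hz)
    rw [polyDof_vertex] at this
    simpa using this
  · intro z hz
    refine ⟨0, fun i => ?_, by simp⟩
    have := hq _ (IsDof.vertex_grad z (singleton_mem_faces hS hz) i)
      (Finset.singleton_subset_iff.2 hz)
    rw [polyDof_vertex] at this
    simpa using this
  · intro h3 z hz
    refine ⟨0, fun i j hij => ?_, by simp⟩
    have := hq _ (IsDof.vertex_hess h3 z (singleton_mem_faces hS hz) i j hij)
      (Finset.singleton_subset_iff.2 hz)
    rw [polyDof_vertex] at this
    simpa using this
  · intro m hm s hs hsm c hc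
    have := hq _ (IsDof.face_value m hm s (K.down_closed hS hs (Finset.card_pos.1 (by omega)))
      hsm c hc) hs
    rw [polyDof_apply] at this
    simp only [List.map_nil, dl_nil] at this
    rw [this, abs_zero]
  · intro h3 e he hec c hc
    refine ⟨0, fun i => ?_, by simp⟩
    exact hq _ (IsDof.edge_normal h3 e (hface e he hec) hec c hc i) he

/-- Polynomials on a simplex with the same degrees of freedom are equal on the simplex, with their
derivatives at the vertices and on the edges. -/
theorem eq_of_polyDof_eq (hd : d = 2 ∨ d = 3) (hP : P.IsAdmissible d k) (hK : IsPure K)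
    (hF : IsFrame K tv te) {S : Finset (E d)} (hS : S ∈ K.faces) {q q' : Poly d}
    (hq : q.totalDegree ≤ k) (hq' : q'.totalDegree ≤ k)
    (h : ∀ α, IsDof K P tv te α → α.s ⊆ S → polyDof α q = polyDof α q') :
    (∀ x ∈ body S, eval x.ofLp q = eval x.ofLp q') ∧
    (∀ z ∈ S, ∀ l : List (E d), l.length < d → eval z.ofLp (dl (l.map WithLp.ofLp) q)
      = eval z.ofLp (dl (l.map WithLp.ofLp) q')) ∧
    (d = 3 → ∀ e ⊆ S, e.card = 2 → ∀ x ∈ body e, ∀ t : E d,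
      eval x.ofLp (dd t.ofLp q) = eval x.ofLp (dd t.ofLp q')) := by
  have hdeg : (q - q').totalDegree ≤ k := (totalDegree_sub _ _).trans (max_le hq hq')
  have hb : ∀ r : ℝ, DofBound P S r 0 (q - q') := dofBound_zero hd hF hS fun α hα hαS => by
    rw [map_sub, h α hα hαS, sub_self]
  have key : ∀ s ⊆ S, s.Nonempty → (∀ x ∈ body s, eval x.ofLp (q - q') = 0) ∧
      (d = 3 → s.card = 2 → ∀ x ∈ body s, ∀ t : E d, eval x.ofLp (dd t.ofLp (q - q')) = 0) :=
    fun s hs hne => DofBound.eval_eq_zero hd hP hne ((Finset.card_le_card hs).trans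
      (card_le_of_mem_faces hK hS)) hdeg fun r _ => (hb r).mono hs
  refine ⟨fun x hx => ?_, fun z hz l hl => ?_, fun h3 e he hec x hx t => ?_⟩
  · have := (key S subset_rfl (K.nonempty_of_mem_faces hS)).1 x hx
    rwa [map_sub, sub_eq_zero] at this
  · have := (hb 1).vertex z hz l hl
    rw [one_pow, mul_one, zero_mul] at this
    have h0 := abs_nonpos_iff.1 this
    rwa [map_sub, map_sub, sub_eq_zero] at h0
  · have := (key e he (Finset.card_pos.1 (by omega))).2 h3 hec x hx t
    rwa [map_sub, map_sub, sub_eq_zero] at this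

theorem IsTriangulation.isPure (hK : IsTriangulation K Ω) : IsPure K := hK.pure

/-- The Kronecker data are interpolated on each cell. On a common subsimplex two pieces have the
same degrees of freedom, so by `eq_of_polyDof_eq` they agree there, with the derivatives required at
vertices and on edges. -/
theorem exists_isNodal (hdk : (d = 2 ∧ 3 ≤ k) ∨ (d = 3 ∧ 5 ≤ k)) (hP : P.IsAdmissible d k)
    (hK : IsTriangulation K Ω) (hF : IsFrame K tv te) (α : Dof d) :
    ∃ φ, IsNodal K Ω k P tv te α φ := by
  classical
  have hd : d = 2 ∨ d = 3 := by omega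
  have hloc : ∀ T : Finset (E d), ∃ q : Poly d, T ∈ cells K → q.totalDegree ≤ k ∧
      ∀ β, IsDof K P tv te β → β.s ⊆ T → polyDof β q = if β = α then 1 else 0 := by
    intro T
    by_cases hT : T ∈ cells K
    · obtain ⟨q, hq⟩ := exists_poly_of_dofs hdk hP hK.isPure hK.finite hF
        (isCell_of_mem_cells hT) fun β => if β = α then 1 else 0
      exact ⟨q, fun _ => hq⟩
    · exact ⟨0, fun h => absurd h hT⟩
  choose q hq using hloc
  have hagree : ∀ S ∈ K.faces, ∀ T ∈ cells K, ∀ T' ∈ cells K, S ⊆ T → S ⊆ T' → _ :=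
    fun S hS T hT T' hT' hST hST' => eq_of_polyDof_eq hd hP hK.isPure hF hS (hq T hT).1
      (hq T' hT').1 fun β hβ hβS => by
        rw [(hq T hT).2 β hβ (hβS.trans hST), (hq T' hT').2 β hβ (hβS.trans hST')]
  obtain ⟨v, hv, hcont⟩ := hK.exists_glue q fun T hT T' hT' x hx hx' => by
    have hxi := body_inter_subset hT.1 hT'.1 hx hx'
    have hne : (T ∩ T').Nonempty := by
      rw [Finset.nonempty_iff_ne_empty]
      intro h
      rw [h, body, Finset.coe_empty, convexHull_empty] at hxi
      exact hxi
    exact (hagree (T ∩ T') (K.down_closed hT.1 Finset.inter_subset_left hne) T hT T' hT'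
      Finset.inter_subset_left Finset.inter_subset_right).1 x hxi
  refine ⟨v, ⟨hcont, fun T hT => ⟨q T, (hq T hT).1, hv T hT⟩, ?_, ?_, ?_⟩, ?_⟩
  · intro z hz
    refine derivAgree_one hv (mem_body_of_mem (Finset.mem_singleton_self z))
      fun T hT T' hT' hs hs' t => ?_
    exact (hagree {z} hz T hT T' hT' hs hs').2.1 z (Finset.mem_singleton_self z) [t]
      (by rw [List.length_singleton]; omega)
  · intro h3 e he hec x hx
    exact derivAgree_one hv hx fun T hT T' hT' hs hs' t =>
      (hagree e he T hT T' hT' hs hs').2.2 h3 e subset_rfl hec x hx t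
  · intro h3 z hz
    refine derivAgree_two hv (mem_body_of_mem (Finset.mem_singleton_self z))
      fun T hT T' hT' hs hs' t u => ?_
    exact (hagree {z} hz T hT T' hT' hs hs').2.1 z (Finset.mem_singleton_self z) [t, u]
      (by rw [List.length_cons, List.length_singleton]; omega)
  · intro β hβ T hT hβT
    rw [Dof.eval_eq_polyDof hβ.card_eq (hβ.isInterior hK.isPure hP) (isCell_of_mem_cells hT) hβT
      (hv T hT), (hq T hT).2 β hβ hβT]

theorem isNodal_nodalBasis (hdk : (d = 2 ∧ 3 ≤ k) ∨ (d = 3 ∧ 5 ≤ k)) (hP : P.IsAdmissible d k)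
    (hK : IsTriangulation K Ω) (hF : IsFrame K tv te) (α : Dof d) :
    IsNodal K Ω k P tv te α (nodalBasis K Ω k P tv te α) :=
  Classical.epsilon_spec (exists_isNodal hdk hP hK hF α)

/-- The patch of a degree of freedom consists of the cells that contain its simplex. -/
theorem patch_eq (hdk : (d = 2 ∧ 3 ≤ k) ∨ (d = 3 ∧ 5 ≤ k)) (hP : P.IsAdmissible d k)
    (hK : IsTriangulation K Ω) (hF : IsFrame K tv te) {α : Dof d} (hα : IsDof K P tv te α) :
    patch K Ω k P tv te α = {T | T ∈ cells K ∧ α.s ⊆ T} := by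
  classical
  have hd : d = 2 ∨ d = 3 := by omega
  have hφ := isNodal_nodalBasis hdk hP hK hF α
  obtain ⟨q, hq⟩ := hφ.1.poly.exists_polys
  have hdof : ∀ T ∈ cells K, ∀ β, IsDof K P tv te β → β.s ⊆ T →
      polyDof β (q T) = if β = α then 1 else 0 := fun T hT β hβ hβT => by
    rw [← hφ.2 β hβ T hT hβT, Dof.eval_eq_polyDof hβ.card_eq (hβ.isInterior hK.isPure hP)
      (isCell_of_mem_cells hT) hβT (hq T hT).2]
  ext T
  refine and_congr_right fun hT => ?_
  have hcell := isCell_of_mem_cells hT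
  constructor
  · rintro ⟨x, hxi, hxs⟩
    by_contra hαT
    -- On a cell that does not contain `α.s` all degrees of freedom of the basis function vanish,
    -- hence so does the function.
    have hzero := (eq_of_polyDof_eq hd hP hK.isPure hF hT.1 (hq T hT).1 (q' := 0) (by simp)
      fun β hβ hβT => by
        rw [hdof T hT β hβ hβT, map_zero, if_neg]
        rintro rfl
        exact hαT hβT).1
    have := mem_closure_iff.1 hxs _ isOpen_interior hxi
    obtain ⟨y, hy, hys⟩ := this
    refine hys ?_
    rw [(hq T hT).2 y (interior_subset hy), hzero y (interior_subset hy), map_zero]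
  · intro hαT
    by_contra hempty
    rw [Set.not_nonempty_iff_eq_empty] at hempty
    -- A support that misses the interior makes the function zero on the whole cell, which
    -- contradicts the normalization `N_α(φ_α) = 1`.
    have h0 : ∀ x ∈ body T, nodalBasis K Ω k P tv te α x = eval x.ofLp (0 : Poly d) := by
      intro x hx
      have hcl : x ∈ closure (interior (body T)) := by
        rw [(convex_body T).closure_interior_eq_closure_of_nonempty_interior
          hcell.interior_nonempty]
        exact subset_closure hx
      have h1 : Set.EqOn (fun x => eval x.ofLp (q T)) (fun _ => (0 : ℝ))
          (closure (interior (body T))) := by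
        refine Set.EqOn.closure ?_ (contDiff_eval (q T) (n := 0)).continuous continuous_const
        intro y hy
        by_contra hne
        have : y ∈ interior (body T) ∩ tsupport (nodalBasis K Ω k P tv te α) := by
          refine ⟨hy, subset_tsupport _ ?_⟩
          rw [Function.mem_support, (hq T hT).2 y (interior_subset hy)]
          exact hne
        rw [hempty] at this
        exact this
      rw [(hq T hT).2 x hx, map_zero]
      exact h1 hcl
    have h2 := hφ.2 α hα T hT hαT
    rw [if_pos rfl, Dof.eval_eq_polyDof hα.card_eq (hα.isInterior hK.isPure hP) hcell hαT h0,
      map_zero] at h2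
    exact zero_ne_one h2

/-- The transfer operator on a cell. -/
theorem exists_transfer_poly (hdk : (d = 2 ∧ 3 ≤ k) ∨ (d = 3 ∧ 5 ≤ k)) (hP : P.IsAdmissible d k)
    (hK : IsTriangulation K Ω) (hF : IsFrame K tv te) (p : E d → ℝ) {T : Finset (E d)}
    (hT : T ∈ cells K) :
    ∃ q : Poly d, q.totalDegree ≤ k ∧ (∀ x ∈ body T, transfer K Ω k P tv te p x = eval x.ofLp q) ∧
      ∀ β, IsDof K P tv te β → β.s ⊆ T → polyDof β q = transferValue K Ω k P tv te p β := by
  classical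
  have hfin : {α : Dof d | IsDof K P tv te α}.Finite := finite_isDof hK.finite hK.isPure
  have hφ := fun α => isNodal_nodalBasis hdk hP hK hF α
  choose q hq hqv using fun α => (hφ α).1.poly T hT
  refine ⟨∑ α ∈ hfin.toFinset, transferValue K Ω k P tv te p α • q α, ?_, ?_, ?_⟩
  · exact totalDegree_finsetSum_le fun α _ => (totalDegree_smul_le _ _).trans (hq α)
  · intro x hx
    have h1 : transfer K Ω k P tv te p x = ∑ᶠ α ∈ {α : Dof d | IsDof K P tv te α},
        transferValue K Ω k P tv te p α * nodalBasis K Ω k P tv te α x := rfl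
    rw [h1, finsum_mem_eq_finite_toFinset_sum _ hfin, map_sum]
    refine Finset.sum_congr rfl fun α _ => ?_
    rw [smul_eval, hqv α x hx]
  · intro β hβ hβT
    have hδ : ∀ α, polyDof β (q α) = if β = α then 1 else 0 := fun α => by
      rw [← (hφ α).2 β hβ T hT hβT, Dof.eval_eq_polyDof hβ.card_eq (hβ.isInterior hK.isPure hP)
        (isCell_of_mem_cells hT) hβT (hqv α)]
    rw [map_sum, Finset.sum_eq_single β]
    · rw [map_smul, hδ, if_pos rfl, smul_eq_mul, mul_one]
    · intro α _ hne
      rw [map_smul, hδ, if_neg hne.symm, smul_zero]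
    · intro h
      exact absurd (hfin.mem_toFinset.2 hβ) h

end NodalBasis

/-! ### Supporting hyperplanes of the domain -/

section OuterNormals

variable {d : ℕ} {Ω : Set (E d)}

theorem IsConvexPolytopalDomain.isOpen (h : IsConvexPolytopalDomain Ω) : IsOpen Ω := by
  obtain ⟨-, P, rfl⟩ := h
  exact isOpen_interior

theorem IsConvexPolytopalDomain.convex (h : IsConvexPolytopalDomain Ω) : Convex ℝ Ω := by
  obtain ⟨-, P, rfl⟩ := h
  exact (convex_convexHull ℝ _).interior

/-- The Riesz representative of a functional separating `x` from the open convex set, normalized. -/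
theorem exists_isOuterNormal (ho : IsOpen Ω) (hc : Convex ℝ Ω) (hne : Ω.Nonempty) {x : E d}
    (hx : x ∈ frontier Ω) : ∃ n, IsOuterNormal Ω {x} n := by
  rw [ho.frontier_eq] at hx
  obtain ⟨f, hf⟩ := geometric_hahn_banach_open_point hc ho hx.2
  set n₀ := (InnerProductSpace.toDual ℝ (E d)).symm f
  have hn₀ : ∀ y, inner ℝ n₀ y = f y := fun y => InnerProductSpace.toDual_symm_apply
  have hne0 : n₀ ≠ 0 := by
    intro h
    obtain ⟨y, hy⟩ := hne
    have := hf y hy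
    rw [← hn₀, ← hn₀, h, inner_zero_left, inner_zero_left] at this
    exact lt_irrefl _ this
  refine ⟨‖n₀‖⁻¹ • n₀, norm_smul_inv_norm hne0, ?_⟩
  rintro _ rfl y hy
  rw [real_inner_smul_left, inner_sub_right, hn₀, hn₀]
  exact mul_nonpos_of_nonneg_of_nonpos (by positivity) (sub_nonpos.2 (hf y hy).le)

theorem IsOuterNormal.mono {D D' : Set (E d)} {n : E d} (h : IsOuterNormal Ω D n) (hD : D' ⊆ D) :
    IsOuterNormal Ω D' n :=
  ⟨h.1, fun x hx => h.2 x (hD hx)⟩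

theorem IsOuterNormal.inner_nonpos {D : Set (E d)} {n x : E d} (h : IsOuterNormal Ω D n)
    (hx : x ∈ D) {y : E d} (hy : y ∈ closure Ω) : inner ℝ n (y - x) ≤ 0 := by
  have hcl : IsClosed {y : E d | inner ℝ n (y - x) ≤ 0} :=
    isClosed_le (by fun_prop) continuous_const
  exact closure_minimal (fun y hy => h.2 x hx y hy) hcl hy

/-- From an interior point one could move a little in direction `n` within `Ω`, and this would leave
the supporting half-space. -/
theorem IsOuterNormal.mem_frontier (ho : IsOpen Ω) {D : Set (E d)} {n x y : E d}
    (h : IsOuterNormal Ω D n) (hx : x ∈ D) (hy : y ∈ closure Ω) (h0 : inner ℝ n (y - x) = 0) :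
    y ∈ frontier Ω := by
  rw [ho.frontier_eq]
  refine ⟨hy, fun hyΩ => ?_⟩
  have hcont : Filter.Tendsto (fun a : ℝ => y + a • n) (nhdsWithin 0 (Set.Ioi 0)) (nhds y) := by
    have : Continuous fun a : ℝ => y + a • n := by fun_prop
    have h1 := (this.tendsto 0).mono_left (nhdsWithin_le_nhds (s := Set.Ioi 0))
    simpa using h1
  obtain ⟨a, haΩ, ha⟩ :=
    ((hcont.eventually (ho.mem_nhds hyΩ)).and self_mem_nhdsWithin).exists
  have h1 := h.2 x hx _ haΩ
  rw [show y + a • n - x = (y - x) + a • n by abel, inner_add_right, h0, real_inner_smul_right,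
    real_inner_self_eq_norm_sq, h.1] at h1
  have : (0 : ℝ) < a := ha
  linarith

/-- A supporting hyperplane at a convex combination contains the points with positive weight. -/
theorem IsOuterNormal.inner_eq_zero_of_weight {D : Set (E d)} {n x : E d}
    (h : IsOuterNormal Ω D n) (hx : x ∈ D) {s : Finset (E d)} (hs : ∀ u ∈ s, u ∈ closure Ω)
    {w : E d → ℝ} (hw0 : ∀ u ∈ s, 0 ≤ w u) (hw1 : ∑ u ∈ s, w u = 1) (hwx : ∑ u ∈ s, w u • u = x)
    {u : E d} (hu : u ∈ s) (hwu : 0 < w u) : inner ℝ n (u - x) = 0 := by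
  have hle : ∀ u ∈ s, w u * inner ℝ n (u - x) ≤ 0 := fun u hu =>
    mul_nonpos_of_nonneg_of_nonpos (hw0 u hu) (h.inner_nonpos hx (hs u hu))
  have hsum : ∑ u ∈ s, w u * inner ℝ n (u - x) = 0 := by
    simp only [inner_sub_right, mul_sub, Finset.sum_sub_distrib, ← Finset.sum_mul, hw1, one_mul]
    rw [sub_eq_zero]
    conv_rhs => rw [← hwx, inner_sum]
    exact Finset.sum_congr rfl fun u _ => (real_inner_smul_right _ _ _).symm
  have h1 := (Finset.sum_eq_zero_iff_of_nonpos hle).1 hsum u hu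
  exact (mul_eq_zero.1 h1).resolve_left hwu.ne'

/-- An outer normal at a point in the relative interior of a simplex in the closure is an outer
normal on the whole simplex. -/
theorem IsOuterNormal.body_of_weight {n x : E d} (h : IsOuterNormal Ω {x} n) {s : Finset (E d)}
    (hs : body s ⊆ closure Ω)
    {w : E d → ℝ} (hw0 : ∀ u ∈ s, 0 < w u) (hw1 : ∑ u ∈ s, w u = 1)
    (hwx : ∑ u ∈ s, w u • u = x) : IsOuterNormal Ω (body s) n := by
  have h0 : ∀ u ∈ s, inner ℝ n (u - x) = 0 := fun u hu =>
    h.inner_eq_zero_of_weight rfl (fun u hu => hs (mem_body_of_mem hu)) (fun u hu => (hw0 u hu).le)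
      hw1 hwx hu (hw0 u hu)
  refine ⟨h.1, fun z hz y hy => ?_⟩
  have hz0 : inner ℝ n (z - x) = 0 := by
    have hconv : Convex ℝ {z : E d | inner ℝ n (z - x) = 0} := by
      intro a ha b hb p q hp hq hpq
      simp only [Set.mem_ofPred_eq] at ha hb ⊢
      have : p • a + q • b - x = p • (a - x) + q • (b - x) := by
        rw [smul_sub, smul_sub, sub_add_sub_comm, ← add_smul, hpq, one_smul]
      rw [this, inner_add_right, real_inner_smul_right, real_inner_smul_right, ha, hb]
      simp
    exact convexHull_min (fun u hu => h0 u hu) hconv hz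
  have h1 := h.2 x rfl y hy
  rw [show y - z = (y - x) - (z - x) by abel, inner_sub_right, hz0, sub_zero]
  exact h1

end OuterNormals

/-! ### The nodal interpolant -/

section NodalInterpolant

variable {d k : ℕ} {K : SimplicialComplex ℝ (E d)} {Ω : Set (E d)}

/-- The affine function on a cell with given vertex values. -/
def linInterp (T : Finset (E d)) (v : E d → ℝ) : E d →ᵃ[ℝ] ℝ := ∑ z ∈ T, v z • bary T z

theorem linInterp_apply (T : Finset (E d)) (v : E d → ℝ) (x : E d) :
    linInterp T v x = ∑ z ∈ T, v z * bary T z x := by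
  have h : ∀ s : Finset (E d), (∑ z ∈ s, v z • bary T z) x = ∑ z ∈ s, v z * bary T z x := by
    classical
    intro s
    induction s using Finset.induction_on with
    | empty => simp
    | insert a s ha ih =>
      rw [Finset.sum_insert ha, Finset.sum_insert ha, ← ih]
      rfl
  exact h T

theorem IsCell.linInterp_vertex {T : Finset (E d)} (hT : IsCell T) (v : E d → ℝ) {z : E d}
    (hz : z ∈ T) : linInterp T v z = v z := by
  rw [linInterp_apply, Finset.sum_eq_single z]
  · rw [hT.bary_self hz, mul_one]
  · intro u hu hne
    rw [hT.bary_of_ne hu hz hne, mul_zero]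
  · exact fun h => absurd hz h

theorem exists_nodalInterp (ho : IsOpen Ω) (hc : Convex ℝ Ω) (hne : Ω.Nonempty)
    (hK : IsTriangulation K Ω) {v : E d → ℝ} (hv : ∀ x ∈ frontier Ω, v x = 0) :
    ∃ p, MemV0 K Ω p ∧ ∀ z, {z} ∈ K.faces → p z = v z := by
  classical
  obtain ⟨p, hp, hcont⟩ := hK.exists_glue (fun T => affPoly (linInterp T v))
    fun T hT T' hT' x hx hx' => by
      rw [eval_affPoly, eval_affPoly, ← sub_eq_zero]
      refine affine_eq_zero_on_body (f := linInterp T v - linInterp T' v) (fun z hz => ?_)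
        (body_inter_subset hT.1 hT'.1 hx hx')
      rw [Finset.mem_inter] at hz
      change linInterp T v z - linInterp T' v z = 0
      rw [(isCell_of_mem_cells hT).linInterp_vertex v hz.1,
        (isCell_of_mem_cells hT').linInterp_vertex v hz.2, sub_self]
  refine ⟨p, ⟨hcont, fun T hT => ⟨_, totalDegree_affPoly _, hp T hT⟩, fun x hx => ?_⟩, ?_⟩
  · obtain ⟨T, hT, hxT⟩ := hK.exists_cell (frontier_subset_closure hx)
    have hcell := isCell_of_mem_cells hT
    rw [hp T hT x hxT, eval_affPoly, linInterp_apply]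
    -- A supporting hyperplane at `x` contains all vertices of positive weight. These lie on the
    -- boundary, where `v` vanishes, so the interpolant vanishes at `x`.
    obtain ⟨n, hn⟩ := exists_isOuterNormal ho hc hne hx
    refine Finset.sum_eq_zero fun z hz => ?_
    rcases (hcell.bary_nonneg hz hxT).eq_or_lt with h0 | hpos
    · rw [← h0, mul_zero]
    · have h0 := hn.inner_eq_zero_of_weight rfl
        (fun u hu => hK.body_subset hT (mem_body_of_mem hu)) (fun u hu => hcell.bary_nonneg hu hxT)
        (hcell.sum_bary x) (hcell.sum_bary_smul x) hz hpos
      rw [hv z (hn.mem_frontier ho rfl (hK.body_subset hT (mem_body_of_mem hz)) h0), zero_mul]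
  · intro z hz
    obtain ⟨T, hT, hzT⟩ := hK.pure _ hz
    have hzT' := Finset.singleton_subset_iff.1 hzT
    rw [hp T hT z (mem_body_of_mem hzT'), eval_affPoly,
      (isCell_of_mem_cells hT).linInterp_vertex v hzT']

theorem nodalInterp_spec (ho : IsOpen Ω) (hc : Convex ℝ Ω) (hne : Ω.Nonempty)
    (hK : IsTriangulation K Ω) {v : E d → ℝ} (hv : ∀ x ∈ frontier Ω, v x = 0) :
    MemV0 K Ω (nodalInterp K Ω v) ∧ ∀ z, {z} ∈ K.faces → nodalInterp K Ω v z = v z :=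
  Classical.epsilon_spec (exists_nodalInterp ho hc hne hK hv)

end NodalInterpolant

/-! ### Gradients at the boundary of functions that vanish there -/

section BoundaryGradient

variable {d : ℕ} {Ω : Set (E d)}

theorem exists_mem_segment_frontier (ho : IsOpen Ω) {x y : E d} (hx : x ∉ closure Ω)
    (hy : y ∈ Ω) : ∃ z ∈ segment ℝ x y, z ∈ frontier Ω := by
  by_contra! h
  have hcover : segment ℝ x y ⊆ (closure Ω)ᶜ ∪ Ω := by
    intro z hz
    by_cases hzc : z ∈ closure Ω
    · right
      by_contra hzΩ
      exact h z hz (ho.frontier_eq ▸ ⟨hzc, hzΩ⟩)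
    · exact Or.inl hzc
  obtain ⟨z, -, hz1, hz2⟩ := (convex_segment x y).isPreconnected _ _ isClosed_closure.isOpen_compl
    ho hcover ⟨x, left_mem_segment ℝ x y, hx⟩ ⟨y, right_mem_segment ℝ x y, hy⟩
  exact hz1 (subset_closure hz2)

/-- If `v` vanishes on `∂Ω`, then its derivative cannot be positive both in an outward and in an
inward direction. -/
theorem deriv_inward_nonpos (ho : IsOpen Ω) (hc : Convex ℝ Ω) {x n : E d} {v : E d → ℝ}
    {L : E d →L[ℝ] ℝ} (hx : x ∈ frontier Ω) (hn : IsOuterNormal Ω {x} n)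
    (hv : ∀ y ∈ frontier Ω, v y = 0) (hL : HasFDerivWithinAt v L (closure Ω) x)
    {y w : E d} (hny : 0 < inner ℝ n y) (hLy : 0 < L y) (hw : w ∈ Ω) : L (w - x) ≤ 0 := by
  by_contra! hLw
  have hxc : x ∈ closure Ω := frontier_subset_closure hx
  set δ := min (L y) (L (w - x))
  have hδ : 0 < δ := lt_min hLy hLw
  set R := max ‖y‖ ‖w - x‖
  have hR : 0 ≤ R := (norm_nonneg y).trans (le_max_left _ _)
  -- With this constant the remainder at `x + τ • u` is less than `τ * δ` whenever `‖u‖ ≤ R`.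
  have hlo := hL.isLittleO.def (c := δ / (2 * (R + 1))) (by positivity)
  obtain ⟨ε, hε, hball⟩ := Metric.mem_nhdsWithin_iff.1 hlo
  set τ := min 1 (ε / (2 * (R + 1)))
  have hτ0 : 0 < τ := lt_min one_pos (by positivity)
  have hout : x + τ • y ∉ closure Ω := by
    intro h
    have := hn.inner_nonpos rfl h
    rw [add_sub_cancel_left, real_inner_smul_right] at this
    exact absurd this (not_le.2 (mul_pos hτ0 hny))
  have hin : x + τ • (w - x) ∈ Ω := by
    have := hc.add_smul_sub_mem_interior' hxc (ho.interior_eq.symm ▸ hw) ⟨hτ0, min_le_left _ _⟩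
    rwa [ho.interior_eq] at this
  -- The segment from the outer to the inner point meets the boundary at `x + τ • u`, with `u` a
  -- convex combination of `y` and `w - x`. There `v` vanishes although `L u ≥ δ`, which contradicts
  -- differentiability.
  obtain ⟨_, ⟨a, b, ha, hb, hab, rfl⟩, hzf⟩ := exists_mem_segment_frontier ho hout hin
  set u := a • y + b • (w - x)
  have hz : a • (x + τ • y) + b • (x + τ • (w - x)) = x + τ • u := by
    have : x = a • x + b • x := by rw [← add_smul, hab, one_smul]
    conv_rhs => rw [this]
    simp only [u, smul_add, smul_comm τ a, smul_comm τ b]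
    abel
  rw [hz] at hzf
  have hLu : δ ≤ L u := by
    simp only [u, map_add, map_smul, smul_eq_mul]
    have h1 : a * δ ≤ a * L y := mul_le_mul_of_nonneg_left (min_le_left _ _) ha
    have h2 : b * δ ≤ b * L (w - x) := mul_le_mul_of_nonneg_left (min_le_right _ _) hb
    calc δ = a * δ + b * δ := by rw [← add_mul, hab, one_mul]
      _ ≤ _ := add_le_add h1 h2
  have hu : ‖u‖ ≤ R := by
    refine (norm_add_le _ _).trans ?_
    rw [norm_smul, norm_smul, Real.norm_of_nonneg ha, Real.norm_of_nonneg hb]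
    have h1 : a * ‖y‖ ≤ a * R := mul_le_mul_of_nonneg_left (le_max_left _ _) ha
    have h2 : b * ‖w - x‖ ≤ b * R := mul_le_mul_of_nonneg_left (le_max_right _ _) hb
    calc a * ‖y‖ + b * ‖w - x‖ ≤ a * R + b * R := add_le_add h1 h2
      _ = R := by rw [← add_mul, hab, one_mul]
  have hnorm : ‖τ • u‖ ≤ τ * R := by
    rw [norm_smul, Real.norm_of_nonneg hτ0.le]
    exact mul_le_mul_of_nonneg_left hu hτ0.le
  have hmem : x + τ • u ∈ Metric.ball x ε ∩ closure Ω := by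
    refine ⟨?_, frontier_subset_closure hzf⟩
    rw [Metric.mem_ball, dist_eq_norm, add_sub_cancel_left]
    refine hnorm.trans_lt ?_
    have h1 : τ * R ≤ ε / (2 * (R + 1)) * R := mul_le_mul_of_nonneg_right (min_le_right _ _) hR
    refine h1.trans_lt ?_
    rw [div_mul_eq_mul_div, div_lt_iff₀ (by positivity)]
    nlinarith
  have hkey := hball hmem
  simp only [Set.mem_ofPred_eq, add_sub_cancel_left, hv _ hzf, hv _ hx, sub_zero, zero_sub,
    map_smul, smul_eq_mul, Real.norm_eq_abs] at hkey
  rw [abs_neg, abs_of_pos (mul_pos hτ0 (hδ.trans_le hLu))] at hkey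
  have h2 : δ / (2 * (R + 1)) * ‖τ • u‖ ≤ δ / (2 * (R + 1)) * (τ * R) :=
    mul_le_mul_of_nonneg_left hnorm (by positivity)
  have h3 : δ / (2 * (R + 1)) * (τ * R) < τ * δ := by
    rw [div_mul_eq_mul_div, div_lt_iff₀ (by positivity)]
    nlinarith [mul_pos hτ0 hδ]
  have h4 : τ * δ ≤ τ * L u := mul_le_mul_of_nonneg_left hLu hτ0.le
  linarith

/-- The tangential derivative of a function that vanishes on `∂Ω` is zero. -/
theorem deriv_eq_normal (ho : IsOpen Ω) (hc : Convex ℝ Ω) (hne : Ω.Nonempty) {x n : E d}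
    {v : E d → ℝ} {L : E d →L[ℝ] ℝ} (hx : x ∈ frontier Ω) (hn : IsOuterNormal Ω {x} n)
    (hv : ∀ y ∈ frontier Ω, v y = 0) (hL : HasFDerivWithinAt v L (closure Ω) x) (t : E d) :
    L t = L n * inner ℝ n t := by
  by_contra hcon
  set u := t - (inner ℝ n t : ℝ) • n
  have hnn : inner ℝ n n = (1 : ℝ) := by rw [real_inner_self_eq_norm_sq, hn.1, one_pow]
  have hnu : inner ℝ n u = (0 : ℝ) := by
    simp only [u, inner_sub_right, real_inner_smul_right, hnn, mul_one, sub_self]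
  have hLu : L u ≠ 0 := by
    intro h
    refine hcon ?_
    rw [map_sub, map_smul, smul_eq_mul, sub_eq_zero] at h
    rw [h, mul_comm]
  -- If `L` is not a multiple of `n`, then outward directions exist with either sign of `L`.
  -- Applying `deriv_inward_nonpos` to `v` and `-v` shows that `L` vanishes on all inward
  -- directions.
  have hdir : ∀ b : ℝ, ∃ y, inner ℝ n y = (1 : ℝ) ∧ L y = b := fun b =>
    ⟨n + ((b - L n) / L u) • u, by rw [inner_add_right, real_inner_smul_right, hnu, hnn]; simp, by
      rw [map_add, map_smul, smul_eq_mul, div_mul_cancel₀ _ hLu]; ring⟩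
  obtain ⟨y₁, hy₁, hLy₁⟩ := hdir 1
  obtain ⟨y₂, hy₂, hLy₂⟩ := hdir (-1)
  have hzero : ∀ w ∈ Ω, L (w - x) = 0 := fun w hw => by
    refine le_antisymm (deriv_inward_nonpos ho hc hx hn hv hL (by rw [hy₁]; exact one_pos)
      (by rw [hLy₁]; exact one_pos) hw) ?_
    have := deriv_inward_nonpos ho hc hx hn (v := -v) (fun y hy => by simp [hv y hy]) hL.neg
      (y := y₂) (by rw [hy₂]; exact one_pos) (by simp [hLy₂]) hw
    simpa using this
  obtain ⟨w, hw⟩ := hne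
  -- Since `Ω` is open, both `w` and `w + a • u` lie in it for some `a > 0`; comparing the two gives
  -- `L u = 0`.
  have hcont : Filter.Tendsto (fun a : ℝ => w + a • u) (nhdsWithin 0 (Set.Ioi 0)) (nhds w) := by
    have : Continuous fun a : ℝ => w + a • u := by fun_prop
    have h1 := (this.tendsto 0).mono_left (nhdsWithin_le_nhds (s := Set.Ioi 0))
    simpa using h1
  obtain ⟨a, haΩ, ha⟩ :=
    ((hcont.eventually (ho.mem_nhds hw)).and self_mem_nhdsWithin).exists
  have h1 := hzero _ haΩ
  have h2 := hzero _ hw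
  rw [show w + a • u - x = (w - x) + a • u by abel, map_add, h2, zero_add, map_smul,
    smul_eq_mul] at h1
  exact (mul_ne_zero (ne_of_gt ha) hLu) h1

/-- The gradient is parallel to both normals. If it is nonzero, these are equal or opposite, and
opposite normals would confine the open set `Ω` to a hyperplane. -/
theorem deriv_eq_zero_of_two_normals (ho : IsOpen Ω) (hc : Convex ℝ Ω) (hne : Ω.Nonempty)
    {x n n' : E d} {v : E d → ℝ} {L : E d →L[ℝ] ℝ} (hx : x ∈ frontier Ω)
    (hn : IsOuterNormal Ω {x} n) (hn' : IsOuterNormal Ω {x} n') (hnn : n ≠ n')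
    (hv : ∀ y ∈ frontier Ω, v y = 0) (hL : HasFDerivWithinAt v L (closure Ω) x) (t : E d) :
    L t = 0 := by
  have h1 := deriv_eq_normal ho hc hne hx hn hv hL
  have h2 := deriv_eq_normal ho hc hne hx hn' hv hL
  suffices h : L n = 0 by rw [h1, h, zero_mul]
  by_contra hLn
  have h3 : (inner ℝ n n' : ℝ) * inner ℝ n n' = 1 := by
    have h4 := h2 n
    rw [h1 n', real_inner_comm n n', mul_assoc] at h4
    have : L n * 1 = L n * ((inner ℝ n n' : ℝ) * inner ℝ n n') := by rw [mul_one]; exact h4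
    exact (mul_left_cancel₀ hLn this).symm
  rcases mul_self_eq_one_iff.1 h3 with h | h
  · exact hnn ((inner_eq_one_iff_of_norm_eq_one hn.1 hn'.1).1 h)
  · have h5 := (inner_eq_neg_one_iff_of_norm_eq_one hn.1 hn'.1).1 h
    obtain ⟨y, hy⟩ := hne
    have h6 := hn.2 x rfl y hy
    have h7 := hn'.2 x rfl y hy
    rw [h5, inner_neg_left] at h6
    have h8 : y ∈ frontier Ω := hn'.mem_frontier ho rfl (subset_closure hy) (by linarith)
    rw [ho.frontier_eq] at h8
    exact h8.2 hy

variable {k : ℕ} {K : SimplicialComplex ℝ (E d)}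

/-- A cell that meets the relative interior of a simplex contains the simplex. -/
theorem subset_of_bary_pos {T₀ T s : Finset (E d)} (hT₀ : T₀ ∈ cells K) (hT : T ∈ cells K)
    (hs : s ∈ K.faces) (hsT : s ⊆ T₀) {x : E d} (hx : x ∈ body s)
    (hpos : ∀ u ∈ s, 0 < bary T₀ u x) (hxT : x ∈ body T) : s ⊆ T := by
  classical
  intro u hu
  by_contra huT
  have h1 := (isCell_of_mem_cells hT₀).bary_eq_zero (Finset.inter_subset_left.trans hsT) (hsT hu)
    (fun h => huT (Finset.mem_inter.1 h).2) (body_inter_subset hs hT.1 hx hxT)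
  exact (hpos u hu).ne' h1

/-- The closure is a finite union of closed cells. Those that contain `x` share the derivative `L`,
and the condition is void for the others. -/
theorem hasFDerivWithinAt_closure (hK : IsTriangulation K Ω) {v : E d → ℝ}
    {q : Finset (E d) → Poly d} (hq : ∀ T ∈ cells K, ∀ x ∈ body T, v x = eval x.ofLp (q T))
    {x : E d} {L : E d →L[ℝ] ℝ} (hL : ∀ T ∈ cells K, x ∈ body T → polyDeriv (q T) x = L) :
    HasFDerivWithinAt v L (closure Ω) x := by
  rw [hK.closure_eq, Set.iUnion_subtype fun T => T ∈ cells K]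
  have hsub : ∀ S : Set (Finset (E d)), S ⊆ cells K → S.Finite →
      HasFDerivWithinAt v L (⋃ T ∈ S, body T) x := by
    intro S hS hfin
    induction S, hfin using Set.Finite.induction_on with
    | empty => simp
    | @insert T S hTS _ ih =>
      rw [Set.biUnion_insert]
      refine HasFDerivWithinAt.union ?_ (ih ((Set.subset_insert _ _).trans hS))
      have hT := hS (Set.mem_insert _ _)
      by_cases hxT : x ∈ body T
      · rw [← hL T hT hxT]
        exact (hasFDerivAt_eval (q T) x).hasFDerivWithinAt.congr (hq T hT) (hq T hT x hxT)
      · exact HasFDerivWithinAt.of_notMem_closure (by rwa [(isClosed_body T).closure_eq])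
  exact hsub _ subset_rfl hK.finite_cells

/-- Functions in the finite element space are differentiable at the vertices and, for `d = 3`, on
the edges. -/
theorem MemW.hasFDerivWithinAt (hK : IsTriangulation K Ω) {v : E d → ℝ} (hv : MemW K Ω k v)
    {q : Finset (E d) → Poly d} (hq : ∀ T ∈ cells K, ∀ x ∈ body T, v x = eval x.ofLp (q T))
    {T s : Finset (E d)} (hT : T ∈ cells K) (hsT : s ⊆ T) {x : E d} (hx : x ∈ body s)
    (hs : s.card = 1 ∨ d = 3 ∧ s.card = 2) :
    HasFDerivWithinAt v (polyDeriv (q T) x) (closure Ω) x := by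
  classical
  have hcell := isCell_of_mem_cells hT
  -- The smallest face that contains `x`. By `subset_of_bary_pos` every cell through `x` contains
  -- it, so the agreement of derivatives on this face covers all cells at `x`.
  set s' := s.filter fun u => 0 < bary T u x
  have hs's : s' ⊆ s := Finset.filter_subset _ _
  have hs'T := hs's.trans hsT
  have hx' : x ∈ body s' := by
    refine hcell.mem_body_of_bary hs'T (fun u hu => (Finset.mem_filter.1 hu).2.le)
      fun u hu hus' => ?_
    by_cases hus : u ∈ s
    · refine le_antisymm (not_lt.1 fun h => hus' (Finset.mem_filter.2 ⟨hus, h⟩))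
        (hcell.bary_nonneg hu (body_mono hsT hx))
    · exact hcell.bary_eq_zero hsT hu hus hx
  have hne : s'.Nonempty := by
    rw [Finset.nonempty_iff_ne_empty]
    intro h
    rw [h, body, Finset.coe_empty, convexHull_empty] at hx'
    exact hx'
  have hs'K : s' ∈ K.faces := K.down_closed hT.1 hs'T hne
  have hagree : DerivAgree K 1 v s' x := by
    have hle := Finset.card_le_card hs's
    have hpos := Finset.card_pos.2 hne
    rcases Nat.lt_or_ge s'.card 2 with h | h
    · obtain ⟨z, hz⟩ := Finset.card_eq_one.1 (show s'.card = 1 by omega)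
      rw [hz, body_singleton, Set.mem_singleton_iff] at hx'
      rw [hz] at hs'K ⊢
      rw [hx']
      exact hv.vertex_C1 z hs'K
    · have h3 : d = 3 := by omega
      exact hv.edge_C1 h3 s' hs'K (by omega) x hx'
  refine hasFDerivWithinAt_closure hK hq fun T' hT' hxT' => ?_
  have hs'T' := subset_of_bary_pos hT hT' hs'K hs'T hx' (fun u hu => (Finset.mem_filter.1 hu).2)
    hxT'
  ext t
  rw [polyDeriv_apply, polyDeriv_apply]
  exact DerivAgree.eval_dl_eq (l := [t]) hq hx' hagree hT' hT hs'T' hs'T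

end BoundaryGradient

/-! ### Finite overlap and comparable sizes of neighbouring cells -/

section MeshGeometry

variable {d : ℕ} {Ω : Set (E d)} {K : SimplicialComplex ℝ (E d)}

theorem IsCell.bary_sub {T : Finset (E d)} (u x y : E d) :
    (bary T u).linear (x - y) = bary T u x - bary T u y := by
  simpa using (bary T u).linearMap_vsub x y

theorem IsCell.bary_pos_of_mem_interior {T : Finset (E d)} (hT : IsCell T) {x : E d}
    (hx : x ∈ interior (body T)) {u : E d} (hu : u ∈ T) : 0 < bary T u x := by
  refine lt_of_le_of_ne (hT.bary_nonneg hu (interior_subset hx)) fun h0 => ?_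
  have hcont : Filter.Tendsto (fun a : ℝ => x - a • (u - x)) (nhdsWithin 0 (Set.Ioi 0))
      (nhds x) := by
    have : Continuous fun a : ℝ => x - a • (u - x) := by fun_prop
    have h1 := (this.tendsto 0).mono_left (nhdsWithin_le_nhds (s := Set.Ioi 0))
    simpa using h1
  obtain ⟨a, haT, ha⟩ :=
    ((hcont.eventually (mem_interior_iff_mem_nhds.1 hx)).and self_mem_nhdsWithin).exists
  have h1 := hT.bary_nonneg hu haT
  have h2 := IsCell.bary_sub (T := T) u (x - a • (u - x)) x
  rw [sub_sub_cancel_left, map_neg, map_smul, IsCell.bary_sub, hT.bary_self hu, ← h0] at h2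
  have : (0 : ℝ) < a := ha
  simp at h2
  linarith

theorem eq_of_mem_interior {T T' : Finset (E d)} (hT : T ∈ cells K)
    (hT' : T' ∈ cells K) {x : E d} (hx : x ∈ interior (body T)) (hx' : x ∈ body T') : T = T' :=
  Finset.eq_of_subset_of_card_le (subset_of_bary_pos hT hT' hT.1 subset_rfl (interior_subset hx)
    (fun _ hu => (isCell_of_mem_cells hT).bary_pos_of_mem_interior hx hu) hx')
    (by rw [hT.2, hT'.2])

theorem IsCell.exists_ne {T : Finset (E d)} (hT : IsCell T) (hd : 0 < d) (z : E d) :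
    ∃ u ∈ T, u ≠ z :=
  Finset.exists_mem_ne (by rw [hT.card]; omega) z

theorem IsCell.diam_pos {T : Finset (E d)} (hT : IsCell T) (hd : 0 < d) : 0 < diam T := by
  obtain ⟨z, hz⟩ := Finset.card_pos.1 (show 0 < T.card by rw [hT.card]; omega)
  obtain ⟨u, hu, huz⟩ := hT.exists_ne hd z
  exact (dist_pos.2 huz).trans_le (dist_le_diam (mem_body_of_mem hu) (mem_body_of_mem hz))

/-- Each cell at `z` is rescaled to diameter one about `z`. The centres of the inscribed balls then
lie in the unit ball and the radii are at least `1 / σ`. A finite cover of the unit ball by balls of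
radius `1 / σ` assigns a ball to each cell, injectively, and no comparison of diameters is needed.
-/
theorem exists_card_cells_le (hd : 0 < d) {σ : ℝ} (hσ : 0 < σ) :
    ∃ N : ℕ, ∀ K : SimplicialComplex ℝ (E d), IsShapeRegular K σ → ∀ z : E d,
      ∀ S : Finset (Finset (E d)), (∀ T ∈ S, T ∈ cells K ∧ z ∈ T) → S.card ≤ N := by
  classical
  obtain ⟨F, -, hF⟩ := (isCompact_closedBall (0 : E d) 1).elim_nhds_subcover
    (fun y => Metric.ball y σ⁻¹) fun y _ => Metric.ball_mem_nhds y (by positivity)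
  refine ⟨F.card, fun K hK z S hS => ?_⟩
  choose! c r hr hdiam hball using hK
  have hpos : ∀ T ∈ S, 0 < diam T := fun T hT => (isCell_of_mem_cells (hS T hT).1).diam_pos hd
  have hcover : ∀ T ∈ S, ∃ y ∈ F, dist y ((diam T)⁻¹ • (c T - z)) < σ⁻¹ := by
    intro T hT
    have hmem : (diam T)⁻¹ • (c T - z) ∈ Metric.closedBall (0 : E d) 1 := by
      rw [mem_closedBall_zero_iff, norm_smul, norm_inv, Real.norm_of_nonneg (hpos T hT).le,
        inv_mul_le_iff₀ (hpos T hT), mul_one, ← dist_eq_norm]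
      exact dist_le_diam (hball T (hS T hT).1
        (Metric.mem_closedBall_self (hr T (hS T hT).1).le)) (mem_body_of_mem (hS T hT).2)
    obtain ⟨y, hy, hys⟩ := Set.mem_iUnion₂.1 (hF hmem)
    exact ⟨y, hy, by rw [dist_comm]; exact hys⟩
  choose! y hyF hy using hcover
  have hmem : ∀ T ∈ S, z + diam T • y T ∈ interior (body T) := by
    intro T hT
    have hTc := (hS T hT).1
    refine interior_mono (hball T hTc) ?_
    rw [interior_closedBall _ (hr T hTc).ne', Metric.mem_ball]
    have h1 : z + diam T • y T - c T = diam T • (y T - (diam T)⁻¹ • (c T - z)) := by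
      rw [smul_sub, smul_inv_smul₀ (hpos T hT).ne']
      abel
    rw [dist_eq_norm, h1, norm_smul, Real.norm_of_nonneg (hpos T hT).le, ← dist_eq_norm]
    calc diam T * dist (y T) ((diam T)⁻¹ • (c T - z)) < diam T * σ⁻¹ :=
          mul_lt_mul_of_pos_left (hy T hT) (hpos T hT)
      _ ≤ σ * r T * σ⁻¹ := mul_le_mul_of_nonneg_right (hdiam T hTc) (by positivity)
      _ = r T := by field_simp
  -- If both cells have the same `y`, contracting the interior point of the larger cell towards `z`
  -- gives the interior point of the smaller one, which therefore belongs to both.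
  have key : ∀ T ∈ S, ∀ T' ∈ S, y T = y T' → diam T ≤ diam T' → T = T' := by
    intro T hT T' hT' hyy hle
    have h1 := (convex_body T').add_smul_sub_mem_interior'
      (subset_closure (mem_body_of_mem (hS T' hT').2)) (hmem T' hT')
      (t := diam T / diam T') ⟨div_pos (hpos T hT) (hpos T' hT'),
        (div_le_one (hpos T' hT')).2 hle⟩
    rw [add_sub_cancel_left, smul_smul, div_mul_cancel₀ _ (hpos T' hT').ne', ← hyy] at h1
    exact eq_of_mem_interior (hS T hT).1 (hS T' hT').1 (hmem T hT) (interior_subset h1)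
  refine Finset.card_le_card_of_injOn y hyF fun T hT T' hT' hyy => ?_
  rcases le_total (diam T) (diam T') with h | h
  · exact key T hT T' hT' hyy h
  · exact (key T' hT' T hT hyy.symm h).symm

/-- Edges at a vertex `z` of a cell are not all opposite to a given direction. -/
theorem IsCell.exists_segment_avoids {T : Finset (E d)} (hT : IsCell T) (hd : 2 ≤ d) {z w : E d}
    (hz : z ∈ T) (hw : w ≠ z) {a : ℝ} (ha : 0 < a) :
    ∃ u ∈ T, u ≠ z ∧ z ∉ segment ℝ (z + a • (u - z)) (z + a • (w - z)) := by
  obtain ⟨u, hu, huz⟩ := hT.exists_ne (by omega) z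
  obtain ⟨u', hu', hu'z, hu'u⟩ : ∃ u' ∈ T, u' ≠ z ∧ u' ≠ u := by
    classical
    have : 0 < ((T.erase z).erase u).card := by
      rw [Finset.card_erase_of_mem (Finset.mem_erase.2 ⟨huz, hu⟩), Finset.card_erase_of_mem hz,
        hT.card]
      omega
    obtain ⟨u', h⟩ := Finset.card_pos.1 this
    rw [Finset.mem_erase, Finset.mem_erase] at h
    exact ⟨u', h.2.2, h.2.1, h.1⟩
  -- Otherwise `u` and `u'` would both lie on the line through `z` and `w`, contrary to the affine
  -- independence of `z`, `u` and `u'`.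
  by_contra! hcon
  have hcomb : ∀ x : E d, z ∈ segment ℝ (z + a • (x - z)) (z + a • (w - z)) →
      ∃ p q : ℝ, p + q = 1 ∧ p • (x - z) + q • (w - z) = 0 := by
    rintro x ⟨p, q, -, -, hpq, h⟩
    refine ⟨p, q, hpq, ?_⟩
    have h1 : a • (p • (x - z) + q • (w - z)) = 0 := by
      have h2 : p • (z + a • (x - z)) + q • (z + a • (w - z))
          = (p + q) • z + a • (p • (x - z) + q • (w - z)) := by
        rw [add_smul, smul_add, smul_add, smul_add a, smul_comm a p, smul_comm a q]
        abel
      rw [h2, hpq, one_smul] at h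
      simpa using h
    exact (smul_eq_zero.1 h1).resolve_left ha.ne'
  obtain ⟨p, q, hpq, h1⟩ := hcomb u (hcon u hu huz)
  obtain ⟨p', q', hpq', h2⟩ := hcomb u' (hcon u' hu' hu'z)
  have h3 := congrArg (bary T u).linear h1
  have h4 := congrArg (bary T u).linear h2
  rw [map_add, map_smul, map_smul, map_zero, IsCell.bary_sub u u z, hT.bary_self hu,
    hT.bary_of_ne hu hz huz] at h3
  rw [map_add, map_smul, map_smul, map_zero, IsCell.bary_sub u u' z,
    hT.bary_of_ne hu hu' hu'u.symm, hT.bary_of_ne hu hz huz] at h4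
  simp only [sub_zero, smul_eq_mul, mul_one, mul_zero, zero_add] at h3 h4
  rcases mul_eq_zero.1 h4 with h | h
  · rw [h, add_zero] at hpq'
    rw [h, hpq', one_smul, zero_smul, add_zero] at h2
    exact hu'z (sub_eq_zero.1 h2)
  · rw [h, mul_zero, add_zero] at h3
    rw [h3, zero_add] at hpq
    rw [h3, hpq, one_smul, zero_smul, zero_add] at h1
    exact hw (sub_eq_zero.1 h1)

/-- The cells at a vertex are connected through common edges. -/
theorem exists_common_edge (hd : 2 ≤ d) (hc : Convex ℝ Ω) (hK : IsTriangulation K Ω) {z : E d}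
    {S : Set (Finset (E d))} {T₁ T₂ : Finset (E d)} (hT₁ : T₁ ∈ cells K) (hz₁ : z ∈ T₁)
    (hS₁ : T₁ ∈ S) (hT₂ : T₂ ∈ cells K) (hz₂ : z ∈ T₂) (hS₂ : T₂ ∉ S) :
    ∃ T ∈ cells K, ∃ T' ∈ cells K, z ∈ T ∧ z ∈ T' ∧ T ∈ S ∧ T' ∉ S ∧
      ∃ u ∈ T, u ∈ T' ∧ u ≠ z := by
  classical
  by_contra! hcon
  -- Without a common edge the closed sets `A` and `B` meet only in `z`, and near `z` they cover the
  -- closure of `Ω`. By convexity a short segment that avoids `z` joins `A` to `B` inside `A ∪ B`,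
  -- and connectedness gives a contradiction.
  set A := ⋃ T ∈ {T | T ∈ cells K ∧ z ∈ T ∧ T ∈ S}, body T
  set B := ⋃ T ∈ {T | T ∈ cells K ∧ z ∈ T ∧ T ∉ S}, body T
  set R := ⋃ T ∈ {T | T ∈ cells K ∧ z ∉ T}, body T
  have hfin := hK.finite_cells
  have hA : IsClosed A := (hfin.subset fun T h => h.1).isClosed_biUnion fun T _ => isClosed_body T
  have hB : IsClosed B := (hfin.subset fun T h => h.1).isClosed_biUnion fun T _ => isClosed_body T
  have hR : IsClosed R := (hfin.subset fun T h => h.1).isClosed_biUnion fun T _ => isClosed_body T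
  have hcl : closure Ω ⊆ A ∪ B ∪ R := by
    intro x hx
    obtain ⟨T, hT, hxT⟩ := hK.exists_cell hx
    by_cases hzT : z ∈ T
    · by_cases hTS : T ∈ S
      · exact Or.inl (Or.inl (Set.mem_biUnion (show T ∈ {T | _} from ⟨hT, hzT, hTS⟩) hxT))
      · exact Or.inl (Or.inr (Set.mem_biUnion (show T ∈ {T | _} from ⟨hT, hzT, hTS⟩) hxT))
    · exact Or.inr (Set.mem_biUnion (show T ∈ {T | _} from ⟨hT, hzT⟩) hxT)
  have hzR : z ∉ R := by
    intro h
    obtain ⟨T, ⟨hT, hzT⟩, hx⟩ := Set.mem_iUnion₂.1 h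
    have h1 := body_inter_subset (hT₁.1) hT.1 (mem_body_of_mem hz₁) hx
    have hcell := isCell_of_mem_cells hT₁
    have h2 := hcell.bary_eq_zero Finset.inter_subset_left hz₁
      (fun h => hzT (Finset.mem_inter.1 h).2) h1
    rw [hcell.bary_self hz₁] at h2
    exact one_ne_zero h2
  have hAB : A ∩ B ⊆ {z} := by
    rintro x ⟨hxA, hxB⟩
    obtain ⟨T, ⟨hT, hzT, hTS⟩, hx⟩ := Set.mem_iUnion₂.1 hxA
    obtain ⟨T', ⟨hT', hzT', hTS'⟩, hx'⟩ := Set.mem_iUnion₂.1 hxB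
    have h1 := body_inter_subset hT.1 hT'.1 hx hx'
    have h2 : T ∩ T' ⊆ {z} := by
      intro u hu
      rw [Finset.mem_inter] at hu
      exact Finset.mem_singleton.2 (hcon T hT T' hT' hzT hzT' hTS hTS' u hu.1 hu.2)
    have := body_mono h2 h1
    rwa [body_singleton] at this
  obtain ⟨ε, hε, hball⟩ := Metric.isOpen_iff.1 hR.isOpen_compl z hzR
  obtain ⟨w, hw, hwz⟩ := (isCell_of_mem_cells hT₂).exists_ne (by omega) z
  have hex : ∃ a : ℝ, 0 < a ∧ a ≤ 1 ∧ ∀ x ∈ body T₁ ∪ body T₂, z + a • (x - z)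
      ∈ Metric.ball z ε := by
    have hD : 0 < diam T₁ + diam T₂ + 1 := by
      have := diam_nonneg T₁
      have := diam_nonneg T₂
      positivity
    refine ⟨min 1 (ε / (diam T₁ + diam T₂ + 1)), by positivity, min_le_left _ _, fun x hx => ?_⟩
    rw [Metric.mem_ball, dist_eq_norm, add_sub_cancel_left, norm_smul,
      Real.norm_of_nonneg (by positivity), ← dist_eq_norm]
    have h1 : dist x z < diam T₁ + diam T₂ + 1 := by
      have h3 := diam_nonneg T₁
      have h4 := diam_nonneg T₂
      rcases hx with hx | hx
      · have := dist_le_diam hx (mem_body_of_mem hz₁)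
        linarith
      · have := dist_le_diam hx (mem_body_of_mem hz₂)
        linarith
    calc min 1 (ε / (diam T₁ + diam T₂ + 1)) * dist x z
        ≤ ε / (diam T₁ + diam T₂ + 1) * dist x z :=
          mul_le_mul_of_nonneg_right (min_le_right _ _) dist_nonneg
      _ < ε / (diam T₁ + diam T₂ + 1) * (diam T₁ + diam T₂ + 1) :=
          mul_lt_mul_of_pos_left h1 (by positivity)
      _ = ε := div_mul_cancel₀ _ hD.ne'
  obtain ⟨a, ha0, ha1, hex⟩ := hex
  obtain ⟨u, hu, huz, hseg⟩ := (isCell_of_mem_cells hT₁).exists_segment_avoids hd hz₁ hwz ha0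
  have hpt : ∀ {T : Finset (E d)} {x : E d}, z ∈ T → x ∈ T → z + a • (x - z) ∈ body T :=
    fun hz hx => (convex_body _).add_smul_sub_mem (mem_body_of_mem hz) (mem_body_of_mem hx)
      ⟨ha0.le, ha1⟩
  have h1 := hpt hz₁ hu
  have h2 := hpt hz₂ hw
  have hsegsub : segment ℝ (z + a • (u - z)) (z + a • (w - z)) ⊆ A ∪ B := by
    intro x hx
    have hxΩ := hc.closure.segment_subset (hK.body_subset hT₁ h1) (hK.body_subset hT₂ h2) hx
    have hxb := (convex_ball z ε).segment_subset (hex u (Or.inl (mem_body_of_mem hu)))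
      (hex w (Or.inr (mem_body_of_mem hw))) hx
    exact (hcl hxΩ).resolve_right (hball hxb)
  obtain ⟨x, hx, hxA, hxB⟩ := isPreconnected_closed_iff.1
    (convex_segment (z + a • (u - z)) (z + a • (w - z))).isPreconnected A B hA hB hsegsub
    ⟨_, left_mem_segment ℝ _ _,
      Set.mem_biUnion (show T₁ ∈ {T | _} from ⟨hT₁, hz₁, hS₁⟩) h1⟩
    ⟨_, right_mem_segment ℝ _ _,
      Set.mem_biUnion (show T₂ ∈ {T | _} from ⟨hT₂, hz₂, hS₂⟩) h2⟩
  have hxz : x = z := hAB ⟨hxA, hxB⟩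
  exact hseg (hxz ▸ hx)

/-- Cells with a common vertex have comparable diameters. -/
theorem exists_diam_le (hd : 2 ≤ d) {σ : ℝ} (hσ : 0 < σ) :
    ∃ ρ : ℝ, 1 ≤ ρ ∧ ∀ (K : SimplicialComplex ℝ (E d)) (Ω : Set (E d)), Convex ℝ Ω →
      IsTriangulation K Ω → IsShapeRegular K σ → ∀ T ∈ cells K, ∀ T' ∈ cells K, ∀ z ∈ T, z ∈ T' →
      diam T ≤ ρ * diam T' := by
  classical
  obtain ⟨N, hN⟩ := exists_card_cells_le (d := d) (by omega) hσ
  set κ := max 1 σ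
  have hκ : 1 ≤ κ := le_max_left _ _
  refine ⟨κ ^ N, one_le_pow₀ hκ, fun K Ω hc hK hreg T hT T' hT' z hz hz' => ?_⟩
  have hfin := hK.finite_cells
  let G := hfin.toFinset.filter fun T => z ∈ T
  have hG : ∀ {T}, T ∈ G ↔ T ∈ cells K ∧ z ∈ T := fun {T} => by
    rw [Finset.mem_filter, hfin.mem_toFinset]
  -- The cells at `z` within `j` factors `κ` of the size of `T'`. As long as a cell is missing, the
  -- next set contains at least one more, so all of them are reached after `N` steps.
  let S : ℕ → Finset (Finset (E d)) := fun j => G.filter fun T => diam T ≤ κ ^ j * diam T'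
  have hstep : ∀ j, G ⊆ S j ∨ j + 1 ≤ (S j).card := by
    intro j
    induction j with
    | zero =>
      refine Or.inr (Finset.card_pos.2 ⟨T', Finset.mem_filter.2 ⟨hG.2 ⟨hT', hz'⟩, ?_⟩⟩)
      rw [pow_zero, one_mul]
    | succ j ih =>
      have hmono : S j ⊆ S (j + 1) := fun T hT => by
        rw [Finset.mem_filter] at hT ⊢
        exact ⟨hT.1, hT.2.trans (mul_le_mul_of_nonneg_right
          (pow_le_pow_right₀ hκ (Nat.le_succ j)) (diam_nonneg _))⟩
      by_cases hall : G ⊆ S j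
      · exact Or.inl (hall.trans hmono)
      · right
        obtain ⟨T₂, hT₂, hT₂S⟩ := Finset.not_subset.1 hall
        have hT'S : T' ∈ S j := Finset.mem_filter.2 ⟨hG.2 ⟨hT', hz'⟩,
          le_mul_of_one_le_left (diam_nonneg _) (one_le_pow₀ hκ)⟩
        obtain ⟨T₃, hT₃, T₄, hT₄, hz₃, hz₄, hS₃, hS₄, u, hu₃, hu₄, huz⟩ := exists_common_edge
          (S := ↑(S j)) hd hc hK hT' hz' hT'S (hG.1 hT₂).1 (hG.1 hT₂).2 hT₂S
        obtain ⟨c, r, hr, hdiam, hball⟩ := hreg T₄ hT₄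
        -- The common edge is at least as long as the inscribed diameter of `T₄` and at most as long
        -- as the diameter of `T₃`.
        have h1 := (isCell_of_mem_cells hT₄).two_mul_le_dist hr hball hu₄ hz₄ huz
        have h2 := dist_le_diam (mem_body_of_mem hu₃) (mem_body_of_mem hz₃)
        have h3 : diam T₃ ≤ κ ^ j * diam T' := (Finset.mem_filter.1 hS₃).2
        have h4 : diam T₄ ≤ κ ^ (j + 1) * diam T' := by
          calc diam T₄ ≤ σ * r := hdiam
            _ ≤ κ * r := mul_le_mul_of_nonneg_right (le_max_right _ _) hr.le
            _ ≤ κ * diam T₃ := mul_le_mul_of_nonneg_left (by linarith) (by positivity)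
            _ ≤ κ * (κ ^ j * diam T') := mul_le_mul_of_nonneg_left h3 (by positivity)
            _ = κ ^ (j + 1) * diam T' := by ring
        have h5 : insert T₄ (S j) ⊆ S (j + 1) := by
          intro T h
          rcases Finset.mem_insert.1 h with rfl | h
          · exact Finset.mem_filter.2 ⟨hG.2 ⟨hT₄, hz₄⟩, h4⟩
          · exact hmono h
        have h6 := Finset.card_le_card h5
        rw [Finset.card_insert_of_notMem hS₄] at h6
        have h7 := ih.resolve_left hall
        omega
  have hTG : T ∈ G := hG.2 ⟨hT, hz⟩
  rcases hstep N with h | h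
  · exact (Finset.mem_filter.1 (h hTG)).2
  · have := hN K hreg z (S N) fun T hT => hG.1 (Finset.mem_filter.1 hT).1
    omega

end MeshGeometry

/-! ### Degrees of freedom of the transfer error as patch averages -/

section TransferError

variable {d k : ℕ} {K : SimplicialComplex ℝ (E d)} {Ω : Set (E d)} {P : DofChoice}
  {tv : E d → Module.Basis (Fin d) ℝ (E d)} {te : Finset (E d) → Fin 2 → E d}

theorem Carrier.avg_congr_carrierSet {m : ℕ} {s : Finset (E d)} (hs : s.card = m + 1)
    {c : Carrier m} (hc : c.IsInterior) {f g : (Fin m → ℝ) → ℝ}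
    (h : ∀ t ∈ refSimplex m, facePt m s t ∈ (⟨m, s, c, []⟩ : Dof d).carrierSet → f t = g t) :
    c.avg f = c.avg g := by
  cases c with
  | point t => exact h t ⟨fun i => (hc.1 i).le, hc.2.le⟩ rfl
  | whole => exact Carrier.avg_congr hc fun t ht => h t ht (facePt_mem_body hs ht)

theorem carrierSet_subset_body {m : ℕ} {s : Finset (E d)} (hs : s.card = m + 1)
    {c : Carrier m} (hc : c.IsInterior) (l : List (E d)) :
    (⟨m, s, c, l⟩ : Dof d).carrierSet ⊆ body s := by
  cases c with
  | point t =>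
    rintro _ rfl
    exact facePt_mem_body hs ⟨fun i => (hc.1 i).le, hc.2.le⟩
  | whole => exact subset_rfl

theorem carrierSet_eq {m : ℕ} (s : Finset (E d)) (c : Carrier m) (l l' : List (E d)) :
    (⟨m, s, c, l⟩ : Dof d).carrierSet = (⟨m, s, c, l'⟩ : Dof d).carrierSet := by
  cases c <;> rfl

theorem transferValue_of_existsUnique {p : E d → ℝ} {m : ℕ} {s : Finset (E d)} {c : Carrier m}
    {t : E d} {D : Set (E d)} (h : (⟨m, s, c, [t]⟩ : Dof d).carrierSet = D)
    (hD : D ⊆ frontier Ω) (hu : ∃! n, IsOuterNormal Ω D n) :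
    transferValue K Ω k P tv te p ⟨m, s, c, [t]⟩
      = patchMean K Ω k P tv te ⟨m, s, c, [t]⟩ fun T => c.avg fun y =>
          fderivWithin ℝ p (body T) (facePt m s y) hu.choose * inner ℝ hu.choose t := by
  subst h
  simp only [transferValue]
  rw [if_pos hD, dif_pos hu]

theorem transferValue_of_not_existsUnique {p : E d → ℝ} {m : ℕ} {s : Finset (E d)}
    {c : Carrier m} {t : E d} {D : Set (E d)} (h : (⟨m, s, c, [t]⟩ : Dof d).carrierSet = D)
    (hD : D ⊆ frontier Ω) (hu : ¬ ∃! n, IsOuterNormal Ω D n) :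
    transferValue K Ω k P tv te p ⟨m, s, c, [t]⟩ = 0 := by
  subst h
  simp only [transferValue]
  rw [if_pos hD, dif_neg hu]

theorem transferValue_of_not_subset {p : E d → ℝ} {m : ℕ} {s : Finset (E d)} {c : Carrier m}
    {t : E d} {D : Set (E d)} (h : (⟨m, s, c, [t]⟩ : Dof d).carrierSet = D)
    (hD : ¬ D ⊆ frontier Ω) :
    transferValue K Ω k P tv te p ⟨m, s, c, [t]⟩
      = patchMean K Ω k P tv te ⟨m, s, c, [t]⟩ fun T => (⟨m, s, c, [t]⟩ : Dof d).eval T p := by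
  subst h
  simp only [transferValue]
  rw [if_neg hD]

theorem abs_avgDeriv_le {m : ℕ} {s : Finset (E d)} (hs : s.card = m + 1) {c : Carrier m}
    (hc : c.IsInterior) {q : Poly d} {B : ℝ} (hB : 0 ≤ B) {t : E d}
    (h : ∀ x ∈ body s, |eval x.ofLp (dd t.ofLp q)| ≤ B * ‖t‖) :
    |avgDeriv m s c q t| ≤ B * ‖t‖ := by
  rw [avgDeriv_apply, faceAvg_apply]
  exact Carrier.abs_avg_le hc (by positivity) fun y hy => h _ (facePt_mem_body hs hy)

/-- A carrier in the boundary has an outer normal. -/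
theorem exists_isOuterNormal_carrierSet (ho : IsOpen Ω) (hc : Convex ℝ Ω) (hne : Ω.Nonempty)
    {m : ℕ} {s : Finset (E d)} (hs : s.card = m + 1) {c : Carrier m} {l : List (E d)}
    (hD : (⟨m, s, c, l⟩ : Dof d).carrierSet ⊆ frontier Ω) :
    ∃ n, IsOuterNormal Ω (⟨m, s, c, l⟩ : Dof d).carrierSet n := by
  cases c with
  | point t => exact exists_isOuterNormal ho hc hne (hD rfl)
  | whole =>
    -- The centroid has positive weights, so an outer normal there is an outer normal on the whole
    -- simplex.
    have hw1 : ∑ _u ∈ s, (m + 1 : ℝ)⁻¹ = 1 := by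
      rw [Finset.sum_const, hs, nsmul_eq_mul]
      push_cast
      exact mul_inv_cancel₀ (by positivity)
    have hx : ∑ u ∈ s, (m + 1 : ℝ)⁻¹ • u ∈ body s :=
      (convex_body s).sum_mem (fun _ _ => by positivity) hw1 fun u hu => mem_body_of_mem hu
    obtain ⟨n, hn⟩ := exists_isOuterNormal ho hc hne (hD hx)
    exact ⟨n, hn.body_of_weight (w := fun _ => (m + 1 : ℝ)⁻¹)
      (fun x hx => frontier_subset_closure (hD hx)) (fun _ _ => by positivity) hw1 rfl⟩

/-- Averages over the cells that contain a simplex. -/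
theorem exists_patchMean_eq (hdk : (d = 2 ∧ 3 ≤ k) ∨ (d = 3 ∧ 5 ≤ k)) (hP : P.IsAdmissible d k)
    (hK : IsTriangulation K Ω) (hF : IsFrame K tv te) {s : Finset (E d)} (hs : s ∈ K.faces) :
    ∃ G : Finset (Finset (E d)), (∀ T, T ∈ G ↔ T ∈ cells K ∧ s ⊆ T) ∧ G.Nonempty ∧
      ∀ α, IsDof K P tv te α → α.s = s → ∀ f : Finset (E d) → ℝ,
        patchMean K Ω k P tv te α f = (G.card : ℝ)⁻¹ * ∑ T ∈ G, f T := by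
  have hfin : {T | T ∈ cells K ∧ s ⊆ T}.Finite := hK.finite_cells.subset fun T h => h.1
  refine ⟨hfin.toFinset, fun T => hfin.mem_toFinset, ?_, ?_⟩
  · obtain ⟨T, hT, hsT⟩ := hK.pure s hs
    exact ⟨T, hfin.mem_toFinset.2 ⟨hT, hsT⟩⟩
  · rintro α hα rfl f
    rw [patchMean, patch_eq hdk hP hK hF hα, finsum_mem_eq_finite_toFinset_sum _ hfin, one_div,
      Set.ncard_eq_toFinset_card _ hfin]

theorem eq_mean_of_forall_eq {ι : Type*} {G : Finset ι} (hG : G.Nonempty) {a : ℝ} {f : ι → ℝ}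
    (h : ∀ T ∈ G, f T = a) : a = (G.card : ℝ)⁻¹ * ∑ T ∈ G, f T := by
  rw [Finset.sum_congr rfl h, Finset.sum_const, nsmul_eq_mul, inv_mul_cancel_left₀]
  exact_mod_cast (Finset.card_pos.2 hG).ne'

theorem abs_mean_le {ι : Type*} {G : Finset ι} (hG : G.Nonempty) {B : ℝ} {f : ι → ℝ}
    (h : ∀ T ∈ G, |f T| ≤ B) : |(G.card : ℝ)⁻¹ * ∑ T ∈ G, f T| ≤ B := by
  have hpos : (0 : ℝ) < G.card := by exact_mod_cast Finset.card_pos.2 hG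
  rw [abs_mul, abs_inv, abs_of_pos hpos, inv_mul_le_iff₀ hpos, ← nsmul_eq_mul, ← Finset.sum_const]
  exact (Finset.abs_sum_le_sum_abs _ _).trans (Finset.sum_le_sum h)

section

variable {v : E d → ℝ} {q : Finset (E d) → Poly d}

theorem MemW.eval_dd_eq (hv : MemW K Ω k v)
    (hq : ∀ T ∈ cells K, ∀ x ∈ body T, v x = eval x.ofLp (q T)) {s : Finset (E d)}
    (hs : s ∈ K.faces) (hdim : s.card = 1 ∨ d = 3 ∧ s.card = 2) {x : E d} (hx : x ∈ body s)
    {T T' : Finset (E d)} (hT : T ∈ cells K) (hT' : T' ∈ cells K) (hsT : s ⊆ T) (hsT' : s ⊆ T')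
    (t : E d) : eval x.ofLp (dd t.ofLp (q T)) = eval x.ofLp (dd t.ofLp (q T')) := by
  have hagree : DerivAgree K 1 v s x := by
    rcases hdim with h | ⟨h3, h⟩
    · obtain ⟨z, rfl⟩ := Finset.card_eq_one.1 h
      rw [body_singleton, Set.mem_singleton_iff] at hx
      rw [hx]
      exact hv.vertex_C1 z hs
    · exact hv.edge_C1 h3 s hs h x hx
  exact DerivAgree.eval_dl_eq (l := [t]) hq hx hagree hT hT' hsT hsT'

end

variable (hdk : (d = 2 ∧ 3 ≤ k) ∨ (d = 3 ∧ 5 ≤ k)) (hP : P.IsAdmissible d k)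
  (hK : IsTriangulation K Ω) (hF : IsFrame K tv te)
include hdk hP hK hF

/-- The transferred gradient degrees of freedom are averages of gradients of the pieces. -/
theorem exists_gradient_error (ho : IsOpen Ω) (hconv : Convex ℝ Ω) (hne : Ω.Nonempty)
    {v p : E d → ℝ} (hv : MemV K Ω k v) {q r : Finset (E d) → Poly d}
    (hq : ∀ T ∈ cells K, ∀ x ∈ body T, v x = eval x.ofLp (q T))
    (hr : ∀ T ∈ cells K, ∀ x ∈ body T, p x = eval x.ofLp (r T))
    {m : ℕ} {s : Finset (E d)} (hs : s ∈ K.faces) (hsm : s.card = m + 1) {c : Carrier m}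
    (hc : c.IsInterior) (hdim : s.card = 1 ∨ d = 3 ∧ s.card = 2) :
    ∃ Ψ : E d →ₗ[ℝ] ℝ, (∀ t, IsDof K P tv te ⟨m, s, c, [t]⟩ → ∀ T ∈ cells K, s ⊆ T →
        polyDof ⟨m, s, c, [t]⟩ (q T) - transferValue K Ω k P tv te p ⟨m, s, c, [t]⟩ = Ψ t) ∧
      ∀ B, 0 ≤ B → (∀ T ∈ cells K, s ⊆ T → ∀ x ∈ body s, ∀ u : E d,
        |eval x.ofLp (dd u.ofLp (q T - r T))| ≤ B * ‖u‖) → ∀ t, |Ψ t| ≤ B * ‖t‖ := by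
  classical
  obtain ⟨G, hG, hGne, hmean⟩ := exists_patchMean_eq hdk hP hK hF hs
  have hsub : ∀ {T}, T ∈ G → body s ⊆ body T := fun h => body_mono ((hG _).1 h).2
  set D := (⟨m, s, c, []⟩ : Dof d).carrierSet
  have hDs : D ⊆ body s := carrierSet_subset_body hsm hc []
  have hmul : ∀ (a : ℝ) (g : Poly d), (c.avg fun y => eval (facePt m s y).ofLp g * a)
      = a * faceAvg m s c g := fun a g => by
    rw [← smul_eq_mul, ← map_smul, faceAvg_apply]
    simp only [smul_eval, mul_comm a]
  have hpoly : ∀ t (g : Poly d), polyDof ⟨m, s, c, [t]⟩ g = avgDeriv m s c g t := fun t g => rfl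
  have hqavg : ∀ t, ∀ T ∈ G, ∀ T' ∈ G, avgDeriv m s c (q T') t = avgDeriv m s c (q T) t :=
    fun t T hT T' hT' => faceAvg_congr hsm hc fun x hx =>
      hv.toMemW.eval_dd_eq hq hs hdim hx ((hG _).1 hT').1 ((hG _).1 hT).1 ((hG _).1 hT').2
        ((hG _).1 hT).2 t
  have hderiv : ∀ T ∈ cells K, s ⊆ T → ∀ x ∈ body s,
      HasFDerivWithinAt v (polyDeriv (q T) x) (closure Ω) x := fun T hT hsT x hx =>
    hv.toMemW.hasFDerivWithinAt hK hq hT hsT hx hdim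
  have hsubavg : ∀ (g g' : Poly d) t, avgDeriv m s c (g - g') t
      = avgDeriv m s c g t - avgDeriv m s c g' t := fun g g' t => by
    rw [avgDeriv_apply, avgDeriv_apply, avgDeriv_apply, map_sub, map_sub]
  by_cases hD : D ⊆ frontier Ω
  · by_cases hu : ∃! n, IsOuterNormal Ω D n
    · set n := hu.choose
      have hn : IsOuterNormal Ω D n := hu.choose_spec.1
      -- On the carrier `∇v` is a multiple of `n`, so the degree of freedom of `v` is also the
      -- average of `∂_n v` times `n · t`, and the difference is linear in `t`.
      refine ⟨((G.card : ℝ)⁻¹ * ∑ T ∈ G, avgDeriv m s c (q T - r T) n) • (innerₗ (E d) n),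
        fun t ht T hT hsT => ?_, fun B hB hb t => ?_⟩
      · have htv := transferValue_of_existsUnique (K := K) (k := k) (P := P) (tv := tv) (te := te)
          (p := p) (carrierSet_eq s c [t] []) hD hu
        have hqt : polyDof ⟨m, s, c, [t]⟩ (q T) = inner ℝ n t * avgDeriv m s c (q T) n := by
          rw [avgDeriv_apply, ← hmul, hpoly, avgDeriv_apply, faceAvg_apply]
          refine Carrier.avg_congr_carrierSet hsm hc fun y hy hyD => ?_
          have := deriv_eq_normal ho hconv hne (hD hyD)
            (hn.mono (Set.singleton_subset_iff.2 hyD)) hv.zero_bdry (hderiv T hT hsT _ (hDs hyD)) t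
          rwa [polyDeriv_apply, polyDeriv_apply] at this
        have hrt : ∀ T ∈ G, (c.avg fun y => fderivWithin ℝ p (body T) (facePt m s y) n
            * inner ℝ n t) = inner ℝ n t * avgDeriv m s c (r T) n := fun T hT => by
          rw [avgDeriv_apply, ← hmul]
          refine Carrier.avg_congr hc fun y hy => ?_
          rw [fderivWithin_eq_dd (isCell_of_mem_cells ((hG _).1 hT).1).uniqueDiffOn
            (hr T ((hG _).1 hT).1) n (hsub hT (facePt_mem_body hsm hy))]
        rw [htv, hmean _ ht rfl, Finset.sum_congr rfl hrt, ← Finset.mul_sum, hqt,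
          eq_mean_of_forall_eq hGne (hqavg n T ((hG T).2 ⟨hT, hsT⟩))]
        simp only [hsubavg, Finset.sum_sub_distrib, LinearMap.smul_apply, innerₗ_apply_apply,
          smul_eq_mul]
        ring
      · have h1 : |(G.card : ℝ)⁻¹ * ∑ T ∈ G, avgDeriv m s c (q T - r T) n| ≤ B := by
          refine abs_mean_le hGne fun T hT => ?_
          have := abs_avgDeriv_le hsm hc hB fun x hx =>
            hb T ((hG _).1 hT).1 ((hG _).1 hT).2 x hx n
          rwa [hn.1, mul_one] at this
        rw [LinearMap.smul_apply, smul_eq_mul, abs_mul, innerₗ_apply_apply]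
        refine mul_le_mul h1 ?_ (abs_nonneg _) hB
        have := abs_real_inner_le_norm n t
        rwa [hn.1, one_mul] at this
    -- A second normal forces `∇v = 0` on the carrier, in agreement with the value `0` prescribed
    -- for the transfer.
    · refine ⟨0, fun t ht T hT hsT => ?_, fun B hB hb t => by simp; positivity⟩
      rw [transferValue_of_not_existsUnique (carrierSet_eq s c [t] []) hD hu, sub_zero,
        LinearMap.zero_apply, hpoly, avgDeriv_apply]
      obtain ⟨n, hn⟩ := exists_isOuterNormal_carrierSet ho hconv hne hsm hD
      obtain ⟨n', hn', hnn⟩ : ∃ n', IsOuterNormal Ω D n' ∧ n' ≠ n := by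
        by_contra! h
        exact hu ⟨n, hn, h⟩
      have h0 : faceAvg m s c (0 : Poly d) = 0 := map_zero _
      rw [← h0, faceAvg_apply, faceAvg_apply]
      refine Carrier.avg_congr_carrierSet hsm hc fun y hy hyD => ?_
      have hyD' := Set.singleton_subset_iff.2 hyD
      have := deriv_eq_zero_of_two_normals ho hconv hne (hD hyD) (hn'.mono hyD') (hn.mono hyD')
        hnn hv.zero_bdry (hderiv T hT hsT _ (hDs hyD)) t
      rw [polyDeriv_apply] at this
      rw [this, map_zero]
  · refine ⟨(G.card : ℝ)⁻¹ • ∑ T ∈ G, avgDeriv m s c (q T - r T), fun t ht T hT hsT => ?_,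
      fun B hB hb t => ?_⟩
    · have htv := transferValue_of_not_subset (K := K) (k := k) (P := P) (tv := tv) (te := te)
        (p := p) (carrierSet_eq s c [t] []) hD
      have hrt : ∀ T ∈ G, (⟨m, s, c, [t]⟩ : Dof d).eval T p = avgDeriv m s c (r T) t :=
        fun T hT => Dof.eval_eq_polyDof (α := ⟨m, s, c, [t]⟩) hsm hc
          (isCell_of_mem_cells ((hG _).1 hT).1) ((hG _).1 hT).2 (hr T ((hG _).1 hT).1)
      rw [htv, hmean _ ht rfl, Finset.sum_congr rfl hrt, hpoly,
        eq_mean_of_forall_eq hGne (hqavg t T ((hG T).2 ⟨hT, hsT⟩))]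
      simp only [hsubavg, Finset.sum_sub_distrib, LinearMap.smul_apply, LinearMap.sum_apply,
        smul_eq_mul]
      ring
    · rw [LinearMap.smul_apply, LinearMap.sum_apply, smul_eq_mul]
      exact abs_mean_le hGne fun T hT => abs_avgDeriv_le hsm hc hB fun x hx =>
        hb T ((hG _).1 hT).1 ((hG _).1 hT).2 x hx t

/-- The other transferred degrees of freedom are averages over the patch. -/
theorem exists_mean_error {v p : E d → ℝ} (hv : MemV K Ω k v) {q r : Finset (E d) → Poly d}
    (hq : ∀ T ∈ cells K, ∀ x ∈ body T, v x = eval x.ofLp (q T))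
    (hr : ∀ T ∈ cells K, ∀ x ∈ body T, p x = eval x.ofLp (r T))
    {s : Finset (E d)} (hs : s ∈ K.faces) :
    ∃ G : Finset (Finset (E d)), (∀ T, T ∈ G ↔ T ∈ cells K ∧ s ⊆ T) ∧ G.Nonempty ∧
      ∀ α, IsDof K P tv te α → α.s = s → α.dirs.length ≠ 1 → ∀ T ∈ cells K, s ⊆ T →
        polyDof α (q T) - transferValue K Ω k P tv te p α
          = (G.card : ℝ)⁻¹ * ∑ T ∈ G, polyDof α (q T - r T) := by
  obtain ⟨G, hG, hGne, hmean⟩ := exists_patchMean_eq hdk hP hK hF hs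
  refine ⟨G, hG, hGne, ?_⟩
  rintro α hα rfl hl T hT hsT
  have htv : transferValue K Ω k P tv te p α
      = patchMean K Ω k P tv te α fun T => α.eval T p := by
    obtain ⟨m, s, c, l⟩ := α
    match l, hl with
    | [], _ => rfl
    | _ :: _ :: _, _ => rfl
  have hrt : ∀ T ∈ G, α.eval T p = polyDof α (r T) := fun T hT =>
    Dof.eval_eq_polyDof hα.card_eq (hα.isInterior hK.isPure hP)
      (isCell_of_mem_cells ((hG _).1 hT).1) ((hG _).1 hT).2 (hr T ((hG _).1 hT).1)
  -- Values are single valued by continuity, and second derivatives at vertices by the `C²`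
  -- condition.
  have hqt : ∀ T' ∈ G, polyDof α (q T') = polyDof α (q T) := by
    intro T' hT'
    obtain ⟨hT', hsT'⟩ := (hG _).1 hT'
    have hval : ∀ x ∈ body α.s, eval x.ofLp (q T') = eval x.ofLp (q T) := fun x hx => by
      rw [← hq T' hT' x (body_mono hsT' hx), ← hq T hT x (body_mono hsT hx)]
    have hcard := hα.card_eq
    have hint := hα.isInterior hK.isPure hP
    cases hα with
    | vertex_value z hz =>
      exact faceAvg_congr hcard hint hval
    | vertex_grad z hz i => simp at hl
    | vertex_hess h3 z hz i j hij =>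
      rw [polyDof_vertex, polyDof_vertex]
      exact DerivAgree.eval_dl_eq (l := [tv z i, tv z j]) hq
        (mem_body_of_mem (Finset.mem_singleton_self z)) (hv.vertex_C2 h3 z hz) hT' hT hsT' hsT
    | face_value m hm s hs hsm c hc =>
      exact faceAvg_congr hcard hint hval
    | edge_normal h3 e he he2 c hc i => simp at hl
  rw [htv, hmean α hα rfl, Finset.sum_congr rfl hrt, eq_mean_of_forall_eq hGne hqt]
  simp only [map_sub, Finset.sum_sub_distrib]
  ring

end TransferError

/-! ### Interpolation error on a cell -/

section JetBounds

variable {d k : ℕ}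

/-- A polynomial and its derivatives up to the second order are bounded by `M` after scaling
with `h`. -/
def JetBound (T : Finset (E d)) (h M : ℝ) (q : Poly d) : Prop :=
  ∀ l : List (E d), l.length ≤ 2 → ∀ x ∈ body T,
    |eval x.ofLp (dl (l.map WithLp.ofLp) q)| * h ^ l.length ≤ M * (l.map fun t => ‖t‖).prod

theorem JetBound.mono {T : Finset (E d)} {h M M' : ℝ} {q : Poly d} (hq : JetBound T h M q)
    (hM : M ≤ M') : JetBound T h M' q := fun l hl x hx =>
  (hq l hl x hx).trans (mul_le_mul_of_nonneg_right hM
    (List.prod_nonneg (by simp)))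

theorem pderiv_pderiv_eq_zero {r : Poly d} (hr : r.totalDegree ≤ 1) (i j : Fin d) :
    pderiv i (pderiv j r) = 0 := by
  have h1 : (pderiv j r).totalDegree ≤ 0 := by
    have := totalDegree_dd_le (Pi.single j 1) r
    rw [dd_single] at this
    omega
  rw [totalDegree_eq_zero_iff_eq_C.1 (Nat.le_zero.1 h1), pderiv_C]

/-- In reference coordinates `q - r` vanishes at the vertices, so its coefficients are bounded by
its Hessian, which is that of `v` because `r` is affine. Each derivative on the cell costs a factor
of order `1 / R`, and this is absorbed by `h ≤ ρ * σ * R`. -/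
theorem exists_jetBound (d k : ℕ) (σ : ℝ) {ρ : ℝ} (hρ : 0 ≤ ρ) :
    ∃ C : ℝ, 0 ≤ C ∧ ∀ T : Finset (E d), IsCell T → ∀ (c : E d) (R : ℝ), 0 < R →
      Metric.closedBall c R ⊆ body T → diam T ≤ σ * R → ∀ h, 0 ≤ h → h ≤ ρ * diam T →
      ∀ J : ℝ, 0 < J →
      (∀ f : E d → ℝ, ∫ x in body T, f x = J * ∫ t in refSimplex d, f (facePt d T t)) →
      ∀ (v : E d → ℝ) (q r : Poly d), q.totalDegree ≤ k → r.totalDegree ≤ 1 → 1 ≤ k →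
      (∀ x ∈ body T, v x = eval x.ofLp q) → (∀ z ∈ T, eval z.ofLp q = eval z.ofLp r) →
      JetBound T h (C * √(diam T ^ 4 * (J⁻¹ * hessL2Sq T v))) (q - r) := by
  obtain ⟨C₀, hC₀, hcoef⟩ := exists_coefBound_refHess d k
  -- The cost of one derivative after scaling with `h`; being at least one, `κ ^ 2` covers all
  -- orders up to two.
  set κ := max 1 (ρ * σ / 2 * (d * k))
  have hκ : 1 ≤ κ := le_max_left _ _
  refine ⟨(mons d k).card * κ ^ 2 * (C₀ * √(d ^ 2)), by positivity, ?_⟩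
  intro T hT c R hR hball hdiam h hh hhT J hJ hint v q r hq hr hk hv hz l hl x hx
  have hdeg : (q - r).totalDegree ≤ k :=
    (totalDegree_sub _ _).trans (max_le hq (hr.trans hk))
  have hvert : ∀ t : Fin d → ℝ, ∀ z ∈ T, facePt d T t = z → eval t (pb d T (q - r)) = 0 := by
    rintro t z hzT rfl
    rw [eval_pb, map_sub, hz _ hzT, sub_self]
  have h0 : facePt d T 0 = vert T 0 := by
    ext i
    simp [facePt_apply]
  have h1 : ∀ i : Fin d, facePt d T (Pi.single i 1) = vert T (i + 1) := by
    intro i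
    ext j
    simp [facePt_apply, Pi.single_apply]
  have hM := hcoef (pb d T (q - r)) ((totalDegree_pb_le _ _ _).trans hdeg)
    (hvert 0 _ (vert_mem hT.card 0) h0)
    (fun i => hvert _ _ (vert_mem hT.card i.succ) (by rw [h1]; simp))
  have hhess : hessL2Sq T (fun x => eval x.ofLp (q - r)) = hessL2Sq T v := by
    rw [hT.hessL2Sq_eq (p := q - r) fun _ _ => rfl, hT.hessL2Sq_eq hv]
    simp only [map_sub, pderiv_pderiv_eq_zero hr, sub_zero]
  have href := hT.refHess_pb_le (v := fun x => eval x.ofLp (q - r)) (p := q - r)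
    (fun _ _ => rfl) hJ hint
  rw [hhess, mul_assoc] at href
  have hsqrt : √(refHess (pb d T (q - r)))
      ≤ √(d ^ 2) * √(diam T ^ 4 * (J⁻¹ * hessL2Sq T v)) := by
    rw [← Real.sqrt_mul (by positivity)]
    exact Real.sqrt_le_sqrt href
  have hmain := hT.abs_eval_dl_le hR hball hdeg hM l hx
  set W := √(diam T ^ 4 * (J⁻¹ * hessL2Sq T v))
  have hscale : h ≤ ρ * σ * R := by
    calc h ≤ ρ * diam T := hhT
      _ ≤ ρ * (σ * R) := mul_le_mul_of_nonneg_left hdiam hρ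
      _ = ρ * σ * R := by ring
  have hprod : ∀ l : List (E d), (l.map fun t => ‖t‖ / (2 * R) * (d * k)).prod * h ^ l.length
      ≤ κ ^ l.length * (l.map fun t => ‖t‖).prod := by
    intro l
    induction l with
    | nil => simp
    | cons t l ih =>
      have h2 : ‖t‖ / (2 * R) * (d * k) * h ≤ κ * ‖t‖ := by
        calc ‖t‖ / (2 * R) * (d * k) * h ≤ ‖t‖ / (2 * R) * (d * k) * (ρ * σ * R) :=
              mul_le_mul_of_nonneg_left hscale (by positivity)
          _ = ρ * σ / 2 * (d * k) * ‖t‖ := by field_simp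
          _ ≤ κ * ‖t‖ := mul_le_mul_of_nonneg_right (le_max_right _ _) (norm_nonneg _)
      rw [List.map_cons, List.prod_cons, List.length_cons, List.map_cons, List.prod_cons]
      calc ‖t‖ / (2 * R) * (d * k) * (l.map fun t => ‖t‖ / (2 * R) * (d * k)).prod
            * h ^ (l.length + 1)
          = (‖t‖ / (2 * R) * (d * k) * h) *
            ((l.map fun t => ‖t‖ / (2 * R) * (d * k)).prod * h ^ l.length) := by ring
        _ ≤ (κ * ‖t‖) * (κ ^ l.length * (l.map fun t => ‖t‖).prod) :=
          mul_le_mul h2 ih (mul_nonneg (List.prod_nonneg (by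
            simp only [List.mem_map, forall_exists_index, and_imp, forall_apply_eq_imp_iff₂]
            intro _ _
            positivity)) (by positivity)) (by positivity)
        _ = _ := by ring
  have hpos : 0 ≤ (l.map fun t => ‖t‖).prod := List.prod_nonneg (by simp)
  calc |eval x.ofLp (dl (l.map WithLp.ofLp) (q - r))| * h ^ l.length
      ≤ (mons d k).card * ((l.map fun t => ‖t‖ / (2 * R) * (d * k)).prod
        * (C₀ * √(refHess (pb d T (q - r))))) * h ^ l.length :=
        mul_le_mul_of_nonneg_right hmain (by positivity)
    _ = (mons d k).card * ((l.map fun t => ‖t‖ / (2 * R) * (d * k)).prod * h ^ l.length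
        * (C₀ * √(refHess (pb d T (q - r))))) := by ring
    _ ≤ (mons d k).card * (κ ^ 2 * (l.map fun t => ‖t‖).prod * (C₀ * (√(d ^ 2) * W))) := by
        refine mul_le_mul_of_nonneg_left (mul_le_mul ?_ ?_ (by positivity) (by positivity))
          (by positivity)
        · exact (hprod l).trans (mul_le_mul_of_nonneg_right (pow_le_pow_right₀ hκ hl) hpos)
        · exact mul_le_mul_of_nonneg_left hsqrt hC₀
    _ = _ := by ring

end JetBounds

/-! ### Degrees of freedom of the transfer error are small -/

section TransferBounds

variable {d k : ℕ} {K : SimplicialComplex ℝ (E d)} {Ω : Set (E d)} {P : DofChoice}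
  {tv : E d → Module.Basis (Fin d) ℝ (E d)} {te : Finset (E d) → Fin 2 → E d}

open Classical in
/-- Bounds for the pieces of `v - p` around a cell are bounds for the degrees of freedom of
`v - Π₀ p` on the cell. -/
theorem dofBound_error (hdk : (d = 2 ∧ 3 ≤ k) ∨ (d = 3 ∧ 5 ≤ k)) (hP : P.IsAdmissible d k)
    (hK : IsTriangulation K Ω) (hF : IsFrame K tv te) (ho : IsOpen Ω) (hconv : Convex ℝ Ω)
    (hne : Ω.Nonempty) {v p : E d → ℝ} (hv : MemV K Ω k v) {q r : Finset (E d) → Poly d}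
    (hq : ∀ T ∈ cells K, ∀ x ∈ body T, v x = eval x.ofLp (q T))
    (hr : ∀ T ∈ cells K, ∀ x ∈ body T, p x = eval x.ofLp (r T)) {T : Finset (E d)}
    (hT : T ∈ cells K) {g : Poly d}
    (hg : ∀ β, IsDof K P tv te β → β.s ⊆ T → polyDof β g = transferValue K Ω k P tv te p β)
    {h M : ℝ} (hh : 0 < h) (hM : 0 ≤ M)
    (hb : ∀ T' ∈ cells K, (T ∩ T').Nonempty → JetBound T' h M (q T' - r T')) :
    DofBound P T h M (q T - g) := by
  have hd : d = 2 ∨ d = 3 := by omega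
  have hface : ∀ {s}, s ⊆ T → 0 < s.card → s ∈ K.faces := fun hs hc =>
    K.down_closed hT.1 hs (Finset.card_pos.1 hc)
  have hb' : ∀ {s}, s ∈ K.faces → s ⊆ T → ∀ T' ∈ cells K, s ⊆ T' →
      JetBound T' h M (q T' - r T') := fun hs hsT T' hT' hsT' =>
    hb T' hT' ((K.nonempty_of_mem_faces hs).mono (Finset.subset_inter hsT hsT'))
  have hz : ∀ {z}, z ∈ T → {z} ∈ K.faces := singleton_mem_faces hT.1
  have hgrad : ∀ {m : ℕ} {s : Finset (E d)} {c : Carrier m}, s ∈ K.faces → s ⊆ T →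
      s.card = m + 1 → c.IsInterior → (s.card = 1 ∨ d = 3 ∧ s.card = 2) →
      ∃ Ψ : E d →ₗ[ℝ] ℝ, (∀ t, IsDof K P tv te ⟨m, s, c, [t]⟩ →
        polyDof ⟨m, s, c, [t]⟩ (q T - g) = Ψ t) ∧ ∀ t, h * |Ψ t| ≤ M * ‖t‖ := by
    intro m s c hs hsT hsm hc hdim
    obtain ⟨Ψ, hΨ, hΨb⟩ := exists_gradient_error hdk hP hK hF ho hconv hne hv hq hr hs hsm hc hdim
    refine ⟨Ψ, fun t ht => ?_, fun t => ?_⟩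
    · rw [map_sub, hg _ ht hsT]
      exact hΨ t ht T hT hsT
    · have h1 := hΨb (M / h) (by positivity) (fun T' hT' hsT' x hx u => by
        have h2 := hb' hs hsT T' hT' hsT' [u] (by simp) x (body_mono hsT' hx)
        simp only [List.map_cons, List.map_nil, dl_cons, dl_nil, List.length_singleton, pow_one,
          List.prod_cons, List.prod_nil, mul_one] at h2
        rw [div_mul_eq_mul_div, le_div_iff₀ hh]
        exact h2) t
      rw [div_mul_eq_mul_div, le_div_iff₀ hh] at h1
      rwa [mul_comm]
  have hmean : ∀ α, IsDof K P tv te α → α.dirs = [] → α.s ⊆ T → |polyDof α (q T - g)| ≤ M := by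
    rintro ⟨m, s, c, _⟩ hα rfl hsT
    obtain ⟨G, hG, hGne, hGm⟩ := exists_mean_error hdk hP hK hF hv hq hr hα.mem_faces
    rw [map_sub, hg _ hα hsT, hGm _ hα rfl (by simp) T hT hsT]
    refine abs_mean_le hGne fun T' hT' => ?_
    rw [polyDof_apply, faceAvg_apply]
    refine Carrier.abs_avg_le (hα.isInterior hK.isPure hP) hM fun y hy => ?_
    have := hb' hα.mem_faces hsT T' ((hG _).1 hT').1 ((hG _).1 hT').2 [] (by simp) _
      (body_mono ((hG _).1 hT').2 (facePt_mem_body hα.card_eq hy))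
    simpa using this
  refine DofBound.of_frame hd (tv := tv) (te := te)
    (fun h3 e he hec => hF.te_indep h3 e (hface he (by omega)) hec)
    (fun h3 e he hec => hF.te_normal h3 e (hface he (by omega)) hec) ?_ ?_ ?_ ?_ ?_
  · intro z hzT
    have := hmean _ (IsDof.vertex_value z (hz hzT)) rfl (Finset.singleton_subset_iff.2 hzT)
    rw [polyDof_vertex] at this
    simpa using this
  · intro z hzT
    obtain ⟨Ψ, hΨ, hΨb⟩ := hgrad (m := 0) (c := .point 0) (hz hzT)
      (Finset.singleton_subset_iff.2 hzT) (by simp)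
      (IsDof.vertex_value (P := P) (tv := tv) (te := te) z (hz hzT) |>.isInterior hK.isPure hP)
      (Or.inl (by simp))
    refine ⟨Ψ, fun i => ?_, fun t => by rw [mul_comm]; exact hΨb t⟩
    rw [← hΨ (tv z i) (IsDof.vertex_grad z (hz hzT) i), polyDof_vertex]
    simp only [List.map_cons, List.map_nil, dl_cons, dl_nil]
  · intro h3 z hzT
    obtain ⟨G, hG, hGne, hGm⟩ := exists_mean_error hdk hP hK hF hv hq hr (hz hzT)
    have hzs := Finset.singleton_subset_iff.2 hzT
    -- The mean of the pieces is itself a polynomial; its Hessian is the symmetric bilinear form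
    -- that `DofBound.of_frame` requires.
    refine ⟨(G.card : ℝ)⁻¹ • ∑ T ∈ G, (q T - r T), fun i j hij => ?_, fun t u => ?_⟩
    · have hα := IsDof.vertex_hess (K := K) (P := P) (tv := tv) (te := te) h3 z (hz hzT) i j hij
      have h1 := hGm _ hα rfl (by simp) T hT hzs
      rw [← hg _ hα hzs, ← map_sub] at h1
      simp only [polyDof_vertex, List.map_cons, List.map_nil, dl_cons, dl_nil] at h1
      rw [h1]
      simp only [map_sum, Derivation.map_smul, smul_eval]
    · have hpos : (0 : ℝ) < G.card := by exact_mod_cast Finset.card_pos.2 hGne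
      have h1 : |eval z.ofLp (dd t.ofLp (dd u.ofLp ((G.card : ℝ)⁻¹ • ∑ T ∈ G, (q T - r T))))|
          ≤ M * (‖t‖ * ‖u‖) / h ^ 2 := by
        simp only [map_sum, Derivation.map_smul, smul_eval]
        refine abs_mean_le hGne fun T' hT' => ?_
        have h2 := hb' (hz hzT) hzs T' ((hG _).1 hT').1 ((hG _).1 hT').2 [t, u] (by simp) z
          (mem_body_of_mem (Finset.singleton_subset_iff.1 ((hG _).1 hT').2))
        simp only [List.map_cons, List.map_nil, dl_cons, dl_nil, List.length_cons,
          List.length_nil, zero_add, Nat.reduceAdd, List.prod_cons, List.prod_nil, mul_one] at h2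
        rwa [le_div_iff₀ (by positivity)]
      rwa [le_div_iff₀ (by positivity)] at h1
  · intro m hm s hs hsm c hc
    have := hmean _ (IsDof.face_value m hm s (hface hs (by omega)) hsm c hc) rfl hs
    rw [polyDof_apply] at this
    simpa using this
  · intro h3 e he hec c hc
    have heK := hface he (by omega)
    obtain ⟨Ψ, hΨ, hΨb⟩ := hgrad (m := 1) (c := c) heK he hec ((hP.nrm h3).1 c hc)
      (Or.inr ⟨h3, hec⟩)
    refine ⟨Ψ, fun i => ?_, hΨb⟩
    rw [← hΨ (te e i) (IsDof.edge_normal h3 e heK hec c hc i), polyDof_apply]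
    simp only [List.map_cons, List.map_nil, dl_cons, dl_nil]

end TransferBounds

/-! ### The local estimate, overlap and weights -/

section LocalEstimate

variable {d k : ℕ}

theorem volume_body_eq {T : Finset (E d)} {J : ℝ}
    (hint : ∀ f : E d → ℝ, ∫ x in body T, f x = J * ∫ t in refSimplex d, f (facePt d T t)) :
    volume.real (body T) = J * volume.real (refSimplex d) := by
  have := hint fun _ => 1
  rwa [setIntegral_const, setIntegral_const, smul_eq_mul, smul_eq_mul, mul_one, mul_one] at this

theorem l2Sq_le {T : Finset (E d)} {J : ℝ} (hT : IsCell T) (hJ : 0 < J)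
    (hint : ∀ f : E d → ℝ, ∫ x in body T, f x = J * ∫ t in refSimplex d, f (facePt d T t))
    {w : E d → ℝ} {B : ℝ} (hw : ∀ x ∈ body T, |w x| ≤ B) :
    l2Sq T w ≤ J * (B ^ 2 * volume.real (refSimplex d)) := by
  rw [l2Sq, hint]
  refine mul_le_mul_of_nonneg_left ?_ hJ.le
  have hfin : volume (refSimplex d) < ⊤ := (isCompact_refSimplex d).measure_lt_top
  have h : ‖∫ t in refSimplex d, w (facePt d T t) ^ 2‖ ≤ B ^ 2 * volume.real (refSimplex d) := by
    refine norm_setIntegral_le_of_norm_le_const hfin fun t ht => ?_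
    rw [Real.norm_eq_abs, abs_pow]
    exact pow_le_pow_left₀ (abs_nonneg _) (hw _ (facePt_mem_body hT.card ht)) 2
  exact (le_abs_self _).trans h

/-- Up to the reference volume the factors are the volumes of the cells. The cell `T` lies in a ball
of radius `diam T`, and `T'` contains a ball of radius `R`. -/
theorem jacobian_le {T T' : Finset (E d)} (hT : IsCell T) {J J' : ℝ}
    (hint : ∀ f : E d → ℝ, ∫ x in body T, f x = J * ∫ t in refSimplex d, f (facePt d T t))
    (hJ' : 0 < J')
    (hint' : ∀ f : E d → ℝ, ∫ x in body T', f x = J' * ∫ t in refSimplex d, f (facePt d T' t))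
    {c : E d} {R σ ρ : ℝ} (hR : 0 < R) (hball : Metric.closedBall c R ⊆ body T')
    (hdiam : diam T' ≤ σ * R) (hρ : 0 ≤ ρ) (hTT' : diam T ≤ ρ * diam T') :
    J ≤ (σ * ρ) ^ d * J' := by
  obtain ⟨z, hz⟩ := Finset.card_pos.1 (show 0 < T.card by rw [hT.card]; omega)
  set ω := volume.real (Metric.ball (0 : E d) 1)
  have hω : 0 < ω := ENNReal.toReal_pos (Metric.measure_ball_pos _ _ one_pos).ne' measure_ball_lt_top.ne
  have hfin : Module.finrank ℝ (E d) = d := by simp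
  have h1 : volume.real (body T) ≤ diam T ^ d * ω := by
    have h2 := Measure.addHaar_real_closedBall (μ := (volume : Measure (E d))) z (diam_nonneg T)
    rw [hfin] at h2
    rw [← h2]
    exact measureReal_mono (fun x hx => Metric.mem_closedBall.2
      (dist_le_diam hx (mem_body_of_mem hz))) (measure_closedBall_lt_top).ne
  have h3 : R ^ d * ω ≤ volume.real (body T') := by
    have h2 := Measure.addHaar_real_closedBall (μ := (volume : Measure (E d))) c hR.le
    rw [hfin] at h2
    rw [← h2]
    exact measureReal_mono hball (isCompact_body T').measure_lt_top.ne
  have h4 : diam T ≤ σ * ρ * R := by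
    calc diam T ≤ ρ * diam T' := hTT'
      _ ≤ ρ * (σ * R) := mul_le_mul_of_nonneg_left hdiam hρ
      _ = σ * ρ * R := by ring
  have hσρ : 0 ≤ σ * ρ := by
    by_contra! h
    have := mul_neg_of_neg_of_pos h hR
    have := diam_nonneg T
    linarith
  have hvol : volume.real (body T) ≤ (σ * ρ) ^ d * volume.real (body T') := by
    calc volume.real (body T) ≤ diam T ^ d * ω := h1
      _ ≤ (σ * ρ * R) ^ d * ω :=
        mul_le_mul_of_nonneg_right (pow_le_pow_left₀ (diam_nonneg T) h4 d) hω.le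
      _ = (σ * ρ) ^ d * (R ^ d * ω) := by ring
      _ ≤ _ := mul_le_mul_of_nonneg_left h3 (by positivity)
  rw [volume_body_eq hint, volume_body_eq hint', ← mul_assoc] at hvol
  rw [volume_body_eq hint'] at h3
  have hpos : 0 < volume.real (refSimplex d) :=
    (pos_iff_pos_of_mul_pos ((by positivity : 0 < R ^ d * ω).trans_le h3)).1 hJ'
  exact le_of_mul_le_mul_right hvol hpos

variable {P : DofChoice}

open Classical in
-- Stability is applied to `q T - g`, the polynomial piece of the error, with `h = diam T`. The
-- ratio `κ = σ` is justified by the lower bound `2 * r` for the edge lengths. The bound for the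
-- degrees of freedom comes from the jet bounds on the neighbouring cells.
theorem exists_local_estimate (hdk : (d = 2 ∧ 3 ≤ k) ∨ (d = 3 ∧ 5 ≤ k)) (hP : P.IsAdmissible d k)
    {σ ρ : ℝ} (hσ : 0 < σ) (hρ : 1 ≤ ρ) :
    ∃ C : ℝ, 0 ≤ C ∧ ∀ (K : SimplicialComplex ℝ (E d)) (Ω : Set (E d)),
      IsConvexPolytopalDomain Ω → IsTriangulation K Ω → IsShapeRegular K σ →
      ∀ (tv : E d → Module.Basis (Fin d) ℝ (E d)) (te : Finset (E d) → Fin 2 → E d),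
      IsFrame K tv te → ∀ v, MemV K Ω k v → ∀ T ∈ cells K, ∀ G : Finset (Finset (E d)),
      (∀ T', T' ∈ G ↔ T' ∈ cells K ∧ (T ∩ T').Nonempty) →
      (∀ T' ∈ G, diam T ≤ ρ * diam T') →
      l2Sq T (fun x => v x - transfer K Ω k P tv te (nodalInterp K Ω v) x)
        ≤ C * ∑ T' ∈ G, diam T' ^ 4 * hessL2Sq T' v := by
  have hd : d = 2 ∨ d = 3 := by omega
  obtain ⟨C₁, hC₁, hjet⟩ := exists_jetBound d k σ (zero_le_one.trans hρ)
  obtain ⟨C₂, hC₂, hstab⟩ := exists_stability hd hP σ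
  refine ⟨(C₂ * C₁) ^ 2 * volume.real (refSimplex d) * (σ * ρ) ^ d, by positivity, ?_⟩
  intro K Ω hΩ hK hreg tv te hF v hv T hT G hG hdiam
  have hcell := fun {T} (hT : T ∈ cells K) => isCell_of_mem_cells hT
  obtain ⟨hp, hpv⟩ := nodalInterp_spec hΩ.isOpen hΩ.convex hΩ.1 hK hv.zero_bdry
  set p := nodalInterp K Ω v
  obtain ⟨q, hq⟩ := hv.poly.exists_polys
  obtain ⟨r, hr⟩ := hp.poly.exists_polys
  obtain ⟨g, hgdeg, hgv, hg⟩ := exists_transfer_poly hdk hP hK hF p hT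
  choose! c R hR hsize hball using hreg
  have hjac : ∀ T, ∃ J : ℝ, T ∈ cells K → 0 < J ∧ ∀ f : E d → ℝ,
      ∫ x in body T, f x = J * ∫ t in refSimplex d, f (facePt d T t) := fun T => by
    by_cases hT : T ∈ cells K
    · obtain ⟨J, hJ⟩ := (hcell hT).exists_jacobian
      exact ⟨J, fun _ => hJ⟩
    · exact ⟨0, fun h => absurd h hT⟩
  choose J hJ using hjac
  -- The square of the common bound for all neighbours, up to `C₁ ^ 2`. The sum replaces the maximum
  -- over the neighbours.
  obtain ⟨W, hWeq⟩ : ∃ W, W = ∑ T' ∈ G, diam T' ^ 4 * ((J T')⁻¹ * hessL2Sq T' v) := ⟨_, rfl⟩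
  have hterm : ∀ T' ∈ G, 0 ≤ diam T' ^ 4 * ((J T')⁻¹ * hessL2Sq T' v) := fun T' hT' =>
    mul_nonneg (by positivity) (mul_nonneg (inv_nonneg.2 (hJ T' ((hG _).1 hT').1).1.le)
      (IsCell.hessL2Sq_nonneg _ _))
  have hW : 0 ≤ W := hWeq ▸ Finset.sum_nonneg hterm
  have hM : 0 ≤ C₁ * √W := mul_nonneg hC₁ (Real.sqrt_nonneg _)
  have hpos : 0 < diam T := (hcell hT).diam_pos (by omega)
  have hb : ∀ T' ∈ cells K, (T ∩ T').Nonempty →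
      JetBound T' (diam T) (C₁ * √W) (q T' - r T') := by
    intro T' hT' hTT'
    have hT'G := (hG T').2 ⟨hT', hTT'⟩
    refine (hjet T' (hcell hT') (c T') (R T') (hR T' hT') (hball T' hT') (hsize T' hT') (diam T)
      hpos.le (hdiam T' hT'G) (J T') (hJ T' hT').1 (hJ T' hT').2 v (q T') (r T') (hq T' hT').1
      (hr T' hT').1 (by omega) (hq T' hT').2 fun z hz => ?_).mono ?_
    · rw [← (hq T' hT').2 z (mem_body_of_mem hz), ← (hr T' hT').2 z (mem_body_of_mem hz),
        hpv z (singleton_mem_faces hT'.1 hz)]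
    · exact mul_le_mul_of_nonneg_left (Real.sqrt_le_sqrt
        ((Finset.single_le_sum hterm hT'G).trans hWeq.ge)) hC₁
  have hdof := dofBound_error hdk hP hK hF hΩ.isOpen hΩ.convex hΩ.1 hv (fun T hT => (hq T hT).2)
    (fun T hT => (hr T hT).2) hT hg hpos hM hb
  have hsup := (hstab T (Finset.card_pos.1 (by rw [hT.2]; omega)) hT.2.le (diam T) hpos
    (fun x hx y hy => dist_le_diam (mem_body_of_mem hx) (mem_body_of_mem hy))
    (fun x hx y hy hxy => (hsize T hT).trans (mul_le_mul_of_nonneg_left (by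
      have := (hcell hT).two_mul_le_dist (hR T hT) (hball T hT) hx hy hxy
      have := hR T hT
      linarith) hσ.le))
    (q T - g) ((totalDegree_sub _ _).trans (max_le (hq T hT).1 hgdeg)) _ hM hdof).1
  have hl2 := l2Sq_le (hcell hT) (hJ T hT).1 (hJ T hT).2
    (w := fun x => v x - transfer K Ω k P tv te p x) (B := C₂ * (C₁ * √W)) fun x hx => by
      rw [(hq T hT).2 x hx, hgv x hx, ← map_sub]
      exact hsup x hx
  refine hl2.trans ?_
  -- The factor `J T` from the integration over `T` meets `(J T')⁻¹` from the neighbours, and the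
  -- quotient is bounded by shape regularity.
  have h1 : J T * W ≤ (σ * ρ) ^ d * ∑ T' ∈ G, diam T' ^ 4 * hessL2Sq T' v := by
    rw [hWeq, Finset.mul_sum, Finset.mul_sum]
    refine Finset.sum_le_sum fun T' hT' => ?_
    have hT'c := ((hG _).1 hT').1
    have h2 := jacobian_le (hcell hT) (hJ T hT).2 (hJ T' hT'c).1 (hJ T' hT'c).2 (hR T' hT'c)
      (hball T' hT'c) (hsize T' hT'c) (zero_le_one.trans hρ) (hdiam T' hT')
    have h3 : J T * (J T')⁻¹ ≤ (σ * ρ) ^ d := by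
      rwa [← div_eq_mul_inv, div_le_iff₀ (hJ T' hT'c).1]
    calc J T * (diam T' ^ 4 * ((J T')⁻¹ * hessL2Sq T' v))
        = J T * (J T')⁻¹ * (diam T' ^ 4 * hessL2Sq T' v) := by ring
      _ ≤ _ := mul_le_mul_of_nonneg_right h3
        (mul_nonneg (by positivity) (IsCell.hessL2Sq_nonneg _ _))
  calc J T * ((C₂ * (C₁ * √W)) ^ 2 * volume.real (refSimplex d))
      = (C₂ * C₁) ^ 2 * volume.real (refSimplex d) * (J T * √W ^ 2) := by ring
    _ = (C₂ * C₁) ^ 2 * volume.real (refSimplex d) * (J T * W) := by rw [Real.sq_sqrt hW]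
    _ ≤ (C₂ * C₁) ^ 2 * volume.real (refSimplex d) *
        ((σ * ρ) ^ d * ∑ T' ∈ G, diam T' ^ 4 * hessL2Sq T' v) :=
      mul_le_mul_of_nonneg_left h1 (by positivity)
    _ = _ := by ring

/-- After interchanging the sums, symmetry of the relation shows that each `a j` is counted at most
`n` times. -/
theorem sum_sum_filter_le {ι : Type*} (G : Finset ι) (p : ι → ι → Prop) [∀ i, DecidablePred (p i)]
    (hp : ∀ i j, p i j → p j i) {n : ℕ} (hn : ∀ i ∈ G, (G.filter (p i)).card ≤ n) {a : ι → ℝ}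
    (ha : ∀ i ∈ G, 0 ≤ a i) : ∑ i ∈ G, ∑ j ∈ G.filter (p i), a j ≤ n * ∑ i ∈ G, a i := by
  have h1 : ∑ i ∈ G, ∑ j ∈ G.filter (p i), a j = ∑ j ∈ G, ∑ i ∈ G.filter (p j), a j :=
    Finset.sum_comm' fun i j => by
      simp only [Finset.mem_filter]
      exact ⟨fun h => ⟨⟨h.1, hp _ _ h.2.2⟩, h.2.1⟩, fun h => ⟨h.1.1, h.2, hp _ _ h.1.2⟩⟩
  rw [h1, Finset.mul_sum]
  refine Finset.sum_le_sum fun j hj => ?_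
  rw [Finset.sum_const, nsmul_eq_mul]
  exact mul_le_mul_of_nonneg_right (by exact_mod_cast hn j hj) (ha j hj)

/-- The factor `h' ^ 4` of the local estimate turns the weight of one cell into that of a neighbour:
`h'² / h²` is at most `ρ²`, and `λ h'²` is already of the required form. -/
theorem weight_mul_le {h h' ρ lam : ℝ} (hh : 0 < h) (hh' : 0 ≤ h') (hρ : 1 ≤ ρ) (hlam : 0 < lam)
    (hle : h' ≤ ρ * h) :
    ((h ^ 2)⁻¹ + lam) ^ 2 * h' ^ 4 ≤ ρ ^ 4 * (1 + lam * h' ^ 2) ^ 2 := by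
  have h1 : (h ^ 2)⁻¹ * h' ^ 2 ≤ ρ ^ 2 := by
    rw [inv_mul_le_iff₀ (by positivity)]
    calc h' ^ 2 ≤ (ρ * h) ^ 2 := pow_le_pow_left₀ hh' hle 2
      _ = h ^ 2 * ρ ^ 2 := by ring
  have h2 : ((h ^ 2)⁻¹ + lam) * h' ^ 2 ≤ ρ ^ 2 * (1 + lam * h' ^ 2) := by
    have h3 : lam * h' ^ 2 ≤ ρ ^ 2 * (lam * h' ^ 2) :=
      le_mul_of_one_le_left (by positivity) (one_le_pow₀ hρ)
    linarith
  calc ((h ^ 2)⁻¹ + lam) ^ 2 * h' ^ 4 = (((h ^ 2)⁻¹ + lam) * h' ^ 2) ^ 2 := by ring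
    _ ≤ (ρ ^ 2 * (1 + lam * h' ^ 2)) ^ 2 := pow_le_pow_left₀ (by positivity) h2 2
    _ = _ := by ring

end LocalEstimate

end C0FEM

end

/-! ### Summation over the mesh -/

open C0FEM

theorem mainTheorem8 (d k : ℕ) (hdk : (d = 2 ∧ 3 ≤ k) ∨ (d = 3 ∧ 5 ≤ k))
    (P : C0FEM.DofChoice) (hP : P.IsAdmissible d k)
    (Ω : Set (C0FEM.E d)) (hΩ : C0FEM.IsConvexPolytopalDomain Ω) (σ : ℝ) :
    ∃ C : ℝ, 0 < C ∧
      ∀ K : Geometry.SimplicialComplex ℝ (C0FEM.E d),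
        C0FEM.IsTriangulation K Ω → C0FEM.IsShapeRegular K σ →
      ∀ (tv : C0FEM.E d → Module.Basis (Fin d) ℝ (C0FEM.E d))
        (te : Finset (C0FEM.E d) → Fin 2 → C0FEM.E d), C0FEM.IsFrame K tv te →
      ∀ lam : ℝ, 0 < lam →
      ∀ v : C0FEM.E d → ℝ, C0FEM.MemV K Ω k v →
        ∑ᶠ T ∈ C0FEM.cells K, ((C0FEM.diam T ^ 2)⁻¹ + lam) ^ 2 *
            C0FEM.l2Sq T (fun x =>
              v x - C0FEM.transfer K Ω k P tv te (C0FEM.nodalInterp K Ω v) x)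
          ≤ C * ∑ᶠ T ∈ C0FEM.cells K, (1 + lam * C0FEM.diam T ^ 2) ^ 2 *
            C0FEM.hessL2Sq T v := by
  classical
  have hd : 2 ≤ d := by omega
  -- For `σ ≤ 0` shape regularity excludes all cells, because their diameters are positive, and both
  -- sums are empty.
  rcases le_or_gt σ 0 with hσ | hσ
  · refine ⟨1, one_pos, fun K _ hreg tv te _ lam _ v _ => ?_⟩
    have hempty : cells K = ∅ := by
      refine Set.eq_empty_of_forall_notMem fun T hT => ?_
      obtain ⟨c, r, hr, hdiam, -⟩ := hreg T hT
      have h1 := (isCell_of_mem_cells hT).diam_pos (by omega)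
      exact absurd hdiam (not_le.2 ((mul_nonpos_of_nonpos_of_nonneg hσ hr.le).trans_lt h1))
    simp [hempty]
  obtain ⟨N, hN⟩ := exists_card_cells_le (d := d) (by omega) hσ
  obtain ⟨ρ, hρ, hdiam⟩ := exists_diam_le hd hσ
  obtain ⟨C, hC, hloc⟩ := exists_local_estimate hdk hP hσ hρ
  -- A neighbour shares one of the `d + 1` vertices of the cell, and each vertex lies in at most `N`
  -- cells. The summand `1` only makes the constant positive.
  refine ⟨C * ρ ^ 4 * ((d + 1) * N : ℕ) + 1, by positivity,
    fun K hK hreg tv te hF lam hlam v hv => ?_⟩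
  set G := hK.finite_cells.toFinset
  have hG : ∀ {T}, T ∈ G ↔ T ∈ cells K := hK.finite_cells.mem_toFinset
  rw [finsum_mem_eq_finite_toFinset_sum _ hK.finite_cells,
    finsum_mem_eq_finite_toFinset_sum _ hK.finite_cells]
  have hcomp : ∀ T ∈ G, ∀ T' ∈ G, (T ∩ T').Nonempty → diam T ≤ ρ * diam T' := by
    rintro T hT T' hT' ⟨z, hz⟩
    rw [Finset.mem_inter] at hz
    exact hdiam K Ω hΩ.convex hK hreg T (hG.1 hT) T' (hG.1 hT') z hz.1 hz.2
  set a := fun T => (1 + lam * diam T ^ 2) ^ 2 * hessL2Sq T v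
  have ha : ∀ T ∈ G, 0 ≤ a T := fun T _ =>
    mul_nonneg (by positivity) (IsCell.hessL2Sq_nonneg _ _)
  have hcell : ∀ T ∈ G, ((diam T ^ 2)⁻¹ + lam) ^ 2 *
      l2Sq T (fun x => v x - transfer K Ω k P tv te (nodalInterp K Ω v) x)
      ≤ C * ρ ^ 4 * ∑ T' ∈ G.filter fun T' => (T ∩ T').Nonempty, a T' := by
    intro T hT
    have h1 := hloc K Ω hΩ hK hreg tv te hF v hv T (hG.1 hT)
      (G.filter fun T' => (T ∩ T').Nonempty) (fun T' => by rw [Finset.mem_filter, hG])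
      fun T' hT' => hcomp T hT T' (Finset.mem_filter.1 hT').1 (Finset.mem_filter.1 hT').2
    refine (mul_le_mul_of_nonneg_left h1 (by positivity)).trans ?_
    rw [mul_left_comm, mul_assoc C]
    refine mul_le_mul_of_nonneg_left ?_ hC
    rw [Finset.mul_sum, Finset.mul_sum]
    refine Finset.sum_le_sum fun T' hT' => ?_
    rw [Finset.mem_filter] at hT'
    have h2 := weight_mul_le ((isCell_of_mem_cells (hG.1 hT)).diam_pos (by omega))
      (diam_nonneg T') hρ hlam
      (hcomp T' hT'.1 T hT (by rw [Finset.inter_comm]; exact hT'.2))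
    rw [← mul_assoc, ← mul_assoc]
    exact mul_le_mul_of_nonneg_right h2 (IsCell.hessL2Sq_nonneg _ _)
  have hcard : ∀ T ∈ G, (G.filter fun T' => (T ∩ T').Nonempty).card ≤ (d + 1) * N := by
    intro T hT
    have hsub : (G.filter fun T' => (T ∩ T').Nonempty)
        ⊆ T.biUnion fun z => G.filter fun T' => z ∈ T' := by
      intro T' hT'
      obtain ⟨hT'G, z, hz⟩ := Finset.mem_filter.1 hT'
      rw [Finset.mem_inter] at hz
      exact Finset.mem_biUnion.2 ⟨z, hz.1, Finset.mem_filter.2 ⟨hT'G, hz.2⟩⟩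
    refine (Finset.card_le_card hsub).trans ?_
    rw [← (hG.1 hT).2]
    refine Finset.card_biUnion_le_card_mul _ _ _ fun z _ => hN K hreg z _ fun T' hT' => ?_
    rw [Finset.mem_filter, hG] at hT'
    exact hT'
  calc _ ≤ ∑ T ∈ G, C * ρ ^ 4 * ∑ T' ∈ G.filter fun T' => (T ∩ T').Nonempty, a T' :=
        Finset.sum_le_sum hcell
    _ = C * ρ ^ 4 * ∑ T ∈ G, ∑ T' ∈ G.filter fun T' => (T ∩ T').Nonempty, a T' :=
        (Finset.mul_sum _ _ _).symm
    _ ≤ C * ρ ^ 4 * (((d + 1) * N : ℕ) * ∑ T ∈ G, a T) :=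
        mul_le_mul_of_nonneg_left (sum_sum_filter_le G (fun T T' => (T ∩ T').Nonempty)
          (fun T T' h => by rwa [Finset.inter_comm]) hcard ha) (by positivity)
    _ ≤ (C * ρ ^ 4 * ((d + 1) * N : ℕ) + 1) * ∑ T ∈ G, a T := by
        have := Finset.sum_nonneg ha
        linarith
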